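/- Let $0<q<1$ and $\alpha\in\mathbb{R}\setminus\{0\}$. Write $(a;q)_k=\prod_{j=0}^{k-1}(1-aq^j)$, $(a;q)_\infty=\prod_{j=0}^{\infty}(1-aq^j)$, $(a,b;q)_\infty=(a;q)_\infty(b;q)_\infty$, and let $${}_1\tilde\phi_1(0;b;q,z)=\sum_{k=0}^{\infty}\frac{(bq^k;q)_\infty}{(q;q)_k}(-1)^kq^{k(k-1)/2}z^k$$ be the regularized confluent basic hypergeometric series $(b;q)_\infty\,{}_1\phi_1(0;b;q,z)$. For $n\in\mathbb{Z}$ and $z\in\mathbb{C}\setminus\{0\}$ put $$f_n(z)=(-1)^n\alpha^{-n}q^{\frac12 n(n+1)}\,{}_1\tilde\phi_1\!\left(0;z^{-1}\alpha^{-1}q^{n+1};q,z\alpha^{-1}q^{n+1}\right).$$ Let $B$ be the discrete Schrödinger operator in $\ell^2(\mathbb{Z})$ (with standard basis $(e_n)_{n\in\mathbb{Z}}$) given by $$(B\psi)_n=\psi_{n-1}+\alpha q^{-n}\psi_n+\psi_{n+1},\qquad \mathrm{Dom}\,B=\{\psi\in\ell^2(\mathbb{Z}) : (q^{-n}\psi_n)_{n\in\mathbb{Z}}\in\ell^2(\mathbb{Z})\}.$$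 Then $B$ has a projection-valued spectral measure $E_B$ on the Borel sets of $\mathbb{R}$ (that is, $B=\int x\,dE_B(x)$), and any such measure satisfies, for all Borel sets $\mathcal{A}\subset\mathbb{R}$ and all $k,l\in\mathbb{Z}$, $$\langle e_k,E_B(\mathcal{A})e_l\rangle=\frac1{2\pi}\int_{\mathcal{A}_c}f_l(e^{i\phi})f_k(e^{i\phi})\left|\frac{(e^{2i\phi};q)_\infty}{(\alpha e^{i\phi},q\alpha^{-1}e^{-i\phi};q)_\infty}\right|^2d\phi$$ $$\qquad+\frac1{(q;q)_\infty^2}\sum_{m\in\mathcal{A}_d}(1-\alpha^{-2}q^{2m})\,\alpha^{2m}q^{-m(m+1)}f_l(\alpha^{-1}q^m)f_k(\alpha^{-1}q^m),$$ where the integral and the sum converge absolutely and $$\mathcal{A}_c=\{\phi\in[0,\pi] : 2\cos\phi\in[-2,2]\cap\mathcal{A}\},\qquad \mathcal{A}_d=\{m\in\mathbb{Z} : m>\lfloor\log_q|\alpha|\rfloor,\ \alpha^{-1}q^m+\alpha q^{-m}\in\mathcal{A}\}.$$ -/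

import Mathlib

open MeasureTheory

noncomputable section

/-- The Hilbert space `ℓ²(ℤ)` of complex square-summable bilateral sequences. -/
abbrev EllTwo : Type := lp (fun _ : ℤ => ℂ) 2

/-- The standard basis vector `e n` of `ℓ²(ℤ)`. -/
def stdBasis (n : ℤ) : EllTwo := lp.single 2 n (1 : ℂ)

/-! ### Basic hypergeometric notation -/

/-- The finite `q`-Pochhammer symbol `(a; q)_n = ∏_{j < n} (1 - a q^j)`. -/
def qPoch (a q : ℂ) (n : ℕ) : ℂ := ∏ j ∈ Finset.range n, (1 - a * q ^ j)

/-- The infinite `q`-Pochhammer symbol `(a; q)_∞ = ∏_{j ≥ 0} (1 - a q^j)`, for `|q| < 1`. -/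
def qPochInf (a q : ℂ) : ℂ := ∏' j : ℕ, (1 - a * q ^ j)

/-- The regularized confluent basic hypergeometric series
`(b; q)_∞ * ₁φ₁(a; b; q, z)
  = ∑_k (a; q)_k (b q^k; q)_∞ / (q; q)_k * (-1)^k q^{k(k-1)/2} z^k`.
The factor `(b; q)_∞ / (b; q)_k` is written as `(b q^k; q)_∞`, so that the function is defined
(and entire) in `b`, including at `b = q^{-N}`, where the unregularized series has poles. -/
def phiReg (a b q z : ℂ) : ℂ :=
  ∑' k : ℕ, qPoch a q k * qPochInf (b * q ^ k) q / qPoch q q k *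
    ((-1) ^ k * q ^ (k * (k - 1) / 2) * z ^ k)

/-- `f_n(z) = (-1)^n α^{-n} q^{n(n+1)/2} ₁φ̃₁(0; z⁻¹ α⁻¹ q^{n+1}; q, z α⁻¹ q^{n+1})`.
The integer `n(n+1)` is even, so the integer division by `2` is exact. -/
def solF (q α : ℝ) (n : ℤ) (z : ℂ) : ℂ :=
  (-1) ^ n * (α : ℂ) ^ (-n) * (q : ℂ) ^ (n * (n + 1) / 2) *
    phiReg 0 (z⁻¹ * (α : ℂ)⁻¹ * (q : ℂ) ^ (n + 1)) q (z * (α : ℂ)⁻¹ * (q : ℂ) ^ (n + 1))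

/-! ### The operator -/

theorem memlp_shift (ψ : EllTwo) (c : ℤ) : Memℓp (fun n : ℤ => ψ (n + c)) 2 := by
  have h := lp.memℓp ψ
  rw [memℓp_gen_iff (by norm_num)] at h ⊢
  exact (Equiv.addRight c).summable_iff.mpr h

/-- The domain of the multiplication operator `V e_n = q^{-n} e_n`:
all `ψ ∈ ℓ²(ℤ)` with `(q^{-n} ψ_n)_n ∈ ℓ²(ℤ)`. -/
def potentialDomain (q : ℝ) : Submodule ℂ EllTwo where
  carrier := {ψ | Memℓp (fun n : ℤ => (q : ℂ) ^ (-n) * ψ n) 2}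
  add_mem' := by
    intro ψ χ hψ hχ
    have h := Memℓp.add hψ hχ
    refine (congrArg (fun g : ℤ → ℂ => Memℓp g 2) ?_).mp h
    funext n
    simp [mul_add]
  zero_mem' := by
    have h : Memℓp (0 : ∀ _ : ℤ, ℂ) 2 := zero_memℓp
    refine (congrArg (fun g : ℤ → ℂ => Memℓp g 2) ?_).mp h
    funext n
    simp
  smul_mem' := by
    intro c ψ hψ
    have h := Memℓp.const_smul hψ c
    refine (congrArg (fun g : ℤ → ℂ => Memℓp g 2) ?_).mp h
    funext n
    simp [mul_left_comm]

/-- The discrete Schrödinger operator `B = U + U* + α V` in `ℓ²(ℤ)`, with domain `Dom V`: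
`(B ψ)_n = ψ_{n-1} + α q^{-n} ψ_n + ψ_{n+1}`. -/
def schrodingerB (q α : ℝ) : EllTwo →ₗ.[ℂ] EllTwo where
  domain := potentialDomain q
  toFun :=
    { toFun := fun ψ =>
        ⟨fun n => (ψ : EllTwo) (n + -1) + (α : ℂ) * ((q : ℂ) ^ (-n) * (ψ : EllTwo) n)
            + (ψ : EllTwo) (n + 1),
          ((memlp_shift ψ.1 (-1)).add (Memℓp.const_smul ψ.2 (α : ℂ))).add (memlp_shift ψ.1 1)⟩
      map_add' := by
        intro ψ χ
        ext n
        rw [lp.coeFn_add, Pi.add_apply]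
        simp only [Submodule.coe_add, lp.coeFn_add, Pi.add_apply]
        ring
      map_smul' := by
        intro c ψ
        ext n
        simp
        ring }

/-! ### Spectral measures of unbounded operators -/

section Spectral

variable {H : Type*} [NormedAddCommGroup H] [InnerProductSpace ℂ H] [CompleteSpace H]

/-- A projection-valued measure on the Borel sets of `ℝ`: a map from Borel sets to orthogonal
projections of `H`, with value the identity at `ℝ`, countably additive in the strong operator
topology. -/
structure ProjValuedMeasure (H : Type*) [NormedAddCommGroup H] [InnerProductSpace ℂ H]
    [CompleteSpace H] where
  toFun : Set ℝ → H →L[ℂ] H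
  isProj : ∀ A, MeasurableSet A → IsStarProjection (toFun A)
  map_univ : toFun Set.univ = 1
  hasSum : ∀ A : ℕ → Set ℝ, (∀ i, MeasurableSet (A i)) → Pairwise (Function.onFun Disjoint A) →
    ∀ ψ : H, HasSum (fun i => toFun (A i) ψ) (toFun (⋃ i, A i) ψ)

namespace ProjValuedMeasure

variable (E : ProjValuedMeasure H)

theorem map_empty (ψ : H) : E.toFun ∅ ψ = 0 := by
  have h := E.hasSum (fun _ => ∅) (fun _ => MeasurableSet.empty)
    (fun _ _ _ => disjoint_bot_left) ψ
  exact tendsto_nhds_unique tendsto_const_nhds h.summable.tendsto_atTop_zero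

theorem re_inner_nonneg {A : Set ℝ} (hA : MeasurableSet A) (ψ : H) :
    0 ≤ (inner ℂ ψ (E.toFun A ψ)).re :=
  (ContinuousLinearMap.nonneg_iff_isPositive _ |>.mp (E.isProj A hA).nonneg).re_inner_nonneg_right ψ

/-- The scalar measure `A ↦ ⟨ψ, E(A) ψ⟩`. -/
def scalar (ψ : H) : Measure ℝ :=
  Measure.ofMeasurable (fun A _ => ENNReal.ofReal (inner ℂ ψ (E.toFun A ψ)).re)
    (by simp [E.map_empty])
    (by
      intro A hA hd
      have h := E.hasSum A hA hd ψ
      have h1 : HasSum (fun i => (inner ℂ ψ (E.toFun (A i) ψ)).re)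
          (inner ℂ ψ (E.toFun (⋃ i, A i) ψ)).re :=
        (h.mapL (innerSL ℂ ψ)).mapL Complex.reCLM
      rw [← h1.tsum_eq]
      exact ENNReal.ofReal_tsum_of_nonneg (fun i => E.re_inner_nonneg (hA i) ψ) h1.summable)

/-- `E` is the spectral measure of the operator `T`, that is `T = ∫ x dE(x)`: the domain of `T`
consists of all `ψ` with `∫ x² d⟨ψ, E(x) ψ⟩ < ∞`, and `⟨ψ, T ψ⟩ = ∫ x d⟨ψ, E(x) ψ⟩` for `ψ` in
the domain (by polarization, this determines `T`). -/
structure IsSpectralMeasureOf (T : H →ₗ.[ℂ] H) : Prop where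
  mem_domain_iff : ∀ ψ : H, ψ ∈ T.domain ↔ Integrable (fun x : ℝ => x ^ 2) (E.scalar ψ)
  inner_apply : ∀ ψ : T.domain, inner ℂ (ψ : H) (T ψ) = ((∫ x, x ∂(E.scalar (ψ : H)) : ℝ) : ℂ)

end ProjValuedMeasure

end Spectral

/-! ### The ingredients of the formula -/

/-- The weight `|(e^{2iφ}; q)_∞ / (α e^{iφ}, q α⁻¹ e^{-iφ}; q)_∞|²`. -/
def acWeight (q α φ : ℝ) : ℝ :=
  ‖qPochInf (Complex.exp (2 * Complex.I * φ)) q /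
    (qPochInf (α * Complex.exp (Complex.I * φ)) q *
      qPochInf (q * (α : ℂ)⁻¹ * Complex.exp (-(Complex.I * φ))) q)‖ ^ 2

/-- The integrand `f_l(e^{iφ}) f_k(e^{iφ}) |…|²` of the absolutely continuous part. -/
def acIntegrand (q α : ℝ) (k l : ℤ) (φ : ℝ) : ℂ :=
  solF q α l (Complex.exp (Complex.I * φ)) * solF q α k (Complex.exp (Complex.I * φ)) *
    (acWeight q α φ : ℂ)

/-- The term `(1 - α⁻² q^{2m}) α^{2m} q^{-m(m+1)} f_l(α⁻¹ q^m) f_k(α⁻¹ q^m)`. -/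
def discreteTerm (q α : ℝ) (k l m : ℤ) : ℂ :=
  (1 - (α : ℂ) ^ (-2 : ℤ) * (q : ℂ) ^ (2 * m)) * (α : ℂ) ^ (2 * m) * (q : ℂ) ^ (-(m * (m + 1))) *
    solF q α l ((α : ℂ)⁻¹ * (q : ℂ) ^ m) * solF q α k ((α : ℂ)⁻¹ * (q : ℂ) ^ m)

/-- `{φ ∈ [0, π] | 2 cos φ ∈ [-2, 2] ∩ 𝒜}`. -/
def acSet (𝒜 : Set ℝ) : Set ℝ :=
  {φ | φ ∈ Set.Icc 0 Real.pi ∧ 2 * Real.cos φ ∈ Set.Icc (-2) 2 ∩ 𝒜}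

/-- `{m ∈ ℤ | m > ⌊log_q |α|⌋, α⁻¹ q^m + α q^{-m} ∈ 𝒜}`. -/
def discreteSet (q α : ℝ) (𝒜 : Set ℝ) : Set ℤ :=
  {m | ⌊Real.logb q |α|⌋ < m ∧ α⁻¹ * q ^ m + α * q ^ (-m) ∈ 𝒜}

end

/-! Put `x = z + z⁻¹`. The sequence `f_n(z)` solves the eigenvalue equation of `B` and is recessive
at `+∞`. The formula says that `e_n ↦ f_n` turns `B` into multiplication by `x` in `L²(μ)`, where
`μ` is the sum of the absolutely continuous and the discrete measure that appear in it. The proof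
has three ingredients.

Orthonormality of the `f_n` in `L²(μ)` (`spectral_orthonormality`). A second solution `g_n(z)`
(`solG`) behaves like `z^{-n}` at `-∞`. Casorati determinants yield a connection formula
(`solF_connection`) that writes `f_n` through `g_n(z)` and `g_n(z⁻¹)` with theta function
coefficients. On the unit circle it splits the continuous integrand into `H(z) + H(z⁻¹)` with `H(z)
= f_l(z) (1 - z²) g_k(z) / θ(αz)`, so the integral is the average of `H` over the unit circle.
Shrinking this circle to the origin crosses the simple poles `α⁻¹ q^m`. There `g_k` is a multiple of
`f_k` (`solG_eigenvalue`), and the average jumps by exactly the discrete term. On circles midway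
between the poles `H` tends to `δ_{kl}` if `k ≤ l`, which suffices by symmetry.

Existence. Orthonormality makes `Φ : e_n ↦ f_n` an isometry, and the recurrence makes it intertwine
`B` with multiplication by `x`. Completeness of the `f_n` in `L²(μ)` is not needed: `B - z` is onto
for nonreal `z`, so the range of `Φ` is invariant under `(x - z)⁻¹` and, by Stieltjes inversion,
under multiplication by indicators (`LinearIsometry.exists_eq_of_ae_mul`). Pulling these back gives
a spectral measure with matrix elements `∫_A f_k f_l dμ`, the `f_n` being real on the support of
`μ`.

Uniqueness (`ProjValuedMeasure.IsSpectralMeasureOf.toFun_eq`). Let `E` be any spectral measure of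
`B` and `I = [c - r, c + r]`. On the range of `E(I)` the operator `B - c` is symmetric with norm at
most `r`. Iterating it forces `Φψ` to live on `I`, so `E(I)` is dominated by the projection
constructed above. Comparing half-lines, whose masses add up to `‖ψ‖²` for both measures, gives
equality. -/

open Filter Topology

/-! ### Infinite `q`-Pochhammer symbols -/

section QSeries

variable {q : ℂ}

theorem qPoch_succ (a q : ℂ) (n : ℕ) : qPoch a q (n + 1) = qPoch a q n * (1 - a * q ^ n) :=
  Finset.prod_range_succ _ _

theorem qPoch_zero_left (q : ℂ) (n : ℕ) : qPoch 0 q n = 1 := by simp [qPoch]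

theorem summable_mul_pow_norm (hq : ‖q‖ < 1) (a : ℂ) : Summable fun j : ℕ => ‖-(a * q ^ j)‖ := by
  simpa [norm_mul, norm_pow] using (summable_geometric_of_lt_one (norm_nonneg q) hq).mul_left ‖a‖

theorem hasProd_qPochInf (hq : ‖q‖ < 1) (a : ℂ) :
    HasProd (fun j : ℕ => 1 - a * q ^ j) (qPochInf a q) := by
  have h := multipliable_one_add_of_summable (summable_mul_pow_norm hq a)
  simpa [sub_eq_add_neg, qPochInf] using h.hasProd

theorem tendsto_qPoch (hq : ‖q‖ < 1) (a : ℂ) :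
    Tendsto (fun n => qPoch a q n) atTop (𝓝 (qPochInf a q)) :=
  (hasProd_qPochInf hq a).tendsto_prod_nat

theorem qPochInf_eq_qPoch_mul (hq : ‖q‖ < 1) (a : ℂ) (n : ℕ) :
    qPochInf a q = qPoch a q n * qPochInf (a * q ^ n) q := by
  have h1 := (tendsto_qPoch hq a).comp (tendsto_add_atTop_nat n)
  have h2 := (tendsto_qPoch hq (a * q ^ n)).const_mul (qPoch a q n)
  refine tendsto_nhds_unique h1 (h2.congr fun m => ?_)
  simp only [Function.comp, qPoch]
  rw [add_comm m n, Finset.prod_range_add]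
  simp [pow_add, mul_assoc]

theorem qPochInf_eq_mul (hq : ‖q‖ < 1) (a : ℂ) :
    qPochInf a q = (1 - a) * qPochInf (a * q) q := by
  simpa [qPoch] using qPochInf_eq_qPoch_mul hq a 1

theorem qPochInf_zero (q : ℂ) : qPochInf 0 q = 1 := by simp [qPochInf]

theorem one_sub_pow_ne_zero (hq : ‖q‖ < 1) (k : ℕ) : 1 - q ^ (k + 1) ≠ 0 := by
  intro h
  have : ‖q ^ (k + 1)‖ = 1 := by rw [← sub_eq_zero.mp h]; simp
  rw [norm_pow] at this
  exact (pow_lt_one₀ (norm_nonneg q) hq (Nat.succ_ne_zero k)).ne this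

theorem qPoch_self_ne_zero (hq : ‖q‖ < 1) (k : ℕ) : qPoch q q k ≠ 0 := by
  rw [qPoch, Finset.prod_ne_zero_iff]
  intro j _
  simpa [pow_succ'] using one_sub_pow_ne_zero hq j

/-! ### Euler's series -/

/-- The coefficient `(-1)^k q^{k(k-1)/2} / (q; q)_k` of Euler's expansion of `(b; q)_∞`. -/
noncomputable def eulerCoeff (q : ℂ) (k : ℕ) : ℂ :=
  (-1) ^ k * q ^ (k * (k - 1) / 2) / qPoch q q k

theorem eulerCoeff_zero (q : ℂ) : eulerCoeff q 0 = 1 := by simp [eulerCoeff, qPoch]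

theorem triangle_succ (k : ℕ) : (k + 1) * (k + 1 - 1) / 2 = k * (k - 1) / 2 + k := by
  rw [Nat.triangle_succ]

theorem eulerCoeff_succ (hq : ‖q‖ < 1) (k : ℕ) :
    eulerCoeff q (k + 1) * (1 - q ^ (k + 1)) = -(q ^ k * eulerCoeff q k) := by
  have h1 := qPoch_self_ne_zero hq k
  have h2 := one_sub_pow_ne_zero hq k
  rw [eulerCoeff, eulerCoeff, triangle_succ, qPoch_succ, ← pow_succ']
  field_simp
  ring

theorem one_sub_norm_le (hq : ‖q‖ < 1) (k : ℕ) : 1 - ‖q‖ ≤ ‖1 - q ^ (k + 1)‖ := by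
  have h1 : ‖(1 : ℂ)‖ - ‖q ^ (k + 1)‖ ≤ ‖1 - q ^ (k + 1)‖ := norm_sub_norm_le _ _
  have h2 : ‖q‖ ^ (k + 1) ≤ ‖q‖ := pow_le_of_le_one (norm_nonneg q) hq.le (Nat.succ_ne_zero k)
  rw [norm_one, norm_pow] at h1
  linarith

theorem norm_eulerCoeff_succ_le (hq : ‖q‖ < 1) (k : ℕ) :
    ‖eulerCoeff q (k + 1)‖ ≤ ‖q‖ ^ k / (1 - ‖q‖) * ‖eulerCoeff q k‖ := by
  have h := congrArg norm (eulerCoeff_succ hq k)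
  rw [norm_mul, norm_neg, norm_mul, norm_pow] at h
  have h1 := one_sub_norm_le hq k
  have h2 : 0 < 1 - ‖q‖ := by linarith
  rw [div_mul_eq_mul_div, le_div_iff₀ h2, ← h]
  gcongr

/-- Euler coefficients decay superexponentially. -/
theorem summable_eulerCoeff_mul_pow (hq : ‖q‖ < 1) (x : ℝ) :
    Summable fun k => ‖eulerCoeff q k‖ * |x| ^ k := by
  have h2 : 0 < 1 - ‖q‖ := by linarith
  have ht : Tendsto (fun k : ℕ => ‖q‖ ^ k / (1 - ‖q‖) * |x|) atTop (𝓝 (0 / (1 - ‖q‖) * |x|)) :=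
    ((tendsto_pow_atTop_nhds_zero_of_lt_one (norm_nonneg q) hq).div_const _).mul_const _
  rw [zero_div, zero_mul] at ht
  have hev := ht.eventually (ge_mem_nhds (show (0 : ℝ) < 1 / 2 by norm_num))
  refine summable_of_ratio_norm_eventually_le (r := 1 / 2) (by norm_num) ?_
  filter_upwards [hev] with k hk
  rw [norm_mul, norm_mul, norm_norm, norm_norm, norm_pow, norm_pow, norm_abs_eq_norm,
    Real.norm_eq_abs, pow_succ]
  calc ‖eulerCoeff q (k + 1)‖ * (|x| ^ k * |x|)
      ≤ (‖q‖ ^ k / (1 - ‖q‖) * ‖eulerCoeff q k‖) * (|x| ^ k * |x|) := by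
        gcongr; exact norm_eulerCoeff_succ_le hq k
    _ = (‖q‖ ^ k / (1 - ‖q‖) * |x|) * (‖eulerCoeff q k‖ * |x| ^ k) := by ring
    _ ≤ 1 / 2 * (‖eulerCoeff q k‖ * |x| ^ k) := by gcongr

theorem summable_euler (hq : ‖q‖ < 1) (b : ℂ) : Summable fun k => eulerCoeff q k * b ^ k := by
  refine Summable.of_norm ?_
  simpa [norm_mul, norm_pow] using summable_eulerCoeff_mul_pow hq ‖b‖

theorem continuous_euler (hq : ‖q‖ < 1) : Continuous fun b => ∑' k, eulerCoeff q k * b ^ k := by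
  rw [← continuousOn_univ]
  refine continuousOn_of_forall_continuousAt fun b _ => ?_
  have : ContinuousOn (fun b => ∑' k, eulerCoeff q k * b ^ k) (Metric.ball 0 (‖b‖ + 1)) := by
    refine continuousOn_tsum (fun k => by fun_prop)
      (summable_eulerCoeff_mul_pow hq (‖b‖ + 1)) fun k z hz => ?_
    rw [norm_mul, norm_pow, abs_of_pos (by positivity)]
    have := (mem_ball_zero_iff.mp hz).le
    gcongr
  exact this.continuousAt (Metric.isOpen_ball.mem_nhds (by simp))

/-- Euler's identity `(b; q)_∞ = ∑ (-1)^k q^{k(k-1)/2} b^k / (q; q)_k`. -/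
theorem qPochInf_eq_tsum (hq : ‖q‖ < 1) (b : ℂ) :
    qPochInf b q = ∑' k, eulerCoeff q k * b ^ k := by
  set F : ℂ → ℂ := fun b => ∑' k, eulerCoeff q k * b ^ k with hF
  -- The series satisfies the same `q`-difference equation as the product. Iterating it and using
  -- continuity at `0` with `F 0 = 1` identifies the two.
  have hstep : ∀ b, F b = (1 - b) * F (b * q) := by
    intro b
    have h1 : F b - F (b * q) = ∑' k, eulerCoeff q k * (1 - q ^ k) * b ^ k := by
      rw [hF, ← (summable_euler hq b).tsum_sub (summable_euler hq (b * q))]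
      exact tsum_congr fun k => by ring
    have hs : Summable fun k => eulerCoeff q k * (1 - q ^ k) * b ^ k := by
      refine ((summable_euler hq b).sub (summable_euler hq (b * q))).congr fun k => by ring
    have h2 : ∑' k, eulerCoeff q k * (1 - q ^ k) * b ^ k = -b * F (b * q) := by
      rw [hs.tsum_eq_zero_add, hF, ← tsum_mul_left]
      simp only [pow_zero, sub_self, mul_zero, zero_mul, zero_add]
      refine tsum_congr fun k => ?_
      rw [eulerCoeff_succ hq k]
      ring
    rw [h2] at h1
    linear_combination h1
  have hiter : ∀ n, F b = qPoch b q n * F (b * q ^ n) := by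
    intro n
    induction n with
    | zero => simp [qPoch]
    | succ n ih => rw [ih, hstep (b * q ^ n), qPoch_succ]; ring_nf
  have hlim : Tendsto (fun n => qPoch b q n * F (b * q ^ n)) atTop (𝓝 (qPochInf b q * F 0)) := by
    refine (tendsto_qPoch hq b).mul ((continuous_euler hq).continuousAt.tendsto.comp ?_)
    simpa using (tendsto_pow_atTop_nhds_zero_of_norm_lt_one hq).const_mul b
  have h0 : F 0 = 1 := by
    simp only [hF]
    rw [tsum_eq_single 0 (by intro k hk; simp [hk])]
    simp [eulerCoeff_zero]
  rw [h0, mul_one] at hlim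
  exact (tendsto_nhds_unique (tendsto_const_nhds.congr hiter) hlim).symm

theorem continuous_qPochInf (hq : ‖q‖ < 1) : Continuous fun b => qPochInf b q := by
  simpa only [← qPochInf_eq_tsum hq] using continuous_euler hq

/-- The tails `(b q^n; q)_∞` tend to `1`, so one of them is nonzero, and only finitely many factors
remain. -/
theorem qPochInf_ne_zero (hq : ‖q‖ < 1) {b : ℂ} (hb : ∀ j : ℕ, 1 - b * q ^ j ≠ 0) :
    qPochInf b q ≠ 0 := by
  have h : Tendsto (fun n => qPochInf (b * q ^ n) q) atTop (𝓝 1) := by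
    rw [← qPochInf_zero q]
    refine ((continuous_qPochInf hq).continuousAt (x := 0)).tendsto.comp ?_
    simpa using (tendsto_pow_atTop_nhds_zero_of_norm_lt_one hq).const_mul b
  obtain ⟨n, hn⟩ := (h.eventually_ne one_ne_zero).exists
  rw [qPochInf_eq_qPoch_mul hq b n]
  exact mul_ne_zero (Finset.prod_ne_zero_iff.mpr fun j _ => hb j) hn

/-! ### The regularized confluent series -/

theorem phiReg_zero_eq (b q w : ℂ) :
    phiReg 0 b q w = ∑' k, qPochInf (b * q ^ k) q * (eulerCoeff q k * w ^ k) := by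
  refine tsum_congr fun k => ?_
  rw [qPoch_zero_left, eulerCoeff]
  ring

theorem summable_phiReg_double (hq : ‖q‖ < 1) (x y : ℝ) :
    Summable fun p : ℕ × ℕ => (‖eulerCoeff q p.1‖ * |x| ^ p.1) * (‖eulerCoeff q p.2‖ * |y| ^ p.2) :=
  Summable.mul_of_nonneg (summable_eulerCoeff_mul_pow hq x) (summable_eulerCoeff_mul_pow hq y)
    (fun _ => by positivity) (fun _ => by positivity)

theorem norm_double_term_le (hq : ‖q‖ < 1) {x y : ℝ} {b w : ℂ} (hb : ‖b‖ ≤ |x|) (hw : ‖w‖ ≤ |y|)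
    (p : ℕ × ℕ) :
    ‖eulerCoeff q p.1 * eulerCoeff q p.2 * q ^ (p.1 * p.2) * b ^ p.1 * w ^ p.2‖ ≤
      (‖eulerCoeff q p.1‖ * |x| ^ p.1) * (‖eulerCoeff q p.2‖ * |y| ^ p.2) := by
  simp only [norm_mul, norm_pow]
  have : ‖q‖ ^ (p.1 * p.2) ≤ 1 := pow_le_one₀ (norm_nonneg q) hq.le
  calc _ ≤ ‖eulerCoeff q p.1‖ * ‖eulerCoeff q p.2‖ * 1 * |x| ^ p.1 * |y| ^ p.2 := by gcongr
    _ = _ := by ring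

theorem summable_double (hq : ‖q‖ < 1) (b w : ℂ) : Summable fun p : ℕ × ℕ =>
    eulerCoeff q p.1 * eulerCoeff q p.2 * q ^ (p.1 * p.2) * b ^ p.1 * w ^ p.2 :=
  Summable.of_norm_bounded (summable_phiReg_double hq ‖b‖ ‖w‖)
    (norm_double_term_le hq (by simp) (by simp))

/-- The symmetric double series for `phiReg 0 b q w`. -/
theorem phiReg_eq_double (hq : ‖q‖ < 1) (b w : ℂ) :
    phiReg 0 b q w = ∑' p : ℕ × ℕ,
      eulerCoeff q p.1 * eulerCoeff q p.2 * q ^ (p.1 * p.2) * b ^ p.1 * w ^ p.2 := by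
  have hs := summable_double hq b w
  have h := ((Equiv.prodComm ℕ ℕ).summable_iff.mpr hs).tsum_prod
  rw [phiReg_zero_eq]
  refine Eq.trans (tsum_congr fun k => ?_) (h.symm.trans
    ((Equiv.prodComm ℕ ℕ).tsum_eq fun p : ℕ × ℕ =>
      eulerCoeff q p.1 * eulerCoeff q p.2 * q ^ (p.1 * p.2) * b ^ p.1 * w ^ p.2))
  rw [qPochInf_eq_tsum hq, ← tsum_mul_right]
  refine tsum_congr fun j => ?_
  simp only [Function.comp, Equiv.prodComm_apply, Prod.swap_prod_mk, mul_pow, pow_mul']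
  rw [pow_right_comm]
  ring

/-- The double series is symmetric. This turns each relation in `w` into one in `b`, and it is the
source of `f_n(z⁻¹) = f_n(z)`. -/
theorem phiReg_symm (hq : ‖q‖ < 1) (b w : ℂ) : phiReg 0 b q w = phiReg 0 w q b := by
  rw [phiReg_eq_double hq, phiReg_eq_double hq, ← (Equiv.prodComm ℕ ℕ).tsum_eq]
  refine tsum_congr fun p => ?_
  simp only [Equiv.prodComm_apply, Prod.fst_swap, Prod.snd_swap, mul_comm p.2 p.1]
  ring

theorem phiReg_zero_right (b q : ℂ) : phiReg 0 b q 0 = qPochInf b q := by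
  rw [phiReg_zero_eq, tsum_eq_single 0 (by intro k hk; simp [hk])]
  simp [eulerCoeff_zero]

theorem continuous_phiReg (hq : ‖q‖ < 1) : Continuous fun p : ℂ × ℂ => phiReg 0 p.1 q p.2 := by
  simp only [phiReg_eq_double hq]
  rw [← continuousOn_univ]
  refine continuousOn_of_forall_continuousAt fun b _ => ?_
  have : ContinuousOn (fun b : ℂ × ℂ => ∑' p : ℕ × ℕ,
      eulerCoeff q p.1 * eulerCoeff q p.2 * q ^ (p.1 * p.2) * b.1 ^ p.1 * b.2 ^ p.2)
      (Metric.ball 0 (‖b‖ + 1)) := by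
    refine continuousOn_tsum (fun k => by fun_prop)
      (summable_phiReg_double hq (‖b‖ + 1) (‖b‖ + 1)) fun k z hz => ?_
    have hz' := (mem_ball_zero_iff.mp hz).le
    refine norm_double_term_le hq ?_ ?_ k
    · rw [abs_of_pos (by positivity)]; exact (norm_fst_le z).trans hz'
    · rw [abs_of_pos (by positivity)]; exact (norm_snd_le z).trans hz'
  exact this.continuousAt (Metric.isOpen_ball.mem_nhds (by simp))

theorem _root_.Filter.Tendsto.comp_two_of_continuous {G : ℂ → ℂ → ℂ} {ι : Type*} {l : Filter ι}
    {f g : ι → ℂ} {b w : ℂ} (hf : Tendsto f l (𝓝 b))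
    (hG : Continuous fun p : ℂ × ℂ => G p.1 p.2) (hg : Tendsto g l (𝓝 w)) :
    Tendsto (fun i => G (f i) (g i)) l (𝓝 (G b w)) :=
  Tendsto.comp (hG.tendsto (b, w)) (hf.prodMk_nhds hg)

theorem tendsto_phiReg (hq : ‖q‖ < 1) {ι : Type*} {l : Filter ι} {f g : ι → ℂ} {b w : ℂ}
    (hf : Tendsto f l (𝓝 b)) (hg : Tendsto g l (𝓝 w)) :
    Tendsto (fun i => phiReg 0 (f i) q (g i)) l (𝓝 (phiReg 0 b q w)) := by
  exact Tendsto.comp_two_of_continuous (G := fun b w => phiReg 0 b q w) hf (continuous_phiReg hq) hg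

theorem differentiableAt_phiReg (hq : ‖q‖ < 1) {u v : ℂ → ℂ} {U : Set ℂ} (hU : IsOpen U)
    (hu : DifferentiableOn ℂ u U) (hv : DifferentiableOn ℂ v U) {z : ℂ} (hz : z ∈ U) :
    DifferentiableAt ℂ (fun z => phiReg 0 (u z) q (v z)) z := by
  set M := max ‖u z‖ ‖v z‖ + 1
  have hM : 0 < M := by positivity
  have hnu : ∀ᶠ x in 𝓝 z, ‖u x‖ < M := by
    refine ((hu.differentiableAt (hU.mem_nhds hz)).continuousAt.norm).eventually_lt_const ?_
    exact (le_max_left _ _).trans_lt (lt_add_one _)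
  have hnv : ∀ᶠ x in 𝓝 z, ‖v x‖ < M := by
    refine ((hv.differentiableAt (hU.mem_nhds hz)).continuousAt.norm).eventually_lt_const ?_
    exact (le_max_right _ _).trans_lt (lt_add_one _)
  obtain ⟨V, hV, hVo, hzV⟩ := eventually_nhds_iff.mp ((hnu.and hnv).and (hU.eventually_mem hz))
  simp only [phiReg_eq_double hq]
  have hu' : DifferentiableOn ℂ u V := hu.mono fun x hx => (hV x hx).2
  have hv' : DifferentiableOn ℂ v V := hv.mono fun x hx => (hV x hx).2
  have : DifferentiableOn ℂ (fun x => ∑' p : ℕ × ℕ,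
      eulerCoeff q p.1 * eulerCoeff q p.2 * q ^ (p.1 * p.2) * u x ^ p.1 * v x ^ p.2) V := by
    refine Complex.differentiableOn_tsum_of_summable_norm (summable_phiReg_double hq M M)
      (fun p => by fun_prop) hVo fun p x hx => norm_double_term_le hq ?_ ?_ p
    · rw [abs_of_pos hM]; exact (hV x hx).1.1.le
    · rw [abs_of_pos hM]; exact (hV x hx).1.2.le
  exact this.differentiableAt (hVo.mem_nhds hzV)

theorem differentiable_qPochInf (hq : ‖q‖ < 1) : Differentiable ℂ fun b => qPochInf b q := by
  intro b
  simpa only [phiReg_zero_right, id] using differentiableAt_phiReg hq isOpen_univ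
    differentiableOn_id (differentiableOn_const 0) (Set.mem_univ b)

/-- Subtracting termwise produces the factor `1 - q^k`, which the recursion of the Euler
coefficients absorbs together with a shift of the index. -/
theorem phiReg_contiguous_right (hq : ‖q‖ < 1) (b w : ℂ) :
    phiReg 0 b q w - phiReg 0 b q (q * w) = -w * phiReg 0 (q * b) q (q * w) := by
  have hs : ∀ b w : ℂ, Summable fun k => qPochInf (b * q ^ k) q * (eulerCoeff q k * w ^ k) := by
    intro b w
    have h := ((Equiv.prodComm ℕ ℕ).summable_iff.mpr (summable_double hq b w)).prod
    refine h.congr fun k => ?_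
    rw [qPochInf_eq_tsum hq, ← tsum_mul_right]
    refine tsum_congr fun j => ?_
    simp only [Function.comp, Equiv.prodComm_apply, Prod.swap_prod_mk, mul_pow, pow_mul']
    rw [pow_right_comm]
    ring
  simp only [phiReg_zero_eq]
  have h1 := hs b w
  have h2 := hs b (q * w)
  rw [← h1.tsum_sub h2, (h1.sub h2).tsum_eq_zero_add, ← tsum_mul_left]
  simp only [pow_zero, sub_self, zero_add]
  refine tsum_congr fun k => ?_
  have := eulerCoeff_succ hq k
  rw [show b * q ^ (k + 1) = q * b * q ^ k by ring]
  linear_combination (qPochInf (q * b * q ^ k) q * w ^ (k + 1)) * this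

theorem phiReg_contiguous_left (hq : ‖q‖ < 1) (b w : ℂ) :
    phiReg 0 b q w - phiReg 0 (q * b) q w = -b * phiReg 0 (q * b) q (q * w) := by
  have h := phiReg_contiguous_right hq w b
  rwa [phiReg_symm hq w, phiReg_symm hq w, phiReg_symm hq (q * w)] at h

/-- Both arguments are multiplied by `q` simultaneously, as happens in `solF` when `n` increases by
one. -/
theorem phiReg_diagonal (hq : ‖q‖ < 1) (b w : ℂ) :
    phiReg 0 b q w = (1 - w - b) * phiReg 0 (q * b) q (q * w) -
      q * b * w * phiReg 0 (q * (q * b)) q (q * (q * w)) := by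
  have h1 := phiReg_contiguous_right hq b w
  have h2 := phiReg_contiguous_left hq b (q * w)
  have h3 := phiReg_contiguous_right hq (q * b) (q * w)
  linear_combination h1 + h2 + b * h3

/-- Here the first argument is fixed and only `w` moves, which is the dependence of `solG` on `n`.
-/
theorem phiReg_three_term (hq : ‖q‖ < 1) (a w : ℂ) :
    phiReg 0 (q * a) q w + a * phiReg 0 (q * a) q (q * (q * w)) =
      (1 + a - w) * phiReg 0 (q * a) q (q * w) := by
  have h1 := phiReg_contiguous_right hq (q * a) w
  have h2 := phiReg_contiguous_right hq (q * a) (q * w)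
  have h3 := phiReg_contiguous_left hq (q * a) (q * w)
  linear_combination h1 - a * h2 + w * h3

/-- Asymptotics of `phiReg 0 B q w` for large `B` staying away from the zeros of `(B; q)_∞`. -/
theorem exists_phiReg_sub_qPochInf_le (hq : ‖q‖ < 1) {δ : ℝ} (hδ : 0 < δ) (W : ℝ) :
    ∃ K : ℝ, ∀ B w : ℂ, (∀ j : ℕ, δ ≤ ‖1 - B * q ^ j‖) → ‖w‖ ≤ W →
      ‖phiReg 0 B q w - qPochInf B q‖ ≤ K * (‖qPochInf B q‖ / ‖1 - B‖) := by
  refine ⟨∑' k : ℕ, δ * (‖eulerCoeff q (k + 1)‖ * |W / δ| ^ (k + 1)), fun B w hB hw => ?_⟩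
  have hs := (summable_eulerCoeff_mul_pow hq (W / δ))
  have hs' : Summable fun k : ℕ => δ * (‖eulerCoeff q (k + 1)‖ * |W / δ| ^ (k + 1)) :=
    ((summable_nat_add_iff 1).mpr hs).mul_left δ
  have hW : 0 ≤ W := (norm_nonneg w).trans hw
  have hB0 : 0 < ‖1 - B‖ := hδ.trans_le (by simpa using hB 0)
  -- All factors but the first are estimated by `δ`. The first one is kept, since `‖1 - B‖` supplies
  -- the decay for large `B`.
  have hP : ∀ k : ℕ, δ ^ k * ‖1 - B‖ ≤ ‖qPoch B q (k + 1)‖ := by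
    intro k
    induction k with
    | zero => simp [qPoch]
    | succ k ih =>
      rw [qPoch_succ, norm_mul]
      calc δ ^ (k + 1) * ‖1 - B‖ = (δ ^ k * ‖1 - B‖) * δ := by ring
        _ ≤ _ := by gcongr; exact hB _
  have hterm : ∀ k : ℕ, ‖qPochInf (B * q ^ (k + 1)) q * (eulerCoeff q (k + 1) * w ^ (k + 1))‖ ≤
      δ * (‖eulerCoeff q (k + 1)‖ * |W / δ| ^ (k + 1)) * (‖qPochInf B q‖ / ‖1 - B‖) := by
    intro k
    have h1 := congrArg norm (qPochInf_eq_qPoch_mul hq B (k + 1))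
    rw [norm_mul] at h1
    have h2 : ‖qPochInf (B * q ^ (k + 1)) q‖ ≤ ‖qPochInf B q‖ / (δ ^ k * ‖1 - B‖) := by
      rw [le_div_iff₀ (by positivity), h1, mul_comm]
      gcongr
      exact hP k
    rw [norm_mul, norm_mul, norm_pow, abs_of_nonneg (by positivity)]
    calc _ ≤ ‖qPochInf B q‖ / (δ ^ k * ‖1 - B‖) * (‖eulerCoeff q (k + 1)‖ * W ^ (k + 1)) := by
          gcongr
      _ = _ := by rw [div_pow, pow_succ δ]; field_simp
  have hnorm := Summable.of_norm_bounded (hs'.mul_right (‖qPochInf B q‖ / ‖1 - B‖)) hterm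
  have hall : Summable fun k => qPochInf (B * q ^ k) q * (eulerCoeff q k * w ^ k) :=
    (summable_nat_add_iff 1).mp hnorm
  rw [phiReg_zero_eq, hall.tsum_eq_zero_add]
  simp only [pow_zero, mul_one, eulerCoeff_zero, add_sub_cancel_left]
  refine (tsum_of_norm_bounded (hs'.mul_right _).hasSum hterm).trans_eq ?_
  rw [tsum_mul_right]

end QSeries

/-! ### Solutions of the difference equation -/

/-- The Casorati determinant of two bilateral sequences. -/
def casorati (u v : ℤ → ℂ) (n : ℤ) : ℂ := u n * v (n + 1) - u (n + 1) * v n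

theorem casorati_eq_of_recurrence {u v a : ℤ → ℂ} {x : ℂ}
    (hu : ∀ n, u (n - 1) + a n * u n + u (n + 1) = x * u n)
    (hv : ∀ n, v (n - 1) + a n * v n + v (n + 1) = x * v n) (m n : ℤ) :
    casorati u v m = casorati u v n := by
  have hstep : ∀ n, casorati u v (n - 1) = casorati u v n := by
    intro n
    simp only [casorati, sub_add_cancel]
    linear_combination v n * hu n - u n * hv n
  have h0 : ∀ n, casorati u v n = casorati u v 0 := by
    intro n
    induction n using Int.induction_on with
    | zero => rfl
    | succ i ih => rw [← ih, ← hstep]; simp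
    | pred i ih => rw [hstep, ih]
  rw [h0 m, h0 n]

/-- Expansion of a `3 × 3` determinant with a repeated row. For three solutions of one recurrence
the coefficients are constants, so this is a linear relation among the solutions. -/
theorem casorati_three (u v w : ℤ → ℂ) (n : ℤ) :
    casorati v w n * u n + casorati w u n * v n + casorati u v n * w n = 0 := by
  simp only [casorati]; ring

/-- The theta function `(y; q)_∞ (q / y; q)_∞`. -/
noncomputable def qTheta (q y : ℂ) : ℂ := qPochInf y q * qPochInf (q * y⁻¹) q

/-- The normalization `(-1)^n α^{-n} q^{n(n+1)/2}` of `solF`. -/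
noncomputable def solCoeff (q α : ℝ) (n : ℤ) : ℂ :=
  (-1) ^ n * (α : ℂ) ^ (-n) * (q : ℂ) ^ (n * (n + 1) / 2)

/-- The solution `z^{-n} ₁φ̃₁(0; z² q; q, α z q^{1-n})`, which behaves like `z^{-n}` at `-∞`. -/
noncomputable def solG (q α : ℝ) (n : ℤ) (z : ℂ) : ℂ :=
  z ^ (-n) * phiReg 0 (z ^ 2 * q) q (α * z * (q : ℂ) ^ (1 - n))

section Solutions

variable {q α : ℝ}

theorem norm_ofReal_lt_one (hq0 : 0 < q) (hq1 : q < 1) : ‖(q : ℂ)‖ < 1 := by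
  rwa [Complex.norm_real, Real.norm_of_nonneg hq0.le]

theorem solF_eq (q α : ℝ) (n : ℤ) (z : ℂ) : solF q α n z = solCoeff q α n *
    phiReg 0 (z⁻¹ * (α : ℂ)⁻¹ * (q : ℂ) ^ (n + 1)) q (z * (α : ℂ)⁻¹ * (q : ℂ) ^ (n + 1)) := rfl

theorem int_triangle_succ (n : ℤ) : (n + 1) * (n + 1 + 1) / 2 = n * (n + 1) / 2 + (n + 1) := by
  rw [← Int.add_mul_ediv_right _ _ two_ne_zero]
  ring_nf

theorem solCoeff_succ (hq0 : 0 < q) (hα : α ≠ 0) (n : ℤ) :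
    solCoeff q α (n + 1) = -solCoeff q α n * ((α : ℂ)⁻¹ * (q : ℂ) ^ (n + 1)) := by
  have hq : (q : ℂ) ≠ 0 := by exact_mod_cast hq0.ne'
  have hα' : (α : ℂ) ≠ 0 := by exact_mod_cast hα
  rw [solCoeff, solCoeff, int_triangle_succ, zpow_add₀ hq (n * (n + 1) / 2), neg_add,
    zpow_add₀ hα', zpow_add₀ (by norm_num : (-1 : ℂ) ≠ 0), zpow_neg_one, zpow_one]
  ring

theorem solCoeff_zero (q α : ℝ) : solCoeff q α 0 = 1 := by simp [solCoeff]

theorem solF_inv (hq0 : 0 < q) (hq1 : q < 1) (n : ℤ) (z : ℂ) :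
    solF q α n z⁻¹ = solF q α n z := by
  rw [solF_eq, solF_eq, phiReg_symm (norm_ofReal_lt_one hq0 hq1), inv_inv]

theorem solF_recurrence (hq0 : 0 < q) (hq1 : q < 1) (hα : α ≠ 0) {z : ℂ} (hz : z ≠ 0) (n : ℤ) :
    solF q α (n - 1) z + α * (q : ℂ) ^ (-n) * solF q α n z + solF q α (n + 1) z =
      (z + z⁻¹) * solF q α n z := by
  have hq : (q : ℂ) ≠ 0 := by exact_mod_cast hq0.ne'
  have hα' : (α : ℂ) ≠ 0 := by exact_mod_cast hα
  obtain ⟨n, rfl⟩ : ∃ m, n = m + 1 := ⟨n - 1, by ring⟩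
  have h := phiReg_diagonal (norm_ofReal_lt_one hq0 hq1) (z⁻¹ * (α : ℂ)⁻¹ * (q : ℂ) ^ (n + 1))
    (z * (α : ℂ)⁻¹ * (q : ℂ) ^ (n + 1))
  have e : ∀ (c : ℂ) (m : ℤ), (q : ℂ) * (c * (q : ℂ) ^ m) = c * (q : ℂ) ^ (m + 1) := by
    intro c m; rw [zpow_add_one₀ hq]; ring
  simp only [e] at h
  rw [add_sub_cancel_right, solF_eq, solF_eq, solF_eq, solCoeff_succ hq0 hα (n + 1),
    solCoeff_succ hq0 hα n, h, zpow_neg, zpow_add_one₀ hq (n + 1)]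
  have hQ : (q : ℂ) ^ (n + 1) ≠ 0 := zpow_ne_zero _ hq
  generalize (q : ℂ) ^ (n + 1) = Q at *
  field_simp
  ring

theorem solG_recurrence (hq0 : 0 < q) (hq1 : q < 1) {z : ℂ} (hz : z ≠ 0) (n : ℤ) :
    solG q α (n - 1) z + α * (q : ℂ) ^ (-n) * solG q α n z + solG q α (n + 1) z =
      (z + z⁻¹) * solG q α n z := by
  have hq : (q : ℂ) ≠ 0 := by exact_mod_cast hq0.ne'
  have h := phiReg_three_term (norm_ofReal_lt_one hq0 hq1) (z ^ 2) (α * z * (q : ℂ) ^ (-n))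
  have e1 : (1 : ℤ) - (n + 1) = -n := by ring
  have e2 : (q : ℂ) ^ (1 - n) = q * (q : ℂ) ^ (-n) := by rw [sub_eq_add_neg, zpow_one_add₀ hq]
  have e3 : (q : ℂ) ^ (1 - (n - 1)) = q * (q * (q : ℂ) ^ (-n)) := by
    rw [← zpow_one_add₀ hq, ← zpow_one_add₀ hq]; ring_nf
  have e4 : z ^ (-(n - 1)) = z * z ^ (-n) := by rw [← zpow_one_add₀ hz]; ring_nf
  have e5 : z ^ (-(n + 1)) = z⁻¹ * z ^ (-n) := by
    rw [← zpow_neg_one, ← zpow_add₀ hz]; ring_nf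
  simp only [solG, e1, e2, e3, e4, e5]
  rw [mul_comm (q : ℂ) (z ^ 2)] at h
  rw [show (α : ℂ) * z * (q * (q : ℂ) ^ (-n)) = q * (α * z * (q : ℂ) ^ (-n)) by ring,
    show (α : ℂ) * z * (q * (q * (q : ℂ) ^ (-n))) = q * (q * (α * z * (q : ℂ) ^ (-n))) by ring]
  have hz' : z⁻¹ * z = 1 := inv_mul_cancel₀ hz
  linear_combination (z ^ (-n) * z⁻¹) * h +
    (-α * (q : ℂ) ^ (-n) * z ^ (-n) * phiReg 0 (z ^ 2 * q) q (q * (α * z * (q : ℂ) ^ (-n))) +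
     z * z ^ (-n) * phiReg 0 (z ^ 2 * q) q (q * (α * z * (q : ℂ) ^ (-n))) -
     z * z ^ (-n) * phiReg 0 (z ^ 2 * q) q (q * (q * (α * z * (q : ℂ) ^ (-n))))) * hz'

/-- The factor `(y; q)_∞` vanishes at `q^{-n}` and `(q / y; q)_∞` at `q^{n+1}` for `n ≥ 0`. Together
they account for all integer powers of `q`. -/
theorem one_sub_ne_zero_of_qTheta_ne_zero {q y : ℂ} (hq : ‖q‖ < 1) (hq0 : q ≠ 0)
    (h : qTheta q y ≠ 0) (j : ℤ) : 1 - y * q ^ j ≠ 0 := by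
  intro h0
  apply h
  obtain ⟨n, rfl | rfl⟩ := j.eq_nat_or_neg
  · rw [zpow_natCast] at h0
    have : qPoch y q (n + 1) = 0 := by rw [qPoch_succ, h0, mul_zero]
    rw [qTheta, qPochInf_eq_qPoch_mul hq y (n + 1), this, zero_mul, zero_mul]
  · cases n with
    | zero =>
      have : qPoch y q (0 + 1) = 0 := by rw [qPoch_succ]; simpa [qPoch] using h0
      rw [qTheta, qPochInf_eq_qPoch_mul hq y (0 + 1), this, zero_mul, zero_mul]
    | succ n =>
      have h1 : 1 - q * y⁻¹ * q ^ n = 0 := by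
        rw [zpow_neg, zpow_natCast] at h0
        have hn : q ^ (n + 1) ≠ 0 := pow_ne_zero _ hq0
        have : y = q ^ (n + 1) := by field_simp at h0; linear_combination -h0
        rw [this]
        field_simp
        ring
      have : qPoch (q * y⁻¹) q (n + 1) = 0 := by rw [qPoch_succ, h1, mul_zero]
      rw [qTheta, qPochInf_eq_qPoch_mul hq (q * y⁻¹) (n + 1), this, zero_mul, mul_zero]

theorem exists_le_norm_of_tendsto_inv {a : ℕ → ℂ} {l : ℂ} (ha : ∀ n, a n ≠ 0)
    (h : Tendsto (fun n => (a n)⁻¹) atTop (𝓝 l)) : ∃ δ : ℝ, 0 < δ ∧ ∀ n, δ ≤ ‖a n‖ := by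
  obtain ⟨C, hC⟩ := h.norm.bddAbove_range
  have hC' : ∀ n, ‖a n‖⁻¹ ≤ C := fun n => by simpa using hC (Set.mem_range_self n)
  have hpos : 0 < C := (inv_pos.mpr (norm_pos_iff.mpr (ha 0))).trans_le (hC' 0)
  exact ⟨C⁻¹, inv_pos.mpr hpos, fun n => inv_le_of_inv_le₀ (norm_pos_iff.mpr (ha n)) (hC' n)⟩

theorem tendsto_norm_one_sub_mul_pow_neg {q y : ℂ} (hq : ‖q‖ < 1) (hq0 : q ≠ 0) (hy : y ≠ 0) :
    Tendsto (fun n : ℕ => ‖1 - y * q ^ (-(n : ℤ))‖) atTop atTop := by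
  have h1 : Tendsto (fun n : ℕ => ‖y‖ * (‖q‖⁻¹) ^ n - 1) atTop atTop :=
    tendsto_atTop_add_const_right _ _ ((tendsto_pow_atTop_atTop_of_one_lt
      ((one_lt_inv₀ (norm_pos_iff.mpr hq0)).mpr hq)).const_mul_atTop (norm_pos_iff.mpr hy))
  refine tendsto_atTop_mono (fun n => ?_) h1
  have := norm_sub_norm_le (y * q ^ (-(n : ℤ))) 1
  rw [norm_sub_rev]
  refine le_trans (le_of_eq ?_) this
  simp

/-- As `j → +∞` the quantity tends to `1`, and as `j → -∞` it is unbounded. So the inverses stay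
bounded in both directions. -/
theorem exists_le_norm_one_sub {q y : ℂ} (hq : ‖q‖ < 1) (hq0 : q ≠ 0) (hy : y ≠ 0)
    (h : ∀ j : ℤ, 1 - y * q ^ j ≠ 0) : ∃ δ : ℝ, 0 < δ ∧ ∀ j : ℤ, δ ≤ ‖1 - y * q ^ j‖ := by
  obtain ⟨δ₁, h₁, H₁⟩ := exists_le_norm_of_tendsto_inv (a := fun n : ℕ => 1 - y * q ^ (n : ℤ))
    (l := (1 - y * 0)⁻¹) (fun n => h n) (by
      refine Tendsto.inv₀ ?_ (by simp)
      simpa only [zpow_natCast] using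
        ((tendsto_pow_atTop_nhds_zero_of_norm_lt_one hq).const_mul y).const_sub 1)
  obtain ⟨δ₂, h₂, H₂⟩ := exists_le_norm_of_tendsto_inv (a := fun n : ℕ => 1 - y * q ^ (-(n : ℤ)))
    (l := 0) (fun n => h _) (by
      rw [tendsto_zero_iff_norm_tendsto_zero]
      simpa only [norm_inv, Pi.inv_def] using
        (tendsto_norm_one_sub_mul_pow_neg hq hq0 hy).inv_tendsto_atTop)
  refine ⟨min δ₁ δ₂, lt_min h₁ h₂, fun j => ?_⟩
  obtain ⟨n, rfl | rfl⟩ := j.eq_nat_or_neg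
  · exact (min_le_left _ _).trans (H₁ n)
  · exact (min_le_right _ _).trans (H₂ n)

/-- Lowering the argument by `q^{-n}` adds `n` factors to the product. The normalization of `f_n`
reflects them into `(q / (αz); q)_n`, so that a theta function appears in the limit. -/
theorem solCoeff_mul_qPochInf (hq0 : 0 < q) (hq1 : q < 1) (hα : α ≠ 0) {z : ℂ} (hz : z ≠ 0)
    (n : ℕ) : solCoeff q α n * z ^ (-(n : ℤ)) * qPochInf (α * z * (q : ℂ) ^ (-(n : ℤ))) q =
      qPochInf (α * z) q * qPoch (q * (α * z)⁻¹) q n := by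
  have hq : (q : ℂ) ≠ 0 := by exact_mod_cast hq0.ne'
  have hα' : (α : ℂ) ≠ 0 := by exact_mod_cast hα
  induction n with
  | zero => simp [solCoeff_zero, qPoch]
  | succ n ih =>
    rw [qPoch_succ, ← mul_assoc, ← ih, qPochInf_eq_mul (norm_ofReal_lt_one hq0 hq1)
      (α * z * (q : ℂ) ^ (-((n + 1 : ℕ) : ℤ)))]
    push_cast
    rw [solCoeff_succ hq0 hα, mul_assoc (_ * z) _ (q : ℂ), ← zpow_add_one₀ hq, neg_add,
      neg_add_cancel_right, zpow_add₀ hz, zpow_add₀ hq, zpow_add₀ hq, zpow_one, zpow_neg_one,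
      zpow_neg_one, zpow_neg, zpow_neg, zpow_natCast, zpow_natCast]
    have hQ : (q : ℂ) ^ n ≠ 0 := pow_ne_zero _ hq
    generalize (q : ℂ) ^ n = Q at *
    field_simp
    ring

/-- By symmetry the growing argument `αz q^{-n}` may be taken as the first one. It keeps away from
the zeros of the product because `θ(αz) ≠ 0`, so the series may be replaced by `(αz q^{-n}; q)_∞`.
-/
theorem tendsto_solCoeff_mul_solG (hq0 : 0 < q) (hq1 : q < 1) (hα : α ≠ 0) {z : ℂ} (hz : z ≠ 0)
    (hθ : qTheta q (α * z) ≠ 0) :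
    Tendsto (fun n : ℕ => solCoeff q α n * solG q α (n + 1) z) atTop
      (𝓝 (qTheta q (α * z) * z⁻¹)) := by
  have hq : (q : ℂ) ≠ 0 := by exact_mod_cast hq0.ne'
  have hα' : (α : ℂ) ≠ 0 := by exact_mod_cast hα
  have hqn := norm_ofReal_lt_one hq0 hq1
  have hy : (α : ℂ) * z ≠ 0 := mul_ne_zero hα' hz
  have hne := one_sub_ne_zero_of_qTheta_ne_zero hqn hq hθ
  obtain ⟨δ, hδ, Hδ⟩ := exists_le_norm_one_sub hqn hq hy hne
  obtain ⟨K, hK⟩ := exists_phiReg_sub_qPochInf_le hqn hδ ‖z ^ 2 * q‖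
  set B : ℕ → ℂ := fun n => α * z * (q : ℂ) ^ (-(n : ℤ)) with hB
  have hBj : ∀ (n j : ℕ), δ ≤ ‖1 - B n * (q : ℂ) ^ j‖ := by
    intro n j
    have := Hδ (-(n : ℤ) + j)
    rwa [zpow_add₀ hq, zpow_natCast, ← mul_assoc] at this
  have hB0 : ∀ n, qPochInf (B n) q ≠ 0 := fun n =>
    qPochInf_ne_zero hqn fun j => norm_pos_iff.mp (hδ.trans_le (hBj n j))
  have hr : Tendsto (fun n => phiReg 0 (B n) q (z ^ 2 * q) / qPochInf (B n) q) atTop (𝓝 1) := by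
    rw [tendsto_iff_norm_sub_tendsto_zero]
    refine squeeze_zero (fun _ => norm_nonneg _) (g := fun n => K * ‖1 - B n‖⁻¹) (fun n => ?_) ?_
    · have h1 := hK (B n) (z ^ 2 * q) (hBj n) le_rfl
      rw [div_sub_one (hB0 n), norm_div, div_le_iff₀ (norm_pos_iff.mpr (hB0 n))]
      refine h1.trans_eq ?_
      ring
    · have h2 := ((tendsto_norm_one_sub_mul_pow_neg hqn hq hy).inv_tendsto_atTop).const_mul K
      rw [mul_zero] at h2
      exact h2
  have hp := (tendsto_qPoch hqn (q * ((α : ℂ) * z)⁻¹)).const_mul (qPochInf (α * z) q)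
  have := (hp.mul hr).mul_const z⁻¹
  rw [mul_one] at this
  refine this.congr fun n => ?_
  rw [← solCoeff_mul_qPochInf hq0 hq1 hα hz, solG, phiReg_symm hqn,
    show (1 : ℤ) - (n + 1) = -n by ring, neg_add, zpow_add₀ hz, zpow_neg_one]
  have := hB0 n
  simp only [hB] at this ⊢
  field_simp

theorem tendsto_zpow_natCast_add (hq0 : 0 < q) (hq1 : q < 1) (m : ℤ) :
    Tendsto (fun n : ℕ => (q : ℂ) ^ ((n : ℤ) + m)) atTop (𝓝 0) := by
  have hq : (q : ℂ) ≠ 0 := by exact_mod_cast hq0.ne'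
  simp only [zpow_add₀ hq, zpow_natCast]
  simpa using (tendsto_pow_atTop_nhds_zero_of_norm_lt_one
    (norm_ofReal_lt_one hq0 hq1)).mul_const ((q : ℂ) ^ m)

theorem tendsto_phiReg_diagonal (hq0 : 0 < q) (hq1 : q < 1) (u v : ℂ) (m : ℤ) :
    Tendsto (fun n : ℕ => phiReg 0 (u * (q : ℂ) ^ ((n : ℤ) + m)) q (v * (q : ℂ) ^ ((n : ℤ) + m)))
      atTop (𝓝 1) := by
  have h1 : phiReg 0 0 q 0 = 1 := by rw [phiReg_zero_right, qPochInf_zero]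
  rw [← h1]
  refine tendsto_phiReg (norm_ofReal_lt_one hq0 hq1) ?_ ?_
  · simpa using (tendsto_zpow_natCast_add hq0 hq1 m).const_mul u
  · simpa using (tendsto_zpow_natCast_add hq0 hq1 m).const_mul v

/-- The Casoratian does not depend on `n` and is evaluated at `+∞`. There `f_n` is asymptotic to
`solCoeff q α n`, and the second product drops out since `solCoeff` decays faster than any geometric
sequence. -/
theorem casorati_solF_solG (hq0 : 0 < q) (hq1 : q < 1) (hα : α ≠ 0) {z : ℂ} (hz : z ≠ 0)
    (hθ : qTheta q (α * z) ≠ 0) (n : ℤ) :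
    casorati (fun n => solF q α n z) (fun n => solG q α n z) n = qTheta q (α * z) * z⁻¹ := by
  have hq : (q : ℂ) ≠ 0 := by exact_mod_cast hq0.ne'
  have hα' : (α : ℂ) ≠ 0 := by exact_mod_cast hα
  have hconst := casorati_eq_of_recurrence (u := fun n => solF q α n z)
    (v := fun n => solG q α n z) (a := fun n => α * (q : ℂ) ^ (-n)) (x := z + z⁻¹)
    (solF_recurrence hq0 hq1 hα hz) (solG_recurrence hq0 hq1 hz)
  have hb := tendsto_solCoeff_mul_solG hq0 hq1 hα hz hθ
  have hb1 := (tendsto_add_atTop_iff_nat 1).mpr hb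
  set a : ℤ → ℂ := fun n =>
    phiReg 0 (z⁻¹ * (α : ℂ)⁻¹ * (q : ℂ) ^ (n + 1)) q (z * (α : ℂ)⁻¹ * (q : ℂ) ^ (n + 1)) with ha
  have ha1 : Tendsto (fun n : ℕ => a ((n : ℤ) + 1)) atTop (𝓝 1) := by
    simpa only [ha, add_assoc] using tendsto_phiReg_diagonal hq0 hq1 (z⁻¹ * (α : ℂ)⁻¹)
      (z * (α : ℂ)⁻¹) (1 + 1)
  have ha2 : Tendsto (fun n : ℕ => a ((n : ℤ) + 1 + 1)) atTop (𝓝 1) := by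
    simpa only [ha, add_assoc] using tendsto_phiReg_diagonal hq0 hq1 (z⁻¹ * (α : ℂ)⁻¹)
      (z * (α : ℂ)⁻¹) (1 + (1 + 1))
  have hc : Tendsto (fun n : ℕ => ((α : ℂ)⁻¹ * (q : ℂ) ^ ((n : ℤ) + 1)) *
      ((α : ℂ)⁻¹ * (q : ℂ) ^ ((n : ℤ) + 2))) atTop (𝓝 0) := by
    simpa using ((tendsto_zpow_natCast_add hq0 hq1 1).const_mul (α : ℂ)⁻¹).mul
      ((tendsto_zpow_natCast_add hq0 hq1 2).const_mul (α : ℂ)⁻¹)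
  have hlim := (ha1.mul hb1).sub ((hc.mul ha2).mul hb)
  simp only [one_mul, zero_mul, sub_zero] at hlim
  refine tendsto_nhds_unique (tendsto_const_nhds.congr fun m : ℕ => ?_) hlim
  rw [hconst n ((m : ℤ) + 1)]
  simp only [casorati, solF_eq, ha]
  push_cast
  rw [solCoeff_succ hq0 hα ((m : ℤ) + 1), solCoeff_succ hq0 hα (m : ℤ)]
  simp only [add_assoc, one_add_one_eq_two]
  ring

theorem tendsto_solG_factor (hq0 : 0 < q) (hq1 : q < 1) (z : ℂ) (m : ℤ) :
    Tendsto (fun n : ℕ => phiReg 0 (z ^ 2 * q) q (α * z * (q : ℂ) ^ ((n : ℤ) + m)))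
      atTop (𝓝 (qPochInf (z ^ 2 * q) q)) := by
  rw [← phiReg_zero_right]
  refine tendsto_phiReg (norm_ofReal_lt_one hq0 hq1) tendsto_const_nhds ?_
  simpa using (tendsto_zpow_natCast_add hq0 hq1 m).const_mul (α * z)

/-- This constant is read off at `-∞`, where both series tend to `(z^{±2} q; q)_∞`. -/
theorem casorati_solG_solG_inv (hq0 : 0 < q) (hq1 : q < 1) {z : ℂ} (hz : z ≠ 0) (n : ℤ) :
    casorati (fun n => solG q α n z) (fun n => solG q α n z⁻¹) n =
      (z - z⁻¹) * (qPochInf (z ^ 2 * q) q * qPochInf (z⁻¹ ^ 2 * q) q) := by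
  have hrec := solG_recurrence (α := α) hq0 hq1 (inv_ne_zero hz)
  rw [inv_inv, add_comm] at hrec
  have hconst := casorati_eq_of_recurrence (u := fun n => solG q α n z)
    (v := fun n => solG q α n z⁻¹) (a := fun n => α * (q : ℂ) ^ (-n)) (x := z + z⁻¹)
    (solG_recurrence hq0 hq1 hz) hrec
  have h1 := (tendsto_solG_factor (α := α) hq0 hq1 z 1).mul (tendsto_solG_factor (α := α) hq0 hq1 z⁻¹ 0)
  have h2 := (tendsto_solG_factor (α := α) hq0 hq1 z 0).mul (tendsto_solG_factor (α := α) hq0 hq1 z⁻¹ 1)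
  have h := (h1.const_mul z).sub (h2.const_mul z⁻¹)
  rw [← sub_mul] at h
  refine tendsto_nhds_unique (tendsto_const_nhds.congr fun m : ℕ => ?_) h
  rw [hconst n (-(m : ℤ))]
  have e1 : (1 : ℤ) - -(m : ℤ) = m + 1 := by ring
  have e2 : (1 : ℤ) - (-(m : ℤ) + 1) = m + 0 := by ring
  have e3 : -(-(m : ℤ) + 1) = m + -1 := by ring
  simp only [casorati, solG, e1, e2, e3, neg_neg]
  rw [zpow_add₀ hz, zpow_add₀ (inv_ne_zero hz), zpow_neg_one, zpow_neg_one, inv_inv, zpow_natCast,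
    zpow_natCast]
  have hm : z ^ m * z⁻¹ ^ m = 1 := by rw [← mul_pow, mul_inv_cancel₀ hz, one_pow]
  linear_combination ((z * (phiReg 0 (z ^ 2 * q) q (α * z * (q : ℂ) ^ ((m : ℤ) + 1)) *
    phiReg 0 (z⁻¹ ^ 2 * q) q (α * z⁻¹ * (q : ℂ) ^ ((m : ℤ) + 0)))) +
    -z⁻¹ * (phiReg 0 (z ^ 2 * q) q (α * z * (q : ℂ) ^ ((m : ℤ) + 0)) *
      phiReg 0 (z⁻¹ ^ 2 * q) q (α * z⁻¹ * (q : ℂ) ^ ((m : ℤ) + 1)))) * hm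

/-- The connection formula between the solution recessive at `+∞` and the Jost solutions. -/
theorem solF_connection (hq0 : 0 < q) (hq1 : q < 1) (hα : α ≠ 0) {z : ℂ} (hz : z ≠ 0)
    (h1 : qTheta q (α * z) ≠ 0) (h2 : qTheta q (α * z⁻¹) ≠ 0) (n : ℤ) :
    (z - z⁻¹) * (qPochInf (z ^ 2 * q) q * qPochInf (z⁻¹ ^ 2 * q) q) * solF q α n z =
      qTheta q (α * z⁻¹) * z * solG q α n z - qTheta q (α * z) * z⁻¹ * solG q α n z⁻¹ := by
  have h := casorati_three (fun n => solF q α n z) (fun n => solG q α n z)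
    (fun n => solG q α n z⁻¹) n
  have c1 := casorati_solF_solG hq0 hq1 hα hz h1 n
  have c2 := casorati_solF_solG hq0 hq1 hα (inv_ne_zero hz) h2 n
  simp only [solF_inv hq0 hq1, inv_inv] at c2
  have c2' : casorati (fun n => solG q α n z⁻¹) (fun n => solF q α n z) n =
      -(qTheta q (α * z⁻¹) * z) := by
    rw [← c2]; simp only [casorati]; ring
  rw [casorati_solG_solG_inv hq0 hq1 hz, c1, c2'] at h
  linear_combination h

end Solutions

/-! ### Theta functions and the proportionality of the two solutions at the eigenvalues -/

section Theta

theorem qTheta_ne_zero {q y : ℂ} (hq : ‖q‖ < 1) (hq0 : q ≠ 0) (hy : y ≠ 0)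
    (h : ∀ j : ℤ, 1 - y * q ^ j ≠ 0) : qTheta q y ≠ 0 := by
  refine mul_ne_zero (qPochInf_ne_zero hq fun j => by simpa using h j)
    (qPochInf_ne_zero hq fun j h0 => h (-(j + 1 : ℕ)) ?_)
  have hj : q ^ (j + 1) ≠ 0 := pow_ne_zero _ hq0
  have hy' : y = q ^ (j + 1) := by
    field_simp at h0
    linear_combination h0
  rw [zpow_neg, zpow_natCast, hy', mul_inv_cancel₀ hj, sub_self]

theorem qTheta_mul_self {q y : ℂ} (hq : ‖q‖ < 1) (hq0 : q ≠ 0) (hy : y ≠ 0) :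
    qTheta q (q * y) * -y = qTheta q y := by
  have h1 := qPochInf_eq_mul hq y
  have h2 := qPochInf_eq_mul hq y⁻¹
  rw [mul_comm] at h1 h2
  have e : q * (q * y)⁻¹ = y⁻¹ := by field_simp
  rw [qTheta, qTheta, e, h1, h2, mul_comm q y, mul_comm q y⁻¹]
  field_simp
  ring

theorem int_triangle_pred_succ (n : ℤ) : (n + 1) * (n + 1 - 1) / 2 = n * (n - 1) / 2 + n := by
  rw [← Int.add_mul_ediv_right _ _ two_ne_zero]
  ring_nf

theorem two_mul_int_triangle (n : ℤ) : 2 * (n * (n - 1) / 2) = n * (n - 1) :=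
  Int.mul_ediv_cancel' (by
    rcases Int.even_or_odd n with h | h
    · exact h.two_dvd.mul_right _
    · exact (h.sub_odd odd_one).two_dvd.mul_left _)

theorem two_mul_int_triangle' (n : ℤ) : 2 * (n * (n + 1) / 2) = n * (n + 1) :=
  Int.mul_ediv_cancel' (Int.even_mul_succ_self n).two_dvd

theorem qTheta_zpow_mul {q y : ℂ} (hq : ‖q‖ < 1) (hq0 : q ≠ 0) (hy : y ≠ 0) (m : ℤ) :
    qTheta q (q ^ m * y) * ((-1) ^ m * y ^ m * q ^ (m * (m - 1) / 2)) = qTheta q y := by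
  have hstep : ∀ m : ℤ, qTheta q (q ^ (m + 1) * y) *
      ((-1) ^ (m + 1) * y ^ (m + 1) * q ^ ((m + 1) * (m + 1 - 1) / 2)) =
      qTheta q (q ^ m * y) * ((-1) ^ m * y ^ m * q ^ (m * (m - 1) / 2)) := by
    intro m
    rw [← qTheta_mul_self (y := q ^ m * y) hq hq0 (mul_ne_zero (zpow_ne_zero _ hq0) hy),
      int_triangle_pred_succ, zpow_add₀ hq0 (m * (m - 1) / 2), zpow_add_one₀ hq0,
      zpow_add_one₀ (by norm_num), zpow_add_one₀ hy]
    ring_nf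
  induction m using Int.induction_on with
  | zero => simp
  | succ i ih => rw [hstep, ih]
  | pred i ih => rw [← hstep, sub_add_cancel, ih]

/-- For `N ≥ 0` the first `N` terms of the series vanish, because `(q^{1-N+k}; q)_∞ = 0` for `k <
N`, and the rest is again such a series. The induction obtains this from the two contiguous
relations. -/
theorem phiReg_zpow {q : ℂ} (hq : ‖q‖ < 1) (hq0 : q ≠ 0) {w : ℂ} (hw : w ≠ 0) (N : ℤ) :
    phiReg 0 (q ^ (1 - N)) q w =
      (-w) ^ N * q ^ (N * (N - 1) / 2) * phiReg 0 (q ^ (N + 1)) q (w * q ^ N) := by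
  have key : ∀ (N : ℕ) {w : ℂ}, w ≠ 0 → phiReg 0 (q ^ (1 - N : ℤ)) q w =
      (-w) ^ (N : ℤ) * q ^ ((N : ℤ) * (N - 1) / 2) *
        phiReg 0 (q ^ (N + 1 : ℤ)) q (w * q ^ (N : ℤ)) := by
    intro N
    induction N with
    | zero => intro w _; simp
    | succ N ih =>
      intro w hw
      have h1 := phiReg_contiguous_left hq (q ^ (-N : ℤ)) w
      have h2 := phiReg_contiguous_right hq (q ^ (N + 1 : ℤ)) (w * q ^ (N : ℤ))
      have e1 : q * q ^ (-N : ℤ) = q ^ (1 - N : ℤ) := by rw [← zpow_one_add₀ hq0]; ring_nf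
      have e2 : q * q ^ (N + 1 : ℤ) = q ^ (N + 1 + 1 : ℤ) := by rw [← zpow_one_add₀ hq0]; ring_nf
      have e3 : q * (w * q ^ (N : ℤ)) = w * q ^ (N + 1 : ℤ) := by rw [zpow_add_one₀ hq0]; ring
      have e4 : q * w * q ^ (N : ℤ) = w * q ^ (N + 1 : ℤ) := by rw [zpow_add_one₀ hq0]; ring
      rw [e1, ih hw, ih (mul_ne_zero hq0 hw), e4] at h1
      rw [e2, e3] at h2
      push_cast
      have e5 : (1 : ℤ) - (N + 1) = -N := by ring
      have e6 : (-(q * w)) ^ (N : ℤ) = (-w) ^ (N : ℤ) * q ^ (N : ℤ) := by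
        rw [← mul_zpow]; ring_nf
      have e7 : q ^ (-N : ℤ) * q ^ (N : ℤ) = 1 := by
        rw [← zpow_add₀ hq0]; simp
      rw [e5, int_triangle_pred_succ, zpow_add₀ hq0 ((N : ℤ) * _ / 2),
        zpow_add_one₀ (neg_ne_zero.mpr hw)]
      rw [e6] at h1
      linear_combination h1 + ((-w) ^ (N : ℤ) * q ^ ((N : ℤ) * (N - 1) / 2)) * h2 -
        ((-w) ^ (N : ℤ) * q ^ ((N : ℤ) * (N - 1) / 2) *
          phiReg 0 (q ^ (N + 1 : ℤ)) q (w * q ^ (N + 1 : ℤ))) * e7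
  obtain ⟨M, rfl | rfl⟩ := N.eq_nat_or_neg
  · exact key M hw
  -- For `N = -M` the identity is the one for `M`, read backwards at `w q^{-M}`. The two prefactors
  -- are inverse to each other.
  · have h := key M (w := w * q ^ (-M : ℤ)) (mul_ne_zero hw (zpow_ne_zero _ hq0))
    rw [mul_assoc w, ← zpow_add₀ hq0, neg_add_cancel, zpow_zero, mul_one] at h
    rw [show (1 : ℤ) - -M = M + 1 by ring, show (-M : ℤ) + 1 = 1 - M by ring, h, ← mul_assoc]
    have e : (-w) ^ (-M : ℤ) * q ^ ((-M : ℤ) * (-M - 1) / 2) *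
        ((-(w * q ^ (-M : ℤ))) ^ (M : ℤ) * q ^ ((M : ℤ) * (M - 1) / 2)) = 1 := by
      rw [← neg_mul, mul_zpow, ← zpow_mul]
      have h1 : (-w) ^ (-M : ℤ) * (-w) ^ (M : ℤ) = 1 := by
        rw [← zpow_add₀ (neg_ne_zero.mpr hw)]; simp
      have h2 : q ^ ((-M : ℤ) * (-M - 1) / 2) * (q ^ (-M * M : ℤ) * q ^ ((M : ℤ) * (M - 1) / 2))
          = 1 := by
        rw [← zpow_add₀ hq0, ← zpow_add₀ hq0]
        have t1 := two_mul_int_triangle (-M : ℤ)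
        have t2 := two_mul_int_triangle (M : ℤ)
        have : (-M : ℤ) * (-M - 1) / 2 + (-M * M + (M : ℤ) * (M - 1) / 2) = 0 := by
          have : 2 * ((-M : ℤ) * (-M - 1) / 2 + (-M * M + (M : ℤ) * (M - 1) / 2)) = 0 := by
            linear_combination t1 + t2
          omega
        rw [this, zpow_zero]
      linear_combination h2 + q ^ ((-M : ℤ) * (-M - 1) / 2) *
        (q ^ (-M * M : ℤ) * q ^ ((M : ℤ) * (M - 1) / 2)) * h1
    rw [e, one_mul]

/-- At `z = α⁻¹ q^m` the theta function `θ(αz)` vanishes and the solutions become dependent. The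
first argument of `f_n` is then the power `q^{1-(m-n)}`, so `phiReg_zpow` with `N = m - n` gives the
constant. -/
theorem solG_eigenvalue {q α : ℝ} (hq0 : 0 < q) (hq1 : q < 1) (hα : α ≠ 0) (n m : ℤ) :
    solG q α n ((α : ℂ)⁻¹ * (q : ℂ) ^ m) * ((-1) ^ m * (q : ℂ) ^ (m * (m - 1) / 2)) =
      (α : ℂ) ^ (2 * m) * (q : ℂ) ^ (-(m * (m + 1))) * solF q α n ((α : ℂ)⁻¹ * (q : ℂ) ^ m) := by
  have hq : (q : ℂ) ≠ 0 := by exact_mod_cast hq0.ne'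
  have hα' : (α : ℂ) ≠ 0 := by exact_mod_cast hα
  have hqn := norm_ofReal_lt_one hq0 hq1
  have e1 : ((α : ℂ)⁻¹ * (q : ℂ) ^ m)⁻¹ * (α : ℂ)⁻¹ * (q : ℂ) ^ (n + 1) =
      (q : ℂ) ^ (1 - (m - n)) := by
    rw [show (1 : ℤ) - (m - n) = -m + (n + 1) by ring, zpow_add₀ hq (-m), zpow_neg]
    field_simp
  have e2 : (α : ℂ)⁻¹ * (q : ℂ) ^ m * (α : ℂ)⁻¹ * (q : ℂ) ^ (n + 1) =
      (α : ℂ) ^ (-2 : ℤ) * (q : ℂ) ^ (m + n + 1) := by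
    rw [add_assoc, zpow_add₀ hq m, zpow_neg]
    field_simp
  have hw : (α : ℂ) ^ (-2 : ℤ) * (q : ℂ) ^ (m + n + 1) ≠ 0 :=
    mul_ne_zero (zpow_ne_zero _ hα') (zpow_ne_zero _ hq)
  have e3 : ((α : ℂ)⁻¹ * (q : ℂ) ^ m) ^ 2 * q =
      (α : ℂ) ^ (-2 : ℤ) * (q : ℂ) ^ (m + n + 1) * (q : ℂ) ^ (m - n) := by
    rw [mul_assoc, ← zpow_add₀ hq, show m + n + 1 + (m - n) = m * 2 + 1 by ring,
      zpow_add_one₀ hq, zpow_mul, mul_pow, zpow_neg]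
    norm_cast
    simp [mul_assoc]
  have e4 : α * ((α : ℂ)⁻¹ * (q : ℂ) ^ m) * (q : ℂ) ^ (1 - n) = (q : ℂ) ^ (m - n + 1) := by
    rw [show m - n + 1 = m + (1 - n) by ring, zpow_add₀ hq m]
    field_simp
  rw [solF_eq, e1, e2, phiReg_zpow hqn hq hw, solG, e4, ← e3, phiReg_symm hqn]
  generalize phiReg 0 ((q : ℂ) ^ (m - n + 1)) q (((α : ℂ)⁻¹ * (q : ℂ) ^ m) ^ 2 * q) = P
  have hA : (α : ℂ) ^ (2 * m) * (α : ℂ) ^ (-n) * ((α : ℂ) ^ (-2 : ℤ)) ^ (m - n) =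
      (α : ℂ)⁻¹ ^ (-n) := by
    rw [← zpow_mul, ← zpow_add₀ hα', ← zpow_add₀ hα', inv_zpow', neg_neg]
    ring_nf
  have hS : (-1 : ℂ) ^ n * (-1) ^ (m - n) = (-1) ^ m := by
    rw [← zpow_add₀ (by norm_num)]
    ring_nf
  have hQ : (q : ℂ) ^ (-(m * (m + 1))) * (q : ℂ) ^ (n * (n + 1) / 2) *
      ((q : ℂ) ^ (m + n + 1)) ^ (m - n) * (q : ℂ) ^ ((m - n) * (m - n - 1) / 2) =
      ((q : ℂ) ^ m) ^ (-n) * (q : ℂ) ^ (m * (m - 1) / 2) := by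
    rw [← zpow_mul, ← zpow_mul, ← zpow_add₀ hq, ← zpow_add₀ hq, ← zpow_add₀ hq, ← zpow_add₀ hq]
    congr 1
    have t1 := two_mul_int_triangle (m - n)
    have t2 := two_mul_int_triangle m
    have t3 := two_mul_int_triangle' n
    refine mul_left_cancel₀ (two_ne_zero (α := ℤ)) ?_
    linear_combination t1 - t2 + t3
  rw [neg_eq_neg_one_mul ((α : ℂ) ^ (-2 : ℤ) * _), mul_zpow, mul_zpow, mul_zpow, ← hA, ← hS,
    solCoeff]
  linear_combination -(P * ((α : ℂ) ^ (2 * m) * (α : ℂ) ^ (-n) * ((α : ℂ) ^ (-2 : ℤ)) ^ (m - n)) *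
    ((-1 : ℂ) ^ n * (-1) ^ (m - n))) * hQ

end Theta

/-! ### Circle averages of a function with one simple pole -/

section CircleAverages

open Real

theorem circleAverage_eq_of_differentiable {D : ℂ → ℂ} {r R : ℝ} (hr : 0 < r) (hrR : r ≤ R)
    (hD : ∀ z : ℂ, r ≤ ‖z‖ → ‖z‖ ≤ R → DifferentiableAt ℂ D z) :
    circleAverage D 0 R = circleAverage D 0 r := by
  rw [circleAverage_eq_circleIntegral hr.ne', circleAverage_eq_circleIntegral (hr.trans_le hrR).ne']
  congr 1
  refine Complex.circleIntegral_sub_center_inv_smul_eq_of_differentiable_on_annulus_off_countable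
    hr hrR Set.countable_empty (fun z hz => ?_) fun z hz => ?_
  · simp only [Set.mem_sdiff, mem_closedBall_zero_iff, mem_ball_zero_iff, not_lt] at hz
    exact (hD z hz.2 hz.1).continuousAt.continuousWithinAt
  · simp only [Set.mem_sdiff, mem_closedBall_zero_iff, mem_ball_zero_iff, not_le] at hz
    exact hD z hz.1.2.le hz.1.1.le

theorem circleIntegrable_of_differentiable {D : ℂ → ℂ} {r : ℝ} (hr : 0 ≤ r)
    (hD : ∀ z : ℂ, ‖z‖ = r → DifferentiableAt ℂ D z) : CircleIntegrable D 0 r := by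
  refine ContinuousOn.circleIntegrable hr fun z hz => ?_
  exact (hD z (by simpa using hz)).continuousAt.continuousWithinAt

theorem circleAverage_inv_sub_of_norm_lt {p : ℂ} {r : ℝ} (hr : 0 < r) (hp : r < ‖p‖) :
    circleAverage (fun z => (z - p)⁻¹) 0 r = -p⁻¹ := by
  have hne : ∀ z : ℂ, ‖z‖ ≤ r → z - p ≠ 0 := by
    intro z hz h
    rw [sub_eq_zero.mp h] at hz
    linarith
  have hd : ∀ z : ℂ, ‖z‖ ≤ r → DifferentiableAt ℂ (fun z => (z - p)⁻¹) z := fun z hz =>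
    (differentiableAt_id.sub_const p).inv (hne z hz)
  rw [circleAverage_of_differentiable_on_off_countable Set.countable_empty]
  · simp [inv_neg]
  · intro z hz
    rw [mem_closedBall_zero_iff, abs_of_pos hr] at hz
    exact (hd z hz).continuousAt.continuousWithinAt
  · intro z hz
    rw [Set.sdiff_empty, mem_ball_zero_iff, abs_of_pos hr] at hz
    exact hd z hz.le

theorem circleAverage_inv_sub_of_lt_norm {p : ℂ} {r : ℝ} (hp0 : p ≠ 0) (hp : ‖p‖ < r) :
    circleAverage (fun z => (z - p)⁻¹) 0 r = 0 := by
  have hr : 0 < r := (norm_nonneg p).trans_lt hp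
  have hne : ∀ z : ℂ, ‖z‖ = r → z - p ≠ 0 := by
    intro z hz h
    rw [sub_eq_zero.mp h] at hz
    linarith
  have h1 := circleAverage_sub_sub_inv_smul_of_differentiable_on_off_countable (c := 0) (R := r)
    (w := p) (f := fun _ => (1 : ℂ)) Set.countable_empty continuousOn_const
    (fun z _ => differentiableAt_const _) (by simpa [abs_of_pos hr] using hp)
  have h2 : circleAverage (fun z => (z - p)⁻¹) 0 r =
      circleAverage (fun z => p⁻¹ • (((z - 0) / (z - p)) • (1 : ℂ) - 1)) 0 r := by
    refine circleAverage_congr_sphere fun z hz => ?_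
    have := hne z (by simpa [abs_of_pos hr] using hz)
    simp only [smul_eq_mul]
    field_simp
    ring
  rw [h2, circleAverage_fun_smul, circleAverage_fun_sub, h1, circleAverage_const, sub_self,
    smul_zero]
  · refine circleIntegrable_of_differentiable hr.le fun z hz => ?_
    have := hne z hz
    fun_prop (disch := assumption)
  · exact circleIntegrable_const _ _ _

variable {h : ℂ → ℂ} {p : ℂ} {a b : ℝ}

theorem differentiableAt_dslope_annulus (hap : a < ‖p‖) (hpb : ‖p‖ < b)
    (hh : ∀ z : ℂ, a < ‖z‖ → ‖z‖ < b → DifferentiableAt ℂ h z) {z : ℂ} (hz : a < ‖z‖)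
    (hz' : ‖z‖ < b) : DifferentiableAt ℂ (dslope h p) z := by
  have hU : IsOpen {z : ℂ | a < ‖z‖ ∧ ‖z‖ < b} :=
    (isOpen_lt continuous_const continuous_norm).inter (isOpen_lt continuous_norm continuous_const)
  have : DifferentiableOn ℂ (dslope h p) {z : ℂ | a < ‖z‖ ∧ ‖z‖ < b} := by
    rw [Complex.differentiableOn_dslope (hU.mem_nhds ⟨hap, hpb⟩)]
    exact fun z hz => (hh z hz.1 hz.2).differentiableWithinAt
  exact this.differentiableAt (hU.mem_nhds ⟨hz, hz'⟩)

theorem div_sub_eq_dslope {z : ℂ} (hz : z ≠ p) :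
    h z / (z - p) = h p * (z - p)⁻¹ + dslope h p z := by
  rw [dslope_of_ne h hz, slope_def_field]
  have := sub_ne_zero.mpr hz
  field_simp
  ring

theorem eventuallyEq_codiscreteWithin_of_ne {f g : ℂ → ℂ} (p : ℂ) (s : Set ℂ)
    (hfg : ∀ z, z ≠ p → f z = g z) : f =ᶠ[codiscreteWithin s] g := by
  filter_upwards [compl_singleton_mem_codiscreteWithin p] with z hz using hfg z hz

/-- Splitting off `h(p) / (z - p)` leaves `dslope h p`, which is holomorphic in the annulus and has
the same average on all circles. The pole part averages to `-h(p)/p` inside and `0` outside. The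
circle through `p` is admitted if `h(p) = 0`, because the unit circle may contain a removable pole.
-/
theorem circleAverage_simplePole (ha : 0 ≤ a) (hap : a < ‖p‖) (hpb : ‖p‖ < b)
    (hh : ∀ z : ℂ, a < ‖z‖ → ‖z‖ < b → DifferentiableAt ℂ h z) {r : ℝ} (har : a < r) (hrb : r < b)
    (hr : r = ‖p‖ → h p = 0) :
    CircleIntegrable (fun z => h z / (z - p)) 0 r ∧
      circleAverage (fun z => h z / (z - p)) 0 r =
        (if r < ‖p‖ then -(h p / p) else 0) + circleAverage (dslope h p) 0 ‖p‖ := by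
  have hr0 : 0 < r := ha.trans_lt har
  have hp0 : p ≠ 0 := norm_pos_iff.mp (ha.trans_lt hap)
  have hD := fun {z : ℂ} => differentiableAt_dslope_annulus hap hpb hh (z := z)
  have hDi : CircleIntegrable (dslope h p) 0 r :=
    circleIntegrable_of_differentiable hr0.le fun z hz => hD (by linarith) (by linarith)
  have hDa : circleAverage (dslope h p) 0 r = circleAverage (dslope h p) 0 ‖p‖ := by
    rcases le_total r ‖p‖ with h1 | h1
    · exact (circleAverage_eq_of_differentiable hr0 h1
        fun z hz hz' => hD (by linarith) (by linarith)).symm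
    · exact circleAverage_eq_of_differentiable (norm_pos_iff.mpr hp0) h1
        fun z hz hz' => hD (by linarith) (by linarith)
  by_cases hrp : r = ‖p‖
  -- At `z = p` the quotient has the default value `0` and need not agree with `dslope`, but a
  -- single point does not affect the average.
  · have heq := eventuallyEq_codiscreteWithin_of_ne p (Metric.sphere 0 |r|)
      (f := fun z => h z / (z - p)) (g := dslope h p) fun z hz => by
        rw [div_sub_eq_dslope hz, hr hrp, zero_mul, zero_add]
    refine ⟨(circleIntegrable_congr_codiscreteWithin heq).mpr hDi, ?_⟩
    rw [circleAverage_congr_codiscreteWithin heq hr0.ne', hDa, if_neg hrp.not_lt, zero_add]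
  · have hne : ∀ z : ℂ, ‖z‖ = r → z ≠ p := by
      rintro z hz rfl
      exact hrp hz.symm
    have heq : Set.EqOn (fun z => h z / (z - p)) (fun z => h p • (z - p)⁻¹ + dslope h p z)
        (Metric.sphere 0 |r|) := by
      intro z hz
      rw [abs_of_pos hr0, mem_sphere_zero_iff_norm] at hz
      simp only [smul_eq_mul]
      exact div_sub_eq_dslope (hne z hz)
    have hI : CircleIntegrable (fun z => h p • (z - p)⁻¹) 0 r := by
      refine circleIntegrable_of_differentiable hr0.le fun z hz => ?_
      have := sub_ne_zero.mpr (hne z hz)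
      fun_prop (disch := assumption)
    refine ⟨(circleIntegrable_congr heq).mpr (hI.add hDi), ?_⟩
    rw [circleAverage_congr_sphere heq, circleAverage_fun_add hI hDi, hDa, circleAverage_fun_smul]
    congr 1
    rcases lt_or_gt_of_ne hrp with h1 | h1
    · rw [circleAverage_inv_sub_of_norm_lt hr0 h1, if_pos h1, smul_eq_mul]
      ring
    · rw [circleAverage_inv_sub_of_lt_norm hp0 h1, if_neg h1.not_gt, smul_zero]

end CircleAverages

/-- The Jost solution `(1 - z²) g_k(z) / θ(α z)`. -/
noncomputable def jostH (q α : ℝ) (k : ℤ) (z : ℂ) : ℂ :=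
  (1 - z ^ 2) * solG q α k z / qTheta q (α * z)

/-- The function `f_l(z) (1 - z²) g_k(z) / θ(α z)` whose circle averages compute the spectral
measure. -/
noncomputable def contourFn (q α : ℝ) (l k : ℤ) (z : ℂ) : ℂ := solF q α l z * jostH q α k z

/-- The radius `|α|⁻¹ q^{m + 1/2}`, half way between the poles `α⁻¹ q^m` and `α⁻¹ q^{m+1}`. -/
noncomputable def gapRadius (q α : ℝ) (m : ℤ) : ℝ := |α|⁻¹ * q ^ m * √q

/-! ### Jumps of the circle averages across the poles -/

section Contour

open Real

variable {q α : ℝ}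

theorem differentiableAt_solF (hq0 : 0 < q) (hq1 : q < 1) (n : ℤ) {z : ℂ} (hz : z ≠ 0) :
    DifferentiableAt ℂ (solF q α n) z := by
  have h : DifferentiableAt ℂ (fun z : ℂ => phiReg 0 (z⁻¹ * (α : ℂ)⁻¹ * (q : ℂ) ^ (n + 1)) q
      (z * (α : ℂ)⁻¹ * (q : ℂ) ^ (n + 1))) z := by
    refine differentiableAt_phiReg (norm_ofReal_lt_one hq0 hq1) (isOpen_ne (x := (0 : ℂ)))
      (fun w hw => ?_) (fun w hw => ?_) hz
    · exact (((differentiableAt_inv hw).mul_const _).mul_const _).differentiableWithinAt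
    · fun_prop
  exact h.const_mul _

theorem differentiableAt_solG (hq0 : 0 < q) (hq1 : q < 1) (n : ℤ) {z : ℂ} (hz : z ≠ 0) :
    DifferentiableAt ℂ (solG q α n) z := by
  have h : DifferentiableAt ℂ (fun z : ℂ => phiReg 0 (z ^ 2 * q) q
      (α * z * (q : ℂ) ^ (1 - n))) z :=
    differentiableAt_phiReg (norm_ofReal_lt_one hq0 hq1) isOpen_univ
      (by fun_prop) (by fun_prop) (Set.mem_univ z)
  exact (differentiableAt_zpow.mpr (Or.inl hz)).mul h

theorem differentiableAt_qTheta (hq0 : 0 < q) (hq1 : q < 1) {y : ℂ} (hy : y ≠ 0) :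
    DifferentiableAt ℂ (fun y => qTheta q y) y := by
  have hd := differentiable_qPochInf (norm_ofReal_lt_one hq0 hq1)
  have h2 : DifferentiableAt ℂ (fun y : ℂ => qPochInf (q * y⁻¹) q) y :=
    (hd _).comp y ((differentiableAt_inv hy).const_mul _)
  exact (hd y).mul h2

/-- The numerator of `contourFn` at its simple pole `p = α⁻¹ q^m`. -/
noncomputable def contourNum (q α : ℝ) (l k m : ℤ) (z : ℂ) : ℂ :=
  let p : ℂ := (α : ℂ)⁻¹ * (q : ℂ) ^ m
  solF q α l z * (-p) * (1 - z ^ 2) * solG q α k z *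
    ((-1) ^ m * (z / p) ^ m * (q : ℂ) ^ (m * (m - 1) / 2)) /
    (qPochInf (z / p * q) q * qPochInf (q * (z / p)⁻¹) q)

/-- Since `αz = q^m (z/p)`, quasi-periodicity moves the relevant zero of the theta function to `z/p
= 1`, where it sits in the explicit factor `1 - z/p`. -/
theorem contourFn_eq (hq0 : 0 < q) (hq1 : q < 1) (hα : α ≠ 0) (l k m : ℤ) {z : ℂ} (hz : z ≠ 0) :
    contourFn q α l k z = contourNum q α l k m z / (z - (α : ℂ)⁻¹ * (q : ℂ) ^ m) := by
  have hq : (q : ℂ) ≠ 0 := by exact_mod_cast hq0.ne'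
  have hα' : (α : ℂ) ≠ 0 := by exact_mod_cast hα
  have hqn := norm_ofReal_lt_one hq0 hq1
  set p : ℂ := (α : ℂ)⁻¹ * (q : ℂ) ^ m with hp
  have hp0 : p ≠ 0 := mul_ne_zero (inv_ne_zero hα') (zpow_ne_zero _ hq)
  have hy : z / p ≠ 0 := div_ne_zero hz hp0
  have hQ : (q : ℂ) ^ m ≠ 0 := zpow_ne_zero _ hq
  have hαz : (α : ℂ) * z = (q : ℂ) ^ m * (z / p) := by
    rw [hp]; field_simp
  have hθ := qTheta_zpow_mul hqn hq hy m
  rw [← hαz] at hθ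
  set c : ℂ := (-1) ^ m * (z / p) ^ m * (q : ℂ) ^ (m * (m - 1) / 2) with hc
  have hc0 : c ≠ 0 := mul_ne_zero (mul_ne_zero (zpow_ne_zero _ (by norm_num)) (zpow_ne_zero _ hy))
    (zpow_ne_zero _ hq)
  have hθ' : qTheta q (α * z) = (1 - z / p) *
      (qPochInf (z / p * q) q * qPochInf (q * (z / p)⁻¹) q) / c := by
    rw [eq_div_iff hc0, hθ, qTheta, qPochInf_eq_mul hqn (z / p)]
    ring
  have hzp : 1 - z / p = -(z - p) / p := by field_simp; ring
  rw [contourFn, jostH, hθ', contourNum, hzp]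
  simp only [← hp, ← hc]
  field_simp

theorem norm_pole (hq0 : 0 < q) (m : ℤ) :
    ‖(α : ℂ)⁻¹ * (q : ℂ) ^ m‖ = |α|⁻¹ * q ^ m := by
  rw [norm_mul, norm_inv, norm_zpow, Complex.norm_real, Complex.norm_real, Real.norm_eq_abs,
    Real.norm_of_nonneg hq0.le]

theorem differentiableAt_contourNum (hq0 : 0 < q) (hq1 : q < 1) (hα : α ≠ 0) (l k m : ℤ) {z : ℂ}
    (h1 : q * (|α|⁻¹ * q ^ m) < ‖z‖) (h2 : ‖z‖ < (|α|⁻¹ * q ^ m) / q) :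
    DifferentiableAt ℂ (contourNum q α l k m) z := by
  have hq : (q : ℂ) ≠ 0 := by exact_mod_cast hq0.ne'
  have hα' : (α : ℂ) ≠ 0 := by exact_mod_cast hα
  have hqn := norm_ofReal_lt_one hq0 hq1
  have hpn := norm_pole (α := α) hq0 m
  have hP : 0 < |α|⁻¹ * q ^ m := by positivity
  have hz : z ≠ 0 := norm_pos_iff.mp (lt_trans (by positivity) h1)
  unfold contourNum
  set p : ℂ := (α : ℂ)⁻¹ * (q : ℂ) ^ m with hp
  have hp0 : p ≠ 0 := mul_ne_zero (inv_ne_zero hα') (zpow_ne_zero _ hq)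
  have hne : ∀ a : ℂ, ‖a‖ < 1 → qPochInf a q ≠ 0 := by
    refine fun a ha => qPochInf_ne_zero hqn fun j h0 => ?_
    have h3 : ‖a * (q : ℂ) ^ j‖ = 1 := by rw [← sub_eq_zero.mp h0]; simp
    rw [norm_mul, norm_pow] at h3
    have := mul_le_of_le_one_right (norm_nonneg a) (pow_le_one₀ (norm_nonneg _) hqn.le (n := j))
    linarith
  have hn1 : qPochInf (z / p * q) q ≠ 0 := by
    refine hne _ ?_
    rw [norm_mul, norm_div, hpn, Complex.norm_real, Real.norm_of_nonneg hq0.le, div_mul_eq_mul_div,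
      div_lt_one hP]
    rwa [lt_div_iff₀ hq0] at h2
  have hn2 : qPochInf (q * (z / p)⁻¹) q ≠ 0 := by
    refine hne _ ?_
    rw [norm_mul, norm_inv, norm_div, hpn, Complex.norm_real, Real.norm_of_nonneg hq0.le, inv_div,
      ← mul_div_assoc, div_lt_one (norm_pos_iff.mpr hz)]
    exact h1
  have hd := differentiable_qPochInf hqn
  have d1 : DifferentiableAt ℂ (fun z => qPochInf (z / p * q) q) z :=
    (hd _).comp z (by fun_prop)
  have dp : DifferentiableAt ℂ (fun z => z / p) z := by fun_prop
  have d0 : DifferentiableAt ℂ (fun z => (q : ℂ) * (z / p)⁻¹) z :=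
    (dp.fun_inv (div_ne_zero hz hp0)).const_mul _
  have d2 : DifferentiableAt ℂ (fun z => qPochInf (q * (z / p)⁻¹) q) z := (hd _).comp z d0
  have d3 : DifferentiableAt ℂ (fun z => (z / p) ^ m) z :=
    DifferentiableAt.comp (g := fun w : ℂ => w ^ m) z
      (differentiableAt_zpow.mpr (Or.inl (div_ne_zero hz hp0))) dp
  have d4 := differentiableAt_solF (α := α) hq0 hq1 l hz
  have d5 := differentiableAt_solG (α := α) hq0 hq1 k hz
  exact DifferentiableAt.div (by fun_prop) (d1.mul d2) (mul_ne_zero hn1 hn2)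

theorem contourNum_pole (hq0 : 0 < q) (hq1 : q < 1) (hα : α ≠ 0) (l k m : ℤ) :
    contourNum q α l k m ((α : ℂ)⁻¹ * (q : ℂ) ^ m) / ((α : ℂ)⁻¹ * (q : ℂ) ^ m) =
      -(1 / qPochInf q q ^ 2 * discreteTerm q α k l m) := by
  have hq : (q : ℂ) ≠ 0 := by exact_mod_cast hq0.ne'
  have hα' : (α : ℂ) ≠ 0 := by exact_mod_cast hα
  have h := solG_eigenvalue hq0 hq1 hα k m
  have e : (α : ℂ) ^ (-2 : ℤ) * (q : ℂ) ^ (2 * m) = ((α : ℂ)⁻¹ * (q : ℂ) ^ m) ^ 2 := by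
    rw [mul_pow, mul_comm 2 m, zpow_mul, zpow_neg]
    norm_cast
    simp
  rw [contourNum, discreteTerm, e]
  set p : ℂ := (α : ℂ)⁻¹ * (q : ℂ) ^ m with hp
  have hp0 : p ≠ 0 := mul_ne_zero (inv_ne_zero hα') (zpow_ne_zero _ hq)
  simp only [div_self hp0, one_zpow, mul_one, one_mul, inv_one]
  have hPq : qPochInf (q : ℂ) q ≠ 0 := qPochInf_ne_zero (norm_ofReal_lt_one hq0 hq1) fun j => by
    simpa [pow_succ'] using one_sub_pow_ne_zero (norm_ofReal_lt_one hq0 hq1) j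
  rw [show solF q α l p * (-p) * (1 - p ^ 2) * solG q α k p *
      ((-1) ^ m * (q : ℂ) ^ (m * (m - 1) / 2)) = solF q α l p * (-p) * (1 - p ^ 2) *
      (solG q α k p * ((-1) ^ m * (q : ℂ) ^ (m * (m - 1) / 2))) by ring, h]
  field_simp

theorem gapRadius_pos (hq0 : 0 < q) (hα : α ≠ 0) (m : ℤ) : 0 < gapRadius q α m := by
  have := abs_pos.mpr hα
  unfold gapRadius
  positivity

/-- In the annulus bounded by the moduli of the two neighbouring poles, `α⁻¹ q^m` is the only
possible pole. `D` is the average of the regular part and is common to all radii. -/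
theorem circleAverage_contourFn (hq0 : 0 < q) (hq1 : q < 1) (hα : α ≠ 0) (l k m : ℤ) :
    ∃ D : ℂ, ∀ r : ℝ, q * (|α|⁻¹ * q ^ m) < r → r < (|α|⁻¹ * q ^ m) / q →
      (r = |α|⁻¹ * q ^ m → discreteTerm q α k l m = 0) →
      CircleIntegrable (contourFn q α l k) 0 r ∧
      circleAverage (contourFn q α l k) 0 r =
        (if r < |α|⁻¹ * q ^ m then 1 / qPochInf q q ^ 2 * discreteTerm q α k l m else 0) + D := by
  have hq : (q : ℂ) ≠ 0 := by exact_mod_cast hq0.ne'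
  have hα' : (α : ℂ) ≠ 0 := by exact_mod_cast hα
  have hpn := norm_pole (α := α) hq0 m
  have hP : 0 < |α|⁻¹ * q ^ m := by have := abs_pos.mpr hα; positivity
  set p : ℂ := (α : ℂ)⁻¹ * (q : ℂ) ^ m with hp
  have hp0 : p ≠ 0 := mul_ne_zero (inv_ne_zero hα') (zpow_ne_zero _ hq)
  have hnum := contourNum_pole hq0 hq1 hα l k m
  rw [← hp] at hnum
  refine ⟨circleAverage (dslope (contourNum q α l k m) p) 0 ‖p‖, fun r h1 h2 h3 => ?_⟩
  have hr0 : 0 < r := lt_trans (by positivity) h1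
  have hap : q * (|α|⁻¹ * q ^ m) < ‖p‖ := by
    rw [hpn]; exact mul_lt_of_lt_one_left hP hq1
  have hpb : ‖p‖ < (|α|⁻¹ * q ^ m) / q := by
    rw [hpn]; exact (lt_div_iff₀ hq0).mpr (mul_lt_of_lt_one_right hP hq1)
  obtain ⟨c1, c2⟩ := circleAverage_simplePole (by positivity) hap hpb
    (fun z hz hz' => differentiableAt_contourNum hq0 hq1 hα l k m hz hz') h1 h2 (fun hr => by
      rw [hpn] at hr
      rw [h3 hr, mul_zero, neg_zero, div_eq_zero_iff] at hnum
      exact hnum.resolve_right hp0)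
  have heq : Set.EqOn (contourFn q α l k) (fun z => contourNum q α l k m z / (z - p))
      (Metric.sphere 0 |r|) := by
    intro z hz
    refine contourFn_eq hq0 hq1 hα l k m (norm_pos_iff.mp ?_)
    rw [mem_sphere_zero_iff_norm] at hz
    rw [hz]
    exact abs_pos.mpr hr0.ne'
  refine ⟨(circleIntegrable_congr heq).mpr c1, ?_⟩
  rw [circleAverage_congr_sphere heq, c2, hnum, neg_neg, hpn]

theorem lt_sqrt_self (hq0 : 0 < q) (hq1 : q < 1) : q < √q :=
  (Real.lt_sqrt hq0.le).mpr (by nlinarith)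

theorem sqrt_lt_one' (hq1 : q < 1) : √q < 1 := (Real.sqrt_lt' one_pos).mpr (by simpa using hq1)

theorem circleAverage_contourFn_step (hq0 : 0 < q) (hq1 : q < 1) (hα : α ≠ 0) (l k m : ℤ) :
    circleAverage (contourFn q α l k) 0 (gapRadius q α (m + 1)) =
      circleAverage (contourFn q α l k) 0 (gapRadius q α m) +
        1 / qPochInf q q ^ 2 * discreteTerm q α k l (m + 1) := by
  obtain ⟨D, hD⟩ := circleAverage_contourFn hq0 hq1 hα l k (m + 1)
  have hs1 := lt_sqrt_self hq0 hq1
  have hs2 := sqrt_lt_one' hq1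
  have hs0 : 0 < √q := Real.sqrt_pos.mpr hq0
  have hss : √q * √q = q := Real.mul_self_sqrt hq0.le
  have hP : 0 < |α|⁻¹ * q ^ (m + 1) := by have := abs_pos.mpr hα; positivity
  have e1 : gapRadius q α (m + 1) = |α|⁻¹ * q ^ (m + 1) * √q := rfl
  have e2 : gapRadius q α m = |α|⁻¹ * q ^ (m + 1) / √q := by
    rw [gapRadius, zpow_add_one₀ hq0.ne', eq_div_iff hs0.ne', mul_assoc _ _ √q, hss]
    ring
  set P := |α|⁻¹ * q ^ (m + 1)
  have l1 : P * √q < P := mul_lt_of_lt_one_right hP hs2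
  have l2 : P < P / √q := (lt_div_iff₀ hs0).mpr l1
  have l3 : P < P / q := (lt_div_iff₀ hq0).mpr (mul_lt_of_lt_one_right hP hq1)
  have l4 : q * P < P := mul_lt_of_lt_one_left hP hq1
  have l5 : P / √q < P / q := div_lt_div_of_pos_left hP hq0 hs1
  have l6 : q * P < P * √q := by rw [mul_comm]; gcongr
  rw [e1, e2, (hD _ l6 (l1.trans l3) (fun h => absurd h l1.ne)).2,
    (hD _ (l4.trans l2) l5 (fun h => absurd h l2.ne')).2, if_pos l1, if_neg l2.not_gt]
  ring

/-- The floor is chosen so that `|α⁻¹ q^{j+1}| < 1 ≤ |α⁻¹ q^j|`. Hence the unit circle and the gap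
circle of index `j` have no pole between them, except possibly a removable one on the unit circle.
-/
theorem circleAverage_contourFn_one (hq0 : 0 < q) (hq1 : q < 1) (hα : α ≠ 0) (l k : ℤ) :
    CircleIntegrable (contourFn q α l k) 0 1 ∧
      circleAverage (contourFn q α l k) 0 1 =
        circleAverage (contourFn q α l k) 0 (gapRadius q α ⌊logb q |α|⌋) := by
  set j := ⌊logb q |α|⌋ with hj
  have hα0 := abs_pos.mpr hα
  have h1 : |α| ≤ q ^ j := by
    have : (j : ℝ) ≤ logb q |α| := Int.floor_le _
    have h2 := Real.rpow_le_rpow_of_exponent_ge hq0 hq1.le this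
    rwa [Real.rpow_logb hq0 hq1.ne hα0, Real.rpow_intCast] at h2
  have h2 : q ^ (j + 1) < |α| := by
    have : logb q |α| < ((j + 1 : ℤ) : ℝ) := by push_cast; exact Int.lt_floor_add_one _
    have h2 := Real.rpow_lt_rpow_of_exponent_gt hq0 hq1 this
    rwa [Real.rpow_logb hq0 hq1.ne hα0, Real.rpow_intCast] at h2
  obtain ⟨D, hD⟩ := circleAverage_contourFn hq0 hq1 hα l k j
  have hs1 := lt_sqrt_self hq0 hq1
  have hs2 := sqrt_lt_one' hq1
  have hP1 : 1 ≤ |α|⁻¹ * q ^ j := by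
    rw [inv_mul_eq_div, one_le_div hα0]; exact h1
  have hP2 : q * (|α|⁻¹ * q ^ j) < 1 := by
    rw [zpow_add_one₀ hq0.ne'] at h2
    rw [inv_mul_eq_div, ← mul_div_assoc, div_lt_one hα0, mul_comm]; exact h2
  -- A pole on the unit circle is `±1`, and it is cancelled by the factor `1 - z²`.
  have hd : 1 = |α|⁻¹ * q ^ j → discreteTerm q α k l j = 0 := by
    intro h
    have h3 : (α : ℂ) ^ (-2 : ℤ) * (q : ℂ) ^ (2 * j) = 1 := by
      have : (|α|⁻¹ * q ^ j) ^ 2 = 1 := by rw [← h]; simp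
      rw [mul_pow, inv_pow, sq_abs] at this
      rw [mul_comm 2 j, zpow_mul, zpow_neg]
      exact_mod_cast this
    rw [discreteTerm, h3]
    simp
  have e1 : gapRadius q α j = |α|⁻¹ * q ^ j * √q := rfl
  set P := |α|⁻¹ * q ^ j
  have hP : 0 < P := by linarith
  have l1 : P * √q < P := mul_lt_of_lt_one_right hP hs2
  have l3 : P < P / q := (lt_div_iff₀ hq0).mpr (mul_lt_of_lt_one_right hP hq1)
  have l6 : q * P < P * √q := by rw [mul_comm]; gcongr
  obtain ⟨i1, a1⟩ := hD 1 hP2 (hP1.trans_lt l3) hd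
  refine ⟨i1, ?_⟩
  rw [a1, e1, (hD _ l6 (l1.trans l3) (fun h => absurd h l1.ne)).2, if_pos l1]
  rcases hP1.lt_or_eq with h | h
  · rw [if_pos h]
  · rw [if_neg h.not_lt, hd h, mul_zero]

theorem circleAverage_contourFn_add_sum (hq0 : 0 < q) (hq1 : q < 1) (hα : α ≠ 0) (l k : ℤ)
    (N : ℕ) :
    circleAverage (contourFn q α l k) 0 1 + 1 / qPochInf q q ^ 2 *
        ∑ i ∈ Finset.range N, discreteTerm q α k l (⌊logb q |α|⌋ + 1 + i) =
      circleAverage (contourFn q α l k) 0 (gapRadius q α (⌊logb q |α|⌋ + N)) := by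
  induction N with
  | zero => simp [(circleAverage_contourFn_one hq0 hq1 hα l k).2]
  | succ N ih =>
    rw [Finset.sum_range_succ, mul_add, ← add_assoc, ih]
    push_cast
    rw [← add_assoc, circleAverage_contourFn_step hq0 hq1 hα, add_right_comm _ 1 (N : ℤ)]

end Contour

/-! ### The limit of the circle averages at the origin -/

section ContourLimit

open Real

variable {q α : ℝ}

/-- The modulus `q^{j+1/2}` is at most `√q` or at least `1/√q`, and `1/√q - 1 ≥ 1 - √q`. This
uniform gap is the reason for using circles midway between the poles. -/
theorem le_norm_one_sub_of_norm_eq (hq0 : 0 < q) (hq1 : q < 1) {u : ℂ} {j : ℤ}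
    (hu : ‖u‖ = q ^ j * √q) : 1 - √q ≤ ‖1 - u‖ := by
  have hs2 := sqrt_lt_one' hq1
  have hs0 : 0 < √q := Real.sqrt_pos.mpr hq0
  have hss : √q * √q = q := Real.mul_self_sqrt hq0.le
  rcases le_or_gt 0 j with hj | hj
  · have h1 : q ^ j ≤ 1 := by simpa using zpow_le_zpow_right_of_le_one₀ hq0 hq1.le hj
    have h2 := norm_sub_norm_le (1 : ℂ) u
    rw [norm_one, hu] at h2
    have h3 := mul_le_of_le_one_left hs0.le h1
    linarith
  · have h1 : q ^ (-1 : ℤ) ≤ q ^ j := zpow_le_zpow_right_of_le_one₀ hq0 hq1.le (by omega)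
    have h2 := norm_sub_norm_le u 1
    rw [norm_one, hu, norm_sub_rev] at h2
    have h3 : (√q)⁻¹ ≤ q ^ j * √q := by
      calc (√q)⁻¹ = q ^ (-1 : ℤ) * √q := by
            rw [zpow_neg_one, eq_inv_mul_iff_mul_eq₀ hq0.ne', ← div_eq_mul_inv,
              div_eq_iff hs0.ne', hss]
        _ ≤ _ := by gcongr
    have h4 : 2 - √q ≤ (√q)⁻¹ := by
      rw [← one_div, le_div_iff₀ hs0]
      nlinarith [sq_nonneg (√q - 1)]
    linarith

/-- The union of the circles that run half way between the poles. -/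
def gapCircles (q α : ℝ) : Set ℂ := {z | ∃ m : ℤ, ‖z‖ = gapRadius q α m}

theorem ne_zero_of_mem_gapCircles (hq0 : 0 < q) (hα : α ≠ 0) {z : ℂ} (hz : z ∈ gapCircles q α) :
    z ≠ 0 := by
  obtain ⟨m, hm⟩ := hz
  exact norm_pos_iff.mp (hm ▸ gapRadius_pos hq0 hα m)

theorem le_norm_one_sub_mul (hq0 : 0 < q) (hq1 : q < 1) (hα : α ≠ 0) {z : ℂ}
    (hz : z ∈ gapCircles q α) (j : ℤ) : 1 - √q ≤ ‖1 - α * z * (q : ℂ) ^ j‖ := by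
  obtain ⟨m, hm⟩ := hz
  refine le_norm_one_sub_of_norm_eq hq0 hq1 (j := m + j) ?_
  have := abs_pos.mpr hα
  rw [norm_mul, norm_mul, norm_zpow, Complex.norm_real, Complex.norm_real, Real.norm_eq_abs,
    Real.norm_of_nonneg hq0.le, hm, gapRadius, zpow_add₀ hq0.ne']
  field_simp

theorem le_norm_one_sub_inv_mul (hq0 : 0 < q) (hq1 : q < 1) (hα : α ≠ 0) {z : ℂ}
    (hz : z ∈ gapCircles q α) (j : ℤ) : 1 - √q ≤ ‖1 - z⁻¹ * (α : ℂ)⁻¹ * (q : ℂ) ^ j‖ := by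
  obtain ⟨m, hm⟩ := hz
  refine le_norm_one_sub_of_norm_eq hq0 hq1 (j := j - m - 1) ?_
  have := abs_pos.mpr hα
  have hs0 : 0 < √q := Real.sqrt_pos.mpr hq0
  have hss : √q * √q = q := Real.mul_self_sqrt hq0.le
  rw [norm_mul, norm_mul, norm_zpow, norm_inv, norm_inv, Complex.norm_real, Complex.norm_real,
    Real.norm_eq_abs, Real.norm_of_nonneg hq0.le, hm, gapRadius, zpow_sub₀ hq0.ne',
    zpow_sub₀ hq0.ne', zpow_one]
  field_simp
  rw [sq, hss]

/-- The ratio is identically `1` for `l = 0`. Changing `l` by one changes it by a factor `1 - αz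
q^{-(l+1)}`, which tends to `1`. -/
theorem tendsto_solF_ratio (hq0 : 0 < q) (hq1 : q < 1) (hα : α ≠ 0) (l : ℤ) :
    Tendsto (fun z => solCoeff q α l * qPochInf (z⁻¹ * (α : ℂ)⁻¹ * (q : ℂ) ^ (l + 1)) q /
      (qPochInf (q * (α * z)⁻¹) q * z ^ l)) (𝓝[gapCircles q α] 0) (𝓝 1) := by
  have hq : (q : ℂ) ≠ 0 := by exact_mod_cast hq0.ne'
  have hα' : (α : ℂ) ≠ 0 := by exact_mod_cast hα
  have hqn := norm_ofReal_lt_one hq0 hq1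
  have hs2 := sqrt_lt_one' hq1
  set t : ℤ → ℂ → ℂ := fun l z => solCoeff q α l *
    qPochInf (z⁻¹ * (α : ℂ)⁻¹ * (q : ℂ) ^ (l + 1)) q / (qPochInf (q * (α * z)⁻¹) q * z ^ l) with ht
  have hne : ∀ l : ℤ, ∀ z ∈ gapCircles q α, 1 - α * z * (q : ℂ) ^ l ≠ 0 := fun l z hz =>
    norm_pos_iff.mp (lt_of_lt_of_le (by linarith) (le_norm_one_sub_mul hq0 hq1 hα hz l))
  have hstep : ∀ l : ℤ, ∀ z ∈ gapCircles q α,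
      t (l + 1) z * (1 - α * z * (q : ℂ) ^ (-(l + 1))) = t l z := by
    intro l z hz
    have hz0 := ne_zero_of_mem_gapCircles hq0 hα hz
    simp only [ht]
    rw [solCoeff_succ hq0 hα, qPochInf_eq_mul hqn (z⁻¹ * (α : ℂ)⁻¹ * (q : ℂ) ^ (l + 1)),
      mul_assoc (z⁻¹ * (α : ℂ)⁻¹) _ (q : ℂ), ← zpow_add_one₀ hq (l + 1), zpow_add_one₀ hz0,
      zpow_neg]
    have hQ : (q : ℂ) ^ (l + 1) ≠ 0 := zpow_ne_zero _ hq
    generalize (q : ℂ) ^ (l + 1) = Q at *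
    field_simp
    ring
  have hfac : ∀ l : ℤ, Tendsto (fun z : ℂ => 1 - α * z * (q : ℂ) ^ (-(l + 1)))
      (𝓝[gapCircles q α] 0) (𝓝 1) := by
    intro l
    have : Tendsto (fun z : ℂ => 1 - α * z * (q : ℂ) ^ (-(l + 1))) (𝓝 0)
        (𝓝 (1 - α * 0 * (q : ℂ) ^ (-(l + 1)))) := Continuous.tendsto (by fun_prop) 0
    simp only [mul_zero, zero_mul, sub_zero] at this
    exact this.mono_left nhdsWithin_le_nhds
  change Tendsto (t l) _ _
  induction l using Int.induction_on with
  | zero =>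
    refine tendsto_const_nhds.congr' ?_
    filter_upwards [self_mem_nhdsWithin] with z hz
    have hz0 := ne_zero_of_mem_gapCircles hq0 hα hz
    have hP : qPochInf (q * (α * z)⁻¹) q ≠ 0 := qPochInf_ne_zero hqn fun j => by
      have := le_norm_one_sub_inv_mul hq0 hq1 hα hz (j + 1)
      refine norm_pos_iff.mp (lt_of_lt_of_le (show 0 < 1 - √q by linarith) (this.trans_eq ?_))
      congr 2
      rw [zpow_add_one₀ hq, mul_inv, zpow_natCast]
      ring
    have e : z⁻¹ * (α : ℂ)⁻¹ * q = q * (α * z)⁻¹ := by rw [mul_inv]; ring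
    simp only [ht, solCoeff_zero, zero_add, zpow_one, zpow_zero, e, mul_one, one_mul]
    exact (div_self hP).symm
  | succ i ih =>
    have h : Tendsto (fun z => t i z / (1 - α * z * (q : ℂ) ^ (-((i : ℤ) + 1))))
        (𝓝[gapCircles q α] 0) (𝓝 (1 / 1)) := ih.div (hfac i) one_ne_zero
    rw [div_one] at h
    refine h.congr' ?_
    filter_upwards [self_mem_nhdsWithin] with z hz
    rw [← hstep i z hz, mul_div_cancel_right₀ _ (hne _ z hz)]
  | pred i ih =>
    have h := ih.mul (hfac (-i - 1))
    rw [mul_one] at h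
    refine h.congr' ?_
    filter_upwards [self_mem_nhdsWithin] with z hz
    have := hstep (-i - 1) z hz
    rwa [sub_add_cancel] at this ⊢

/-- As `z → 0` the first argument is large and, on the gap circles, uniformly away from the zeros of
the product, while the second one tends to `0`. -/
theorem tendsto_phiReg_ratio (hq0 : 0 < q) (hq1 : q < 1) (hα : α ≠ 0) (l : ℤ) :
    Tendsto (fun z => phiReg 0 (z⁻¹ * (α : ℂ)⁻¹ * (q : ℂ) ^ (l + 1)) q
        (z * (α : ℂ)⁻¹ * (q : ℂ) ^ (l + 1)) /
      qPochInf (z⁻¹ * (α : ℂ)⁻¹ * (q : ℂ) ^ (l + 1)) q) (𝓝[gapCircles q α] 0) (𝓝 1) := by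
  have hq : (q : ℂ) ≠ 0 := by exact_mod_cast hq0.ne'
  have hα' : (α : ℂ) ≠ 0 := by exact_mod_cast hα
  have hqn := norm_ofReal_lt_one hq0 hq1
  have hs2 := sqrt_lt_one' hq1
  have hδ : 0 < 1 - √q := by linarith
  obtain ⟨K, hK⟩ := exists_phiReg_sub_qPochInf_le hqn hδ 1
  set c : ℂ := (α : ℂ)⁻¹ * (q : ℂ) ^ (l + 1) with hc
  have hc0 : c ≠ 0 := mul_ne_zero (inv_ne_zero hα') (zpow_ne_zero _ hq)
  have hlim : Tendsto (fun z : ℂ => K * ‖1 - z⁻¹ * c‖⁻¹) (𝓝[gapCircles q α] 0) (𝓝 0) := by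
    have h1 : Tendsto (fun z : ℂ => z / (z - c)) (𝓝 0) (𝓝 (0 / (0 - c))) :=
      tendsto_id.div (tendsto_id.sub_const c) (by simpa using hc0)
    have h2 := (h1.norm.const_mul K).mono_left (nhdsWithin_le_nhds (s := gapCircles q α))
    rw [zero_div, norm_zero, mul_zero] at h2
    refine h2.congr' ?_
    filter_upwards [self_mem_nhdsWithin] with z hz
    have hz0 := ne_zero_of_mem_gapCircles hq0 hα hz
    rw [← norm_inv]
    congr 2
    rw [show 1 - z⁻¹ * c = (z - c) / z by field_simp, inv_div]
  have hw : ∀ᶠ z : ℂ in 𝓝[gapCircles q α] 0, ‖z * c‖ ≤ 1 := by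
    have h1 : Tendsto (fun z : ℂ => ‖z * c‖) (𝓝 0) (𝓝 ‖0 * c‖) :=
      (tendsto_id.mul_const c).norm
    rw [zero_mul, norm_zero] at h1
    exact (h1.mono_left nhdsWithin_le_nhds).eventually_le_const one_pos
  simp only [mul_assoc _ (α : ℂ)⁻¹, ← hc]
  rw [tendsto_iff_norm_sub_tendsto_zero]
  refine squeeze_zero' (Eventually.of_forall fun _ => norm_nonneg _) ?_ hlim
  filter_upwards [self_mem_nhdsWithin, hw] with z hz hzw
  have hB : ∀ j : ℕ, 1 - √q ≤ ‖1 - z⁻¹ * c * (q : ℂ) ^ j‖ := by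
    intro j
    have := le_norm_one_sub_inv_mul hq0 hq1 hα hz (l + 1 + j)
    rwa [zpow_add₀ hq, zpow_natCast, ← mul_assoc, mul_assoc z⁻¹, ← hc] at this
  have hP : qPochInf (z⁻¹ * c) q ≠ 0 :=
    qPochInf_ne_zero hqn fun j => norm_pos_iff.mp (hδ.trans_le (hB j))
  have := hK _ _ hB hzw
  rw [div_sub_one hP, norm_div, div_le_iff₀ (norm_pos_iff.mpr hP)]
  refine this.trans_eq ?_
  ring

/-- Up to factors tending to `1` the function is `z^{l-k}`: near the origin `f_l` is comparable to
`(q/(αz); q)_∞ z^l` and `g_k` to `z^{-k}`. This explains the hypothesis `k ≤ l`. -/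
theorem tendsto_contourFn (hq0 : 0 < q) (hq1 : q < 1) (hα : α ≠ 0) {l k : ℤ} (hkl : k ≤ l) :
    Tendsto (contourFn q α l k) (𝓝[gapCircles q α] 0) (𝓝 (if k = l then 1 else 0)) := by
  have hq : (q : ℂ) ≠ 0 := by exact_mod_cast hq0.ne'
  have hα' : (α : ℂ) ≠ 0 := by exact_mod_cast hα
  have hqn := norm_ofReal_lt_one hq0 hq1
  have hs2 := sqrt_lt_one' hq1
  have hδ : 0 < 1 - √q := by linarith
  have h1 := tendsto_solF_ratio hq0 hq1 hα l
  have h2 := tendsto_phiReg_ratio hq0 hq1 hα l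
  obtain ⟨n, rfl⟩ := Int.le.dest hkl
  have h3 : Tendsto (fun z : ℂ => z ^ n) (𝓝[gapCircles q α] 0) (𝓝 (if k = k + n then 1 else 0)) := by
    have : Tendsto (fun z : ℂ => z ^ n) (𝓝 0) (𝓝 (0 ^ n)) := Continuous.tendsto (by fun_prop) 0
    rw [zero_pow_eq] at this
    simpa [eq_comm] using this.mono_left (nhdsWithin_le_nhds (s := gapCircles q α))
  have h4 : Tendsto (fun z : ℂ => (1 - z ^ 2) * phiReg 0 (z ^ 2 * q) q (α * z * (q : ℂ) ^ (1 - k)) /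
      qPochInf (α * z) q) (𝓝[gapCircles q α] 0) (𝓝 1) := by
    have e1 : Tendsto (fun z : ℂ => 1 - z ^ 2) (𝓝 0) (𝓝 (1 - 0 ^ 2)) :=
      Continuous.tendsto (by fun_prop) 0
    have e2 : Tendsto (fun z : ℂ => z ^ 2 * q) (𝓝 0) (𝓝 (0 ^ 2 * q)) :=
      Continuous.tendsto (by fun_prop) 0
    have e3 : Tendsto (fun z : ℂ => α * z * (q : ℂ) ^ (1 - k)) (𝓝 0)
        (𝓝 (α * 0 * (q : ℂ) ^ (1 - k))) := Continuous.tendsto (by fun_prop) 0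
    have e4 : Tendsto (fun z : ℂ => qPochInf (α * z) q) (𝓝 0) (𝓝 (qPochInf (α * 0) q)) :=
      ((continuous_qPochInf hqn).comp (continuous_const.mul continuous_id)).tendsto 0
    simp only [ne_eq, OfNat.ofNat_ne_zero, not_false_eq_true, zero_pow, sub_zero, zero_mul,
      mul_zero] at e1 e2 e3 e4
    have e5 := tendsto_phiReg hqn e2 e3
    rw [phiReg_zero_right, qPochInf_zero] at e5
    rw [qPochInf_zero] at e4
    have := (e1.mul e5).div e4 one_ne_zero
    rw [mul_one, div_one] at this
    exact this.mono_left nhdsWithin_le_nhds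
  have h := ((h1.mul h2).mul h3).mul h4
  rw [one_mul, one_mul, mul_one] at h
  refine h.congr' ?_
  filter_upwards [self_mem_nhdsWithin] with z hz
  have hz0 := ne_zero_of_mem_gapCircles hq0 hα hz
  have hP : qPochInf (z⁻¹ * (α : ℂ)⁻¹ * (q : ℂ) ^ (k + n + 1)) q ≠ 0 :=
    qPochInf_ne_zero hqn fun j => by
      have := le_norm_one_sub_inv_mul hq0 hq1 hα hz (k + n + 1 + j)
      rw [zpow_add₀ hq, zpow_natCast, ← mul_assoc] at this
      exact norm_pos_iff.mp (hδ.trans_le this)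
  rw [contourFn, jostH, solF_eq, solG, qTheta, zpow_add₀ hz0, zpow_natCast, zpow_neg]
  have hzk : z ^ k ≠ 0 := zpow_ne_zero _ hz0
  have hzn : z ^ n ≠ 0 := pow_ne_zero _ hz0
  generalize qPochInf (z⁻¹ * (α : ℂ)⁻¹ * (q : ℂ) ^ (k + n + 1)) q = P at hP ⊢
  generalize phiReg 0 (z⁻¹ * (α : ℂ)⁻¹ * (q : ℂ) ^ (k + n + 1)) q _ = F
  field_simp

theorem tendsto_gapRadius (hq0 : 0 < q) (hq1 : q < 1) (j : ℤ) :
    Tendsto (fun N : ℕ => gapRadius q α (j + N)) atTop (𝓝 0) := by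
  have : Tendsto (fun N : ℕ => |α|⁻¹ * (q ^ j * q ^ N) * √q) atTop
      (𝓝 (|α|⁻¹ * (q ^ j * 0) * √q)) :=
    (((tendsto_pow_atTop_nhds_zero_of_lt_one hq0.le hq1).const_mul _).const_mul _).mul_const _
  simp only [mul_zero, zero_mul] at this
  refine this.congr fun N => ?_
  rw [gapRadius, zpow_add₀ hq0.ne', zpow_natCast]

theorem norm_circleAverage_sub_le {f : ℂ → ℂ} {c : ℂ} {r ε : ℝ} (hr : 0 ≤ r)
    (hf : CircleIntegrable f 0 r) (h : ∀ z : ℂ, ‖z‖ = r → ‖f z - c‖ ≤ ε) :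
    ‖circleAverage f 0 r - c‖ ≤ ε := by
  have hc : circleAverage (fun _ : ℂ => c) 0 r = c := circleAverage_const c 0 r
  rw [← hc, ← circleAverage_fun_sub hf (circleIntegrable_const _ _ _), circleAverage_def,
    norm_smul, Real.norm_of_nonneg (by positivity)]
  have := intervalIntegral.norm_integral_le_of_norm_le_const (a := 0) (b := 2 * π) (C := ε)
    (f := fun θ => f (circleMap 0 r θ) - c) fun θ _ => h _ (by simp [abs_of_nonneg hr])
  rw [sub_zero, abs_of_pos two_pi_pos] at this
  rw [inv_mul_le_iff₀ two_pi_pos]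
  linarith

theorem circleIntegrable_contourFn_gapRadius (hq0 : 0 < q) (hq1 : q < 1) (hα : α ≠ 0) (l k m : ℤ) :
    CircleIntegrable (contourFn q α l k) 0 (gapRadius q α m) := by
  have hq : (q : ℂ) ≠ 0 := by exact_mod_cast hq0.ne'
  have hα' : (α : ℂ) ≠ 0 := by exact_mod_cast hα
  have hqn := norm_ofReal_lt_one hq0 hq1
  have hs2 := sqrt_lt_one' hq1
  refine circleIntegrable_of_differentiable (gapRadius_pos hq0 hα m).le fun z hz => ?_
  have hzS : z ∈ gapCircles q α := ⟨m, hz⟩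
  have hz0 := ne_zero_of_mem_gapCircles hq0 hα hzS
  have hθ : qTheta q (α * z) ≠ 0 := qTheta_ne_zero hqn hq (mul_ne_zero hα' hz0) fun j =>
    norm_pos_iff.mp (lt_of_lt_of_le (by linarith) (le_norm_one_sub_mul hq0 hq1 hα hzS j))
  have d1 := differentiableAt_solF (α := α) hq0 hq1 l hz0
  have d2 := differentiableAt_solG (α := α) hq0 hq1 k hz0
  have d3 : DifferentiableAt ℂ (fun z => qTheta q (α * z)) z :=
    (differentiableAt_qTheta hq0 hq1 (mul_ne_zero hα' hz0)).comp z (by fun_prop)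
  exact d1.mul (DifferentiableAt.div (by fun_prop) d3 hθ)

theorem tendsto_circleAverage_contourFn (hq0 : 0 < q) (hq1 : q < 1) (hα : α ≠ 0) {l k : ℤ}
    (hkl : k ≤ l) (j : ℤ) :
    Tendsto (fun N : ℕ => circleAverage (contourFn q α l k) 0 (gapRadius q α (j + N))) atTop
      (𝓝 (if k = l then 1 else 0)) := by
  rw [Metric.tendsto_atTop']
  intro ε hε
  have h := (Metric.tendsto_nhdsWithin_nhds.mp (tendsto_contourFn hq0 hq1 hα hkl)) (ε / 2)
    (half_pos hε)
  obtain ⟨δ, hδ, H⟩ := h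
  have hg := (tendsto_gapRadius (α := α) hq0 hq1 j).eventually_lt_const hδ
  obtain ⟨N₀, hN₀⟩ := eventually_atTop.mp hg
  refine ⟨N₀, fun N hN => ?_⟩
  rw [dist_eq_norm]
  refine lt_of_le_of_lt (norm_circleAverage_sub_le (gapRadius_pos hq0 hα _).le
    (circleIntegrable_contourFn_gapRadius hq0 hq1 hα l k _) fun z hz => ?_) (half_lt_self hε)
  rw [← dist_eq_norm]
  refine (H ⟨_, hz⟩ ?_).le
  rw [dist_zero_right, hz]
  exact hN₀ N hN.le

end ContourLimit

/-! ### Orthonormality of the generalized eigenfunctions -/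

section Orthogonality

open Real ComplexConjugate

variable {q α : ℝ}

theorem conj_qPoch (a q : ℂ) (n : ℕ) : conj (qPoch a q n) = qPoch (conj a) (conj q) n := by
  simp [qPoch, map_prod]

theorem conj_qPochInf {q : ℂ} (hq : ‖q‖ < 1) (a : ℂ) :
    conj (qPochInf a q) = qPochInf (conj a) (conj q) := by
  refine tendsto_nhds_unique ((Complex.continuous_conj.tendsto _).comp (tendsto_qPoch hq a)) ?_
  refine (tendsto_qPoch (q := conj q) (by simpa using hq) (conj a)).congr fun n => ?_
  simp [conj_qPoch]

theorem conj_phiReg {q : ℂ} (hq : ‖q‖ < 1) (b w : ℂ) :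
    conj (phiReg 0 b q w) = phiReg 0 (conj b) (conj q) (conj w) := by
  rw [phiReg_zero_eq, phiReg_zero_eq, Complex.conj_tsum]
  refine tsum_congr fun k => ?_
  simp [eulerCoeff, conj_qPoch, conj_qPochInf hq]

theorem conj_solF (hq0 : 0 < q) (hq1 : q < 1) (n : ℤ) (z : ℂ) :
    conj (solF q α n z) = solF q α n (conj z) := by
  rw [solF_eq, solF_eq, map_mul, conj_phiReg (norm_ofReal_lt_one hq0 hq1)]
  simp [solCoeff]

/-- On the unit circle conjugation is inversion, and `f_n` is invariant under inversion. -/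
theorem conj_solF_exp (hq0 : 0 < q) (hq1 : q < 1) (n : ℤ) (φ : ℝ) :
    conj (solF q α n (Complex.exp (Complex.I * φ))) = solF q α n (Complex.exp (Complex.I * φ)) := by
  rw [conj_solF hq0 hq1, ← Complex.exp_conj, map_mul, Complex.conj_I, Complex.conj_ofReal, neg_mul,
    Complex.exp_neg, solF_inv hq0 hq1]

theorem conj_solF_pole (hq0 : 0 < q) (hq1 : q < 1) (n m : ℤ) :
    conj (solF q α n ((α : ℂ)⁻¹ * (q : ℂ) ^ m)) = solF q α n ((α : ℂ)⁻¹ * (q : ℂ) ^ m) := by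
  rw [conj_solF hq0 hq1]
  simp

/-- A zero means `z α q^j = 1` for some `j`. As `α q^j` is real, `|z| = 1` forces `z = ±1`. -/
theorem qTheta_ne_zero_of_norm_eq_one (hq0 : 0 < q) (hq1 : q < 1) (hα : α ≠ 0) {z : ℂ}
    (hz : ‖z‖ = 1) (hz2 : z ^ 2 ≠ 1) : qTheta q (α * z) ≠ 0 := by
  have hq : (q : ℂ) ≠ 0 := by exact_mod_cast hq0.ne'
  have hα' : (α : ℂ) ≠ 0 := by exact_mod_cast hα
  have hz0 : z ≠ 0 := norm_pos_iff.mp (by rw [hz]; exact one_pos)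
  refine qTheta_ne_zero (norm_ofReal_lt_one hq0 hq1) hq (mul_ne_zero hα' hz0) fun j h => ?_
  have h1 : z * ((α * q ^ j : ℝ) : ℂ) = 1 := by
    push_cast
    linear_combination -h
  have h2 : (α * q ^ j) ^ 2 = 1 := by
    have := congrArg norm h1
    rw [norm_mul, hz, one_mul, norm_one, Complex.norm_real, Real.norm_eq_abs] at this
    rw [← sq_abs, this, one_pow]
  apply hz2
  have h3 : ((α * q ^ j : ℝ) : ℂ) ^ 2 = 1 := by exact_mod_cast h2
  calc z ^ 2 = z ^ 2 * ((α * q ^ j : ℝ) : ℂ) ^ 2 := by rw [h3, mul_one]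
    _ = (z * ((α * q ^ j : ℝ) : ℂ)) ^ 2 := by ring
    _ = 1 := by rw [h1, one_pow]

/-- On the unit circle the weighted solution splits into the two Jost solutions. -/
theorem acIntegrand_eq (hq0 : 0 < q) (hq1 : q < 1) (hα : α ≠ 0) (k l : ℤ) {φ : ℝ}
    (hφ : Complex.exp (Complex.I * φ) ^ 2 ≠ 1) :
    acIntegrand q α k l φ = contourFn q α l k (Complex.exp (Complex.I * φ)) +
      contourFn q α l k (Complex.exp (Complex.I * φ))⁻¹ := by
  have hqn := norm_ofReal_lt_one hq0 hq1
  have e1 : Complex.exp (2 * Complex.I * φ) = Complex.exp (Complex.I * φ) ^ 2 := by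
    rw [← Complex.exp_nat_mul]; push_cast; ring_nf
  have e2 : Complex.exp (-(Complex.I * φ)) = (Complex.exp (Complex.I * φ))⁻¹ := Complex.exp_neg _
  have hconj : conj (Complex.exp (Complex.I * φ)) = (Complex.exp (Complex.I * φ))⁻¹ := by
    rw [← Complex.exp_conj, map_mul, Complex.conj_I, Complex.conj_ofReal, neg_mul, Complex.exp_neg]
  have hn : ‖Complex.exp (Complex.I * φ)‖ = 1 := by
    rw [mul_comm]; exact Complex.norm_exp_ofReal_mul_I φ
  rw [acIntegrand, acWeight, e1, e2]
  set z := Complex.exp (Complex.I * φ) with hz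
  have hz0 : z ≠ 0 := Complex.exp_ne_zero _
  have hθ1 := qTheta_ne_zero_of_norm_eq_one hq0 hq1 hα hn hφ
  have hθ2 : qTheta q (α * z⁻¹) ≠ 0 := by
    refine qTheta_ne_zero_of_norm_eq_one hq0 hq1 hα (by rw [norm_inv, hn, inv_one]) fun h => hφ ?_
    rwa [inv_pow, inv_eq_one] at h
  have hden : qPochInf (α * z) q * qPochInf (q * (α : ℂ)⁻¹ * z⁻¹) q = qTheta q (α * z) := by
    rw [qTheta, mul_inv, mul_assoc (q : ℂ)]
  have hcθ : conj (qTheta q (α * z)) = qTheta q (α * z⁻¹) := by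
    rw [qTheta, qTheta, map_mul, conj_qPochInf hqn, conj_qPochInf hqn]
    simp [hconj]
  -- Conjugation inverts `z`, so the squared modulus is the product of the values at `z` and `z⁻¹`.
  have hw : ((‖qPochInf (z ^ 2) q / (qPochInf (α * z) q * qPochInf (q * (α : ℂ)⁻¹ * z⁻¹) q)‖ ^ 2
      : ℝ) : ℂ) = (1 - z ^ 2) * (1 - z⁻¹ ^ 2) *
        (qPochInf (z ^ 2 * q) q * qPochInf (z⁻¹ ^ 2 * q) q) /
        (qTheta q (α * z) * qTheta q (α * z⁻¹)) := by
    rw [hden]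
    push_cast
    rw [← Complex.mul_conj', map_div₀, hcθ, conj_qPochInf hqn, map_pow, hconj, Complex.conj_ofReal,
      qPochInf_eq_mul hqn (z ^ 2), qPochInf_eq_mul hqn (z⁻¹ ^ 2)]
    field_simp
  rw [hw, contourFn, contourFn, jostH, jostH, solF_inv hq0 hq1]
  have hc := solF_connection hq0 hq1 hα hz0 hθ1 hθ2 k
  -- The connection formula multiplied by `-(z - z⁻¹)`, using `(1 - z²)(1 - z⁻²) = -(z - z⁻¹)²`.
  have key : solF q α k z * ((1 - z ^ 2) * (1 - z⁻¹ ^ 2) *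
        (qPochInf (z ^ 2 * q) q * qPochInf (z⁻¹ ^ 2 * q) q)) =
      (1 - z ^ 2) * solG q α k z * qTheta q (α * z⁻¹) +
      (1 - z⁻¹ ^ 2) * solG q α k z⁻¹ * qTheta q (α * z) := by
    have hzz : z * z⁻¹ = 1 := mul_inv_cancel₀ hz0
    generalize z⁻¹ = y at *
    linear_combination (-(z - y)) * hc + (solF q α k z *
      (qPochInf (z ^ 2 * q) q * qPochInf (y ^ 2 * q) q) * (z * y - 1)
      + (solG q α k z * qTheta q (α * y)) + (qTheta q (α * z) * solG q α k y)) * hzz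
  rw [mul_assoc, ← mul_div_assoc, key]
  generalize qTheta q (α * z⁻¹) = T at hθ2 ⊢
  generalize qTheta q (α * z) = S at hθ1 ⊢
  field_simp

theorem exp_sq_ne_one {φ : ℝ} (h : φ ∈ Set.Ioo 0 π) : Complex.exp (Complex.I * φ) ^ 2 ≠ 1 := by
  intro h1
  rw [← Complex.exp_nat_mul] at h1
  have h2 := congrArg Complex.re h1
  have e : ((2 : ℕ) : ℂ) * (Complex.I * φ) = ((2 * φ : ℝ) : ℂ) * Complex.I := by push_cast; ring
  rw [e, Complex.exp_ofReal_mul_I_re, Complex.one_re, Real.cos_two_mul] at h2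
  have h3 := Real.sin_pos_of_pos_of_lt_pi h.1 h.2
  nlinarith [Real.sin_sq_add_cos_sq φ]

/-- The integrand is `C(φ) + C(-φ)`, so the integral over `[0, π]` unfolds to one over the whole
circle. -/
theorem acIntegrand_integrableOn_and_integral (hq0 : 0 < q) (hq1 : q < 1) (hα : α ≠ 0) (k l : ℤ) :
    IntegrableOn (acIntegrand q α k l) (Set.Icc 0 π) ∧
      1 / (2 * (π : ℂ)) * ∫ φ in Set.Icc 0 π, acIntegrand q α k l φ =
        circleAverage (contourFn q α l k) 0 1 := by
  have hint := (circleAverage_contourFn_one hq0 hq1 hα l k).1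
  set C : ℝ → ℂ := fun θ => contourFn q α l k (circleMap 0 1 θ) with hC
  have hper : Function.Periodic C (2 * π) := fun x => by simp [hC, periodic_circleMap 0 1 x]
  have hC0 : IntervalIntegrable C volume 0 (0 + 2 * π) := by rw [zero_add]; exact hint
  have hCall := fun a b => hper.intervalIntegrable two_pi_pos.ne' hC0 a b
  have hneg : IntervalIntegrable (fun x => C (-x)) volume 0 π := by
    have h := (IntervalIntegrable.iff_comp_neg (by simp)).mp (hCall 0 (-π))
    rwa [neg_zero, neg_neg] at h
  -- The endpoints, where `z² = 1` and the connection formula degenerates, are a null set.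
  have heq : ∀ φ ∈ Set.Ioo 0 π, acIntegrand q α k l φ = C φ + C (-φ) := by
    intro φ hφ
    rw [acIntegrand_eq hq0 hq1 hα k l (exp_sq_ne_one hφ)]
    simp only [hC, circleMap, zero_add, Complex.ofReal_one, one_mul, Complex.ofReal_neg, neg_mul,
      Complex.exp_neg, mul_comm Complex.I]
  have hsum : IntervalIntegrable (fun φ => C φ + C (-φ)) volume 0 π := (hCall 0 π).add hneg
  have hioo : IntegrableOn (fun φ => C φ + C (-φ)) (Set.Ioo 0 π) :=
    (((intervalIntegrable_iff_integrableOn_Ioc_of_le pi_pos.le).mp hsum)).mono_set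
      Set.Ioo_subset_Ioc_self
  constructor
  · rw [integrableOn_Icc_iff_integrableOn_Ioo]
    exact hioo.congr_fun (fun φ hφ => (heq φ hφ).symm) measurableSet_Ioo
  · rw [integral_Icc_eq_integral_Ioo, setIntegral_congr_fun measurableSet_Ioo heq,
      ← integral_Ioc_eq_integral_Ioo, ← intervalIntegral.integral_of_le pi_pos.le,
      intervalIntegral.integral_add (hCall 0 π) hneg, intervalIntegral.integral_comp_neg, neg_zero,
      add_comm, intervalIntegral.integral_add_adjacent_intervals (hCall _ _) (hCall _ _),
      circleAverage_def]
    have := hper.intervalIntegral_add_eq (-π) 0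
    rw [show -π + 2 * π = π by ring, zero_add] at this
    rw [this, Complex.real_smul]
    push_cast
    rw [one_div]

/-- The weight of the eigenvalue `α⁻¹ q^m + α q^{-m}`, up to the factor `(q; q)_∞⁻²`. -/
noncomputable def discreteWeight (q α : ℝ) (m : ℤ) : ℝ :=
  (1 - α ^ (-2 : ℤ) * q ^ (2 * m)) * α ^ (2 * m) * q ^ (-(m * (m + 1)))

theorem discreteTerm_eq (q α : ℝ) (k l m : ℤ) : discreteTerm q α k l m =
    discreteWeight q α m * (solF q α l ((α : ℂ)⁻¹ * (q : ℂ) ^ m) *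
      solF q α k ((α : ℂ)⁻¹ * (q : ℂ) ^ m)) := by
  rw [discreteTerm, discreteWeight]
  push_cast
  ring

theorem zpow_lt_abs_of_floor_lt (hq0 : 0 < q) (hq1 : q < 1) (hα : α ≠ 0) {m : ℤ}
    (hm : ⌊logb q |α|⌋ < m) : q ^ m < |α| := by
  have : logb q |α| < (m : ℝ) := Int.floor_lt.mp hm
  have h2 := Real.rpow_lt_rpow_of_exponent_gt hq0 hq1 this
  rwa [Real.rpow_logb hq0 hq1.ne (abs_pos.mpr hα), Real.rpow_intCast] at h2

/-- Admissible indices are those with `|α⁻¹ q^m| < 1`, and `α` enters only through even powers. -/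
theorem discreteWeight_nonneg (hq0 : 0 < q) (hq1 : q < 1) (hα : α ≠ 0) {m : ℤ}
    (hm : ⌊logb q |α|⌋ < m) : 0 ≤ discreteWeight q α m := by
  have h := zpow_lt_abs_of_floor_lt hq0 hq1 hα hm
  have hα0 := abs_pos.mpr hα
  have h1 : α ^ (-2 : ℤ) * q ^ (2 * m) ≤ 1 := by
    rw [zpow_neg, inv_mul_eq_div, div_le_one (by positivity), mul_comm, zpow_mul]
    norm_cast
    rw [← sq_abs α]
    gcongr
  have h2 : 0 ≤ α ^ (2 * m) := by
    rw [zpow_mul]; positivity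
  have h3 : 0 < q ^ (-(m * (m + 1))) := zpow_pos hq0 _
  have h4 := sub_nonneg.mpr h1
  unfold discreteWeight
  positivity

theorem discreteTerm_symm (q α : ℝ) (k l m : ℤ) :
    discreteTerm q α k l m = discreteTerm q α l k m := by
  rw [discreteTerm_eq, discreteTerm_eq]
  ring

theorem acIntegrand_symm (q α : ℝ) (k l : ℤ) : acIntegrand q α k l = acIntegrand q α l k := by
  funext φ
  simp only [acIntegrand]
  ring

theorem qPochInf_self_ne_zero (hq0 : 0 < q) (hq1 : q < 1) : qPochInf (q : ℂ) q ≠ 0 :=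
  qPochInf_ne_zero (norm_ofReal_lt_one hq0 hq1) fun j => by
    simpa [pow_succ'] using one_sub_pow_ne_zero (norm_ofReal_lt_one hq0 hq1) j

theorem tendsto_sum_discreteTerm (hq0 : 0 < q) (hq1 : q < 1) (hα : α ≠ 0) {k l : ℤ}
    (hkl : k ≤ l) :
    Tendsto (fun N => ∑ i ∈ Finset.range N, discreteTerm q α k l (⌊logb q |α|⌋ + 1 + i)) atTop
      (𝓝 (qPochInf q q ^ 2 * ((if k = l then 1 else 0) -
        1 / (2 * (π : ℂ)) * ∫ φ in Set.Icc 0 π, acIntegrand q α k l φ))) := by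
  have hP := qPochInf_self_ne_zero hq0 hq1
  have h := tendsto_circleAverage_contourFn hq0 hq1 hα hkl ⌊logb q |α|⌋
  simp only [← circleAverage_contourFn_add_sum hq0 hq1 hα] at h
  rw [(acIntegrand_integrableOn_and_integral hq0 hq1 hα k l).2]
  refine ((h.sub_const (circleAverage (contourFn q α l k) 0 1)).const_mul
    (qPochInf (q : ℂ) q ^ 2)).congr fun N => ?_
  field_simp
  ring

theorem discreteTerm_self (hq0 : 0 < q) (hq1 : q < 1) (k m : ℤ) :
    discreteTerm q α k k m =
      ((discreteWeight q α m * ‖solF q α k ((α : ℂ)⁻¹ * (q : ℂ) ^ m)‖ ^ 2 : ℝ) : ℂ) := by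
  rw [discreteTerm_eq]
  push_cast
  rw [← Complex.conj_mul', conj_solF_pole hq0 hq1]

/-- The contour argument only shows that the partial sums converge. On the diagonal the terms are
nonnegative, so this is summability, and the diagonal terms dominate the others. -/
theorem summable_discreteTerm_self (hq0 : 0 < q) (hq1 : q < 1) (hα : α ≠ 0) (k : ℤ) :
    Summable fun i : ℕ => discreteWeight q α (⌊logb q |α|⌋ + 1 + i) *
      ‖solF q α k ((α : ℂ)⁻¹ * (q : ℂ) ^ (⌊logb q |α|⌋ + 1 + i))‖ ^ 2 := by
  have h := (Complex.continuous_re.tendsto _).comp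
    (tendsto_sum_discreteTerm hq0 hq1 hα (le_refl k))
  obtain ⟨c, hc⟩ : ∃ c, Tendsto (fun N => ∑ i ∈ Finset.range N,
      discreteWeight q α (⌊logb q |α|⌋ + 1 + i) *
      ‖solF q α k ((α : ℂ)⁻¹ * (q : ℂ) ^ (⌊logb q |α|⌋ + 1 + i))‖ ^ 2) atTop (𝓝 c) := by
    refine ⟨_, h.congr fun N => ?_⟩
    simp only [Function.comp, discreteTerm_self hq0 hq1, ← Complex.ofReal_sum, Complex.ofReal_re]
  have hnn : ∀ i : ℕ, 0 ≤ discreteWeight q α (⌊logb q |α|⌋ + 1 + i) *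
      ‖solF q α k ((α : ℂ)⁻¹ * (q : ℂ) ^ (⌊logb q |α|⌋ + 1 + i))‖ ^ 2 := fun i =>
    mul_nonneg (discreteWeight_nonneg hq0 hq1 hα (by omega)) (by positivity)
  exact ((hasSum_iff_tendsto_nat_of_nonneg hnn c).mpr hc).summable

theorem summable_discreteTerm (hq0 : 0 < q) (hq1 : q < 1) (hα : α ≠ 0) (k l : ℤ) :
    Summable fun i : ℕ => discreteTerm q α k l (⌊logb q |α|⌋ + 1 + i) := by
  refine Summable.of_norm_bounded ((summable_discreteTerm_self hq0 hq1 hα k).add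
    (summable_discreteTerm_self hq0 hq1 hα l)) fun i => ?_
  have hw := discreteWeight_nonneg hq0 hq1 hα (m := ⌊logb q |α|⌋ + 1 + i) (by omega)
  rw [discreteTerm_eq, norm_mul, norm_mul, Complex.norm_real, Real.norm_of_nonneg hw, ← mul_add]
  refine mul_le_mul_of_nonneg_left ?_ hw
  nlinarith [sq_nonneg (‖solF q α l ((α : ℂ)⁻¹ * (q : ℂ) ^ (⌊logb q |α|⌋ + 1 + (i : ℤ)))‖ -
    ‖solF q α k ((α : ℂ)⁻¹ * (q : ℂ) ^ (⌊logb q |α|⌋ + 1 + (i : ℤ)))‖),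
    sq_nonneg (‖solF q α l ((α : ℂ)⁻¹ * (q : ℂ) ^ (⌊logb q |α|⌋ + 1 + (i : ℤ)))‖ +
    ‖solF q α k ((α : ℂ)⁻¹ * (q : ℂ) ^ (⌊logb q |α|⌋ + 1 + (i : ℤ)))‖)]

/-- Orthonormality of the generalized eigenfunctions with respect to the spectral weight. -/
theorem spectral_orthonormality (hq0 : 0 < q) (hq1 : q < 1) (hα : α ≠ 0) (k l : ℤ) :
    1 / (2 * (π : ℂ)) * (∫ φ in Set.Icc 0 π, acIntegrand q α k l φ) +
      1 / qPochInf q q ^ 2 * ∑' i : ℕ, discreteTerm q α k l (⌊logb q |α|⌋ + 1 + i) =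
      if k = l then 1 else 0 := by
  wlog hkl : k ≤ l generalizing k l
  · have := this l k (by omega)
    simpa only [acIntegrand_symm q α l k, discreteTerm_symm q α l k, eq_comm (a := l)] using this
  have h1 := (summable_discreteTerm hq0 hq1 hα k l).hasSum.tendsto_sum_nat
  rw [tendsto_nhds_unique h1 (tendsto_sum_discreteTerm hq0 hq1 hα hkl)]
  have hP := qPochInf_self_ne_zero hq0 hq1
  field_simp
  ring

end Orthogonality

/-! ### Stieltjes inversion through the Poisson kernel -/

section Poisson

open scoped ContDiff

theorem ofReal_sub_ne_zero {z : ℂ} (hz : z.im ≠ 0) (x : ℝ) : (x : ℂ) - z ≠ 0 := by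
  intro h
  apply hz
  have := congrArg Complex.im h
  simpa using this

theorem abs_im_le_norm_ofReal_sub (z : ℂ) (x : ℝ) : |z.im| ≤ ‖(x : ℂ) - z‖ := by
  simpa using Complex.abs_im_le_norm ((x : ℂ) - z)

theorem norm_inv_ofReal_sub_le {z : ℂ} (hz : z.im ≠ 0) (x : ℝ) :
    ‖((x : ℂ) - z)⁻¹‖ ≤ |z.im|⁻¹ := by
  rw [norm_inv]
  exact inv_anti₀ (abs_pos.mpr hz) (abs_im_le_norm_ofReal_sub z x)

theorem measurable_inv_ofReal_sub (z : ℂ) : Measurable fun x : ℝ => ((x : ℂ) - z)⁻¹ := by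
  fun_prop

theorem integral_poisson (g : ℝ → ℝ) {ε : ℝ} (hε : 0 < ε) (x : ℝ) :
    ∫ t, g t * (ε / ((x - t) ^ 2 + ε ^ 2)) = ∫ s, g (x + ε * s) * (1 + s ^ 2)⁻¹ := by
  have h1 := Measure.integral_comp_mul_left (fun u => g (x + u) * (ε / (u ^ 2 + ε ^ 2))) ε
  have h2 := integral_add_left_eq_self (μ := volume)
    (fun t => g t * (ε / ((x - t) ^ 2 + ε ^ 2))) x
  rw [← h2]
  simp only [sub_add_cancel_left, neg_sq]
  have h3 : ∫ u, g (x + u) * (ε / (u ^ 2 + ε ^ 2)) =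
      ε • ∫ s, g (x + ε * s) * (ε / ((ε * s) ^ 2 + ε ^ 2)) := by
    rw [h1, abs_of_pos (inv_pos.mpr hε), smul_smul, mul_inv_cancel₀ hε.ne', one_smul]
  rw [h3, ← integral_smul]
  refine integral_congr_ae (Eventually.of_forall fun s => ?_)
  have : 1 + s ^ 2 ≠ 0 := by positivity
  simp only [smul_eq_mul]
  field_simp
  ring

/-- A function is determined almost everywhere by its Stieltjes transform. -/
theorem ae_eq_zero_of_stieltjes {μ : Measure ℝ} [SFinite μ] {w : ℝ → ℂ} (hw : Integrable w μ)
    (h : ∀ z : ℂ, z.im ≠ 0 → ∫ x, ((x : ℂ) - z)⁻¹ * w x ∂μ = 0) : ∀ᵐ x ∂μ, w x = 0 := by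
  refine ae_eq_zero_of_integral_contDiff_smul_eq_zero hw.locallyIntegrable fun g hg hgc => ?_
  have hgcont : Continuous g := hg.continuous
  have hgi : Integrable g := hgcont.integrable_of_hasCompactSupport hgc
  obtain ⟨C, hC⟩ := hgcont.bounded_above_of_compact_support hgc
  have hC0 : 0 ≤ C := (norm_nonneg _).trans (hC 0)
  have hres : ∀ z : ℂ, z.im ≠ 0 → Integrable (fun x : ℝ => ((x : ℂ) - z)⁻¹ * w x) μ := fun z hz =>
    hw.bdd_mul (c := |z.im|⁻¹) (measurable_inv_ofReal_sub z).aestronglyMeasurable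
      (Eventually.of_forall (norm_inv_ofReal_sub_le hz))
  -- The Poisson kernel is the difference of the kernels `(x - z)⁻¹` at `z = t ± iε`, divided by
  -- `2i`.
  have hK : ∀ ε : ℝ, 0 < ε → ∀ t : ℝ,
      ∫ x, ((ε / ((x - t) ^ 2 + ε ^ 2) : ℝ) : ℂ) * w x ∂μ = 0 := by
    intro ε hε t
    have hz1 : ((t : ℂ) + ε * Complex.I).im ≠ 0 := by simpa using hε.ne'
    have hz2 : ((t : ℂ) - ε * Complex.I).im ≠ 0 := by simpa using hε.ne'
    have h1 := h _ hz1
    have h2 := h _ hz2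
    have h3 : ∀ x : ℝ, ((ε / ((x - t) ^ 2 + ε ^ 2) : ℝ) : ℂ) * w x =
        (2 * Complex.I)⁻¹ * (((x : ℂ) - ((t : ℂ) + ε * Complex.I))⁻¹ * w x -
          ((x : ℂ) - ((t : ℂ) - ε * Complex.I))⁻¹ * w x) := by
      intro x
      have n1 := ofReal_sub_ne_zero hz1 x
      have n2 := ofReal_sub_ne_zero hz2 x
      have n3 : ((x : ℂ) - t) ^ 2 + (ε : ℂ) ^ 2 ≠ 0 := by
        have : 0 < (x - t) ^ 2 + ε ^ 2 := by positivity
        exact_mod_cast this.ne'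
      have e : ((x : ℂ) - t) ^ 2 + (ε : ℂ) ^ 2 =
          ((x : ℂ) - ((t : ℂ) + ε * Complex.I)) * ((x : ℂ) - ((t : ℂ) - ε * Complex.I)) := by
        linear_combination ((ε : ℂ) ^ 2) * Complex.I_sq
      push_cast
      rw [e]
      have hI := Complex.I_ne_zero
      field_simp
      ring
    simp only [h3]
    rw [integral_const_mul, integral_sub (hres _ hz1) (hres _ hz2), h1, h2, sub_zero, mul_zero]
  -- By Fubini, `w` annihilates the Poisson smoothing of the test function `g`. The substitution `t
  -- = x + εs` makes the kernel independent of `ε`.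
  have hzero : ∀ ε : ℝ, 0 < ε →
      ∫ x, ((∫ s, g (x + ε * s) * (1 + s ^ 2)⁻¹ : ℝ) : ℂ) * w x ∂μ = 0 := by
    intro ε hε
    have hprod : Integrable (fun p : ℝ × ℝ => (ε / ((p.2 - p.1) ^ 2 + ε ^ 2) : ℂ) *
        ((g p.1 : ℂ) * w p.2)) (volume.prod μ) := by
      refine (hgi.ofReal.mul_prod hw).bdd_mul (c := ε⁻¹) ?_ (Eventually.of_forall fun p => ?_)
      · refine Continuous.aestronglyMeasurable (Continuous.div continuous_const (by fun_prop) ?_)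
        intro p
        have : 0 < (p.2 - p.1) ^ 2 + ε ^ 2 := by positivity
        exact_mod_cast this.ne'
      · have e : (ε / ((p.2 - p.1) ^ 2 + ε ^ 2) : ℂ) = ((ε / ((p.2 - p.1) ^ 2 + ε ^ 2) : ℝ) : ℂ) := by
          push_cast; rfl
        rw [e, Complex.norm_real, Real.norm_of_nonneg (by positivity), ← one_div,
          div_le_div_iff₀ (by positivity) hε]
        nlinarith [sq_nonneg (p.2 - p.1)]
    have hswap := integral_integral_swap (f := fun t x => (ε / (((x : ℝ) - (t : ℝ)) ^ 2 + ε ^ 2) : ℂ) *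
        ((g t : ℂ) * w x)) (μ := volume) (ν := μ) hprod
    have hl : ∀ t : ℝ, ∫ x, (ε / (((x : ℝ) - (t : ℝ)) ^ 2 + ε ^ 2) : ℂ) * ((g t : ℂ) * w x) ∂μ = 0 := by
      intro t
      have := congrArg (fun c => (g t : ℂ) * c) (hK ε hε t)
      simp only [mul_zero] at this
      rw [← integral_const_mul] at this
      rw [← this]
      refine integral_congr_ae (Eventually.of_forall fun x => ?_)
      simp only
      push_cast
      ring
    simp only [hl, integral_zero] at hswap
    rw [hswap]
    refine integral_congr_ae (Eventually.of_forall fun x => ?_)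
    simp only
    rw [← integral_poisson g hε x, ← integral_complex_ofReal, ← integral_mul_const]
    refine integral_congr_ae (Eventually.of_forall fun t => ?_)
    simp only
    push_cast
    ring
  have hinv : Integrable fun s : ℝ => (1 + s ^ 2)⁻¹ := integrable_inv_one_add_sq
  have hinner : ∀ x, Tendsto (fun n : ℕ => ∫ s, g (x + (1 / ((n : ℝ) + 1)) * s) * (1 + s ^ 2)⁻¹)
      atTop (𝓝 (∫ s, g x * (1 + s ^ 2)⁻¹)) := by
    intro x
    refine tendsto_integral_of_dominated_convergence (fun s => C * (1 + s ^ 2)⁻¹) (fun n => ?_)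
      (hinv.const_mul C) (fun n => Eventually.of_forall fun s => ?_)
      (Eventually.of_forall fun s => ?_)
    · exact ((hgcont.comp (by fun_prop)).aestronglyMeasurable).mul hinv.aestronglyMeasurable
    · rw [norm_mul, Real.norm_of_nonneg (show 0 ≤ (1 + s ^ 2)⁻¹ by positivity)]
      have := hC (x + (1 / ((n : ℝ) + 1)) * s)
      gcongr
    · refine Tendsto.mul_const _ ?_
      have h1 := (tendsto_one_div_add_atTop_nhds_zero_nat (𝕜 := ℝ)).mul_const s
      have h2 := h1.const_add x
      rw [zero_mul, add_zero] at h2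
      exact (hgcont.tendsto x).comp h2
  have hbound : ∀ (n : ℕ) (x : ℝ),
      ‖∫ s, g (x + (1 / ((n : ℝ) + 1)) * s) * (1 + s ^ 2)⁻¹‖ ≤ C * Real.pi := by
    intro n x
    rw [← integral_univ_inv_one_add_sq, ← integral_const_mul]
    refine norm_integral_le_of_norm_le (hinv.const_mul C) (Eventually.of_forall fun s => ?_)
    rw [norm_mul, Real.norm_of_nonneg (show 0 ≤ (1 + s ^ 2)⁻¹ by positivity)]
    have := hC (x + (1 / ((n : ℝ) + 1)) * s)
    gcongr
  -- Letting `ε = 1/(n+1)` tend to `0`, the smoothings converge boundedly to `π g`.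
  have hlim : Tendsto (fun n : ℕ =>
      ∫ x, ((∫ s, g (x + (1 / ((n : ℝ) + 1)) * s) * (1 + s ^ 2)⁻¹ : ℝ) : ℂ) * w x ∂μ) atTop
      (𝓝 (∫ x, ((∫ s, g x * (1 + s ^ 2)⁻¹ : ℝ) : ℂ) * w x ∂μ)) := by
    refine tendsto_integral_of_dominated_convergence (fun x => C * Real.pi * ‖w x‖) (fun n => ?_)
      (hw.norm.const_mul _) (fun n => Eventually.of_forall fun x => ?_)
      (Eventually.of_forall fun x => ?_)
    · refine AEStronglyMeasurable.mul ?_ hw.aestronglyMeasurable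
      refine Continuous.aestronglyMeasurable (Complex.continuous_ofReal.comp ?_)
      refine continuous_of_dominated (bound := fun s => C * (1 + s ^ 2)⁻¹) (fun x => ?_)
        (fun x => Eventually.of_forall fun s => ?_) (hinv.const_mul C)
        (Eventually.of_forall fun s => ?_)
      · exact ((hgcont.comp (by fun_prop)).aestronglyMeasurable).mul hinv.aestronglyMeasurable
      · rw [norm_mul, Real.norm_of_nonneg (show 0 ≤ (1 + s ^ 2)⁻¹ by positivity)]
        have := hC (x + (1 / ((n : ℝ) + 1)) * s)
        gcongr
      · exact (hgcont.comp (by fun_prop)).mul continuous_const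
    · rw [norm_mul, Complex.norm_real]
      exact mul_le_mul_of_nonneg_right (hbound n x) (norm_nonneg _)
    · exact ((Complex.continuous_ofReal.tendsto _).comp (hinner x)).mul_const _
  have hz : ∀ n : ℕ, ∫ x, ((∫ s, g (x + (1 / ((n : ℝ) + 1)) * s) * (1 + s ^ 2)⁻¹ : ℝ) : ℂ) * w x ∂μ
      = 0 := fun n => hzero _ (by positivity)
  simp only [hz] at hlim
  have h0 := tendsto_nhds_unique tendsto_const_nhds hlim
  have hfin : ∀ x, ((∫ s, g x * (1 + s ^ 2)⁻¹ : ℝ) : ℂ) * w x = (Real.pi : ℂ) * (g x • w x) := by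
    intro x
    rw [integral_const_mul, integral_univ_inv_one_add_sq, Complex.real_smul]
    push_cast
    ring
  simp only [hfin] at h0
  rw [integral_const_mul, eq_comm, mul_eq_zero] at h0
  exact h0.resolve_left (by exact_mod_cast Real.pi_ne_zero)

end Poisson

/-! ### Norm estimates and shifts in the sequence space -/

section EllTwoLemmas

/-- The shift `ψ ↦ (ψ (n + c))_n`. -/
def shiftSeq (c : ℤ) (ψ : EllTwo) : EllTwo := ⟨fun n => ψ (n + c), memlp_shift ψ c⟩

theorem shiftSeq_apply (c : ℤ) (ψ : EllTwo) (n : ℤ) : shiftSeq c ψ n = ψ (n + c) := rfl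

theorem ellTwo_norm_sq (ψ : EllTwo) : ‖ψ‖ ^ 2 = ∑' n, ‖ψ n‖ ^ 2 := by
  have := lp.norm_rpow_eq_tsum (p := 2) (by norm_num) ψ
  simpa using this

theorem ellTwo_summable_sq (ψ : EllTwo) : Summable fun n => ‖ψ n‖ ^ 2 := by
  have := (lp.memℓp ψ).summable (by norm_num)
  simpa using this

theorem ellTwo_mem_of_le {f : ℤ → ℂ} (ψ : EllTwo) {C : ℝ} (h : ∀ n, ‖f n‖ ≤ C * ‖ψ n‖) :
    Memℓp f 2 := by
  rw [memℓp_gen_iff (by norm_num)]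
  have h1 := (ellTwo_summable_sq ψ).mul_left (C ^ 2)
  refine Summable.of_nonneg_of_le (fun n => by positivity) (fun n => ?_) h1
  have : ‖f n‖ ^ 2 ≤ (C * ‖ψ n‖) ^ 2 := by gcongr; exact h n
  simpa [mul_pow] using this

theorem ellTwo_norm_le {φ ψ : EllTwo} {C : ℝ} (hC : 0 ≤ C) (h : ∀ n, ‖φ n‖ ≤ C * ‖ψ n‖) :
    ‖φ‖ ≤ C * ‖ψ‖ := by
  refine abs_le_of_sq_le_sq' ?_ (by positivity) |>.2
  rw [mul_pow, ellTwo_norm_sq, ellTwo_norm_sq, ← tsum_mul_left]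
  refine (ellTwo_summable_sq φ).tsum_le_tsum (fun n => ?_) ((ellTwo_summable_sq ψ).mul_left _)
  rw [← mul_pow]
  gcongr
  exact h n

theorem norm_shiftSeq (c : ℤ) (ψ : EllTwo) : ‖shiftSeq c ψ‖ = ‖ψ‖ := by
  rw [← sq_eq_sq₀ (norm_nonneg _) (norm_nonneg _), ellTwo_norm_sq, ellTwo_norm_sq]
  exact (Equiv.addRight c).tsum_eq fun n => ‖ψ n‖ ^ 2

theorem shiftSeq_sub (c : ℤ) (φ ψ : EllTwo) :
    shiftSeq c (φ - ψ) = shiftSeq c φ - shiftSeq c ψ := rfl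

theorem stdBasis_apply (n m : ℤ) : stdBasis n m = if m = n then 1 else 0 := by
  rw [stdBasis, lp.single_apply, Pi.single_apply]

end EllTwoLemmas

/-! ### Surjectivity of `B - z` for nonreal `z` -/

section SchrodingerB

variable {q α : ℝ}

theorem schrodingerB_apply (ψ : (schrodingerB q α).domain) (n : ℤ) :
    (schrodingerB q α ψ : EllTwo) n = (ψ : EllTwo) (n + -1) +
      (α : ℂ) * ((q : ℂ) ^ (-n) * (ψ : EllTwo) n) + (ψ : EllTwo) (n + 1) := rfl

theorem mem_schrodingerB_domain {ψ : EllTwo} :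
    ψ ∈ (schrodingerB q α).domain ↔ Memℓp (fun n : ℤ => (q : ℂ) ^ (-n) * ψ n) 2 := Iff.rfl

theorem stdBasis_mem_domain (n : ℤ) : stdBasis n ∈ (schrodingerB q α).domain := by
  rw [mem_schrodingerB_domain]
  refine (congrArg (fun g : ℤ → ℂ => Memℓp g 2) ?_).mp (lp.memℓp ((q : ℂ) ^ (-n) • stdBasis n))
  funext m
  rw [lp.coeFn_smul, Pi.smul_apply, smul_eq_mul, stdBasis_apply]
  split_ifs with h <;> simp [h]

/-- `B - z` is onto when `z` is far from the real axis. -/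
theorem schrodingerB_sub_surjective_of_large {q α : ℝ} (hα : α ≠ 0) {T : ℝ} (hT : 2 < |T|)
    (η : EllTwo) : ∃ ψ : (schrodingerB q α).domain,
      schrodingerB q α ψ - (T * Complex.I) • (ψ : EllTwo) = η := by
  have hα' : (α : ℂ) ≠ 0 := by exact_mod_cast hα
  have hTI : ((T : ℂ) * Complex.I).im ≠ 0 := by
    simpa using abs_pos.mp (by linarith : 0 < |T|)
  have hT0 : 0 < |T| := by linarith
  have him : ((T : ℂ) * Complex.I).im = T := by simp
  -- `d` is the diagonal part of `B - iT`, and `‖d n‖ ≥ |T|` because the potential is real.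
  set d : ℤ → ℂ := fun n => ((α * q ^ (-n) : ℝ) : ℂ) - T * Complex.I with hd
  have hd0 : ∀ n, d n ≠ 0 := fun n => ofReal_sub_ne_zero hTI _
  have hdn : ∀ n, ‖(d n)⁻¹‖ ≤ |T|⁻¹ := fun n => by
    have := norm_inv_ofReal_sub_le hTI (α * q ^ (-n))
    rwa [him] at this
  have hmem : ∀ ξ : EllTwo, Memℓp (fun n => (d n)⁻¹ * ξ n) 2 := fun ξ =>
    ellTwo_mem_of_le ξ (C := |T|⁻¹) fun n => by rw [norm_mul]; gcongr; exact hdn n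
  set R : EllTwo → EllTwo := fun ξ => ⟨fun n => (d n)⁻¹ * ξ n, hmem ξ⟩ with hR
  have hRsub : ∀ ξ ξ', R ξ - R ξ' = R (ξ - ξ') := by
    intro ξ ξ'
    ext n
    rw [lp.coeFn_sub, Pi.sub_apply]
    simp only [hR, lp.coeFn_sub, Pi.sub_apply]
    ring
  have hRn : ∀ ξ, ‖R ξ‖ ≤ |T|⁻¹ * ‖ξ‖ := fun ξ =>
    ellTwo_norm_le (by positivity) fun n => by
      simp only [hR, norm_mul]
      gcongr
      exact hdn n
  have hRdom : ∀ ξ, R ξ ∈ (schrodingerB q α).domain := by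
    intro ξ
    rw [mem_schrodingerB_domain]
    refine ellTwo_mem_of_le (ψ := ξ) (C := |α|⁻¹ * 2) fun n => ?_
    -- The quotient of the potential by `d n` is `1 + iT / d n`, of modulus at most `2`. So
    -- inverting the diagonal maps into the domain.
    have e : (q : ℂ) ^ (-n) * R ξ n = (α : ℂ)⁻¹ * ((1 + T * Complex.I * (d n)⁻¹) * ξ n) := by
      have h1 : (α : ℂ) * (q : ℂ) ^ (-n) = d n + T * Complex.I := by simp [hd]
      have h2 := hd0 n
      have h3 : (q : ℂ) ^ (-n) = (α : ℂ)⁻¹ * (d n + T * Complex.I) := by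
        rw [← h1, ← mul_assoc, inv_mul_cancel₀ hα', one_mul]
      simp only [hR]
      rw [h3]
      field_simp
    rw [e, norm_mul, norm_mul, norm_inv, Complex.norm_real, Real.norm_eq_abs, ← mul_assoc]
    gcongr
    refine (norm_add_le _ _).trans ?_
    rw [norm_mul, norm_mul, Complex.norm_I, Complex.norm_real, Real.norm_eq_abs, norm_one, mul_one]
    have := mul_le_mul_of_nonneg_left (hdn n) hT0.le
    rw [mul_inv_cancel₀ hT0.ne'] at this
    linarith
  -- A fixed point solves the equation. Both shifts are isometric, so the Lipschitz constant is
  -- `2/|T| < 1`.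
  set f : EllTwo → EllTwo := fun ψ => R (η - (shiftSeq (-1) ψ + shiftSeq 1 ψ)) with hf
  have hcontr : ContractingWith (⟨2 * |T|⁻¹, by positivity⟩ : NNReal) f := by
    refine ⟨?_, LipschitzWith.of_dist_le_mul fun x y => ?_⟩
    · apply NNReal.coe_lt_coe.mp
      change 2 * |T|⁻¹ < 1
      rw [← div_eq_mul_inv, div_lt_one hT0]
      exact hT
    · rw [dist_eq_norm, dist_eq_norm]
      change ‖f x - f y‖ ≤ 2 * |T|⁻¹ * ‖x - y‖
      have e : η - (shiftSeq (-1) x + shiftSeq 1 x) - (η - (shiftSeq (-1) y + shiftSeq 1 y)) =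
          -(shiftSeq (-1) (x - y) + shiftSeq 1 (x - y)) := by
        rw [shiftSeq_sub, shiftSeq_sub]; abel
      simp only [hf]
      rw [hRsub, e]
      refine (hRn _).trans ?_
      rw [norm_neg]
      have := norm_add_le (shiftSeq (-1) (x - y)) (shiftSeq 1 (x - y))
      rw [norm_shiftSeq, norm_shiftSeq] at this
      calc _ ≤ |T|⁻¹ * (‖x - y‖ + ‖x - y‖) := by gcongr
        _ = _ := by ring
  have hfix : f (hcontr.fixedPoint f) = hcontr.fixedPoint f := hcontr.fixedPoint_isFixedPt
  set ψ := hcontr.fixedPoint f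
  refine ⟨⟨ψ, by rw [← hfix]; exact hRdom _⟩, ?_⟩
  ext n
  have hn : (d n)⁻¹ * (η n - (ψ (n + -1) + ψ (n + 1))) = ψ n :=
    congrArg (fun φ : EllTwo => φ n) hfix
  have hn' : η n - (ψ (n + -1) + ψ (n + 1)) = d n * ψ n := by
    rw [← hn, ← mul_assoc, mul_inv_cancel₀ (hd0 n), one_mul]
  rw [lp.coeFn_sub, Pi.sub_apply, schrodingerB_apply, lp.coeFn_smul, Pi.smul_apply, smul_eq_mul]
  simp only [hd] at hn'
  push_cast at hn'
  linear_combination -hn'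

/-- `B - z` is onto for all nonreal `z`, given the resolvent bound. -/
theorem schrodingerB_sub_surjective (hα : α ≠ 0)
    (hbound : ∀ (z : ℂ), z.im ≠ 0 → ∀ ψ : (schrodingerB q α).domain,
      ‖(ψ : EllTwo)‖ ≤ |z.im|⁻¹ * ‖schrodingerB q α ψ - z • (ψ : EllTwo)‖)
    {z : ℂ} (hz : z.im ≠ 0) (η : EllTwo) : ∃ ψ : (schrodingerB q α).domain,
      schrodingerB q α ψ - z • (ψ : EllTwo) = η := by
  -- The second condition amounts to `|z|² < 2 T Im z`. It holds for `T` of the same sign as `Im z`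
  -- with `|T| = 3 + |z|² / |Im z|`.
  obtain ⟨T, hT2, hT⟩ : ∃ T : ℝ, 2 < |T| ∧ ‖z - T * Complex.I‖ < |T| := by
    have key : ∀ s : ℝ, |s| = 1 → 0 < s * z.im → ∃ T : ℝ, 2 < |T| ∧ ‖z - T * Complex.I‖ < |T| := by
      intro s hs hsz
      have hz' : |z.im| = s * z.im := by
        rw [← abs_of_pos hsz, abs_mul, hs, one_mul]
      have hnz : 0 ≤ ‖z‖ ^ 2 / |z.im| := by positivity
      have hpos : 0 ≤ 3 + ‖z‖ ^ 2 / |z.im| := by linarith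
      refine ⟨s * (3 + ‖z‖ ^ 2 / |z.im|), ?_, ?_⟩
      · rw [abs_mul, hs, one_mul, abs_of_nonneg hpos]; linarith
      · rw [abs_mul, hs, one_mul, abs_of_nonneg hpos]
        refine abs_lt_of_sq_lt_sq' ?_ (by linarith) |>.2
        have h1 : ‖z‖ ^ 2 / |z.im| * (s * z.im) = ‖z‖ ^ 2 := by
          rw [← hz', div_mul_cancel₀ _ (abs_pos.mpr hz).ne']
        have hs2 : s ^ 2 = 1 := by rw [← sq_abs, hs, one_pow]
        set A := ‖z‖ ^ 2 / |z.im|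
        have h2 : ‖z‖ ^ 2 = z.re ^ 2 + z.im ^ 2 := by
          rw [← Complex.normSq_eq_norm_sq, Complex.normSq_apply]; ring
        rw [← Complex.normSq_eq_norm_sq, Complex.normSq_apply]
        simp only [Complex.sub_re, Complex.sub_im, Complex.mul_re, Complex.mul_im,
          Complex.ofReal_re, Complex.ofReal_im, Complex.I_re, Complex.I_im]
        have hA : (s * (3 + A)) ^ 2 = (3 + A) ^ 2 := by rw [mul_pow, hs2, one_mul]
        nlinarith [sq_nonneg ‖z‖]
    rcases lt_or_gt_of_ne hz with h | h
    · exact key (-1) (by simp) (by linarith)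
    · exact key 1 (by simp) (by linarith)
  have him : ((T : ℂ) * Complex.I).im = T := by simp
  have hT0 : 0 < |T| := by linarith
  choose R hR using schrodingerB_sub_surjective_of_large (q := q) hα hT2
  -- The first resolvent equation as a fixed point problem. The resolvent at `iT` has norm at most
  -- `1/|T|`, so the disc of radius `|T|` about `iT` is covered.
  set f : EllTwo → EllTwo := fun ψ => (R (η + (z - T * Complex.I) • ψ) : EllTwo) with hf
  have hcontr : ContractingWith (⟨|T|⁻¹ * ‖z - T * Complex.I‖, by positivity⟩ : NNReal) f := by
    refine ⟨?_, LipschitzWith.of_dist_le_mul fun x y => ?_⟩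
    · apply NNReal.coe_lt_coe.mp
      change |T|⁻¹ * ‖z - T * Complex.I‖ < 1
      rw [inv_mul_lt_one₀ hT0]
      exact hT
    · rw [dist_eq_norm, dist_eq_norm]
      change ‖f x - f y‖ ≤ |T|⁻¹ * ‖z - T * Complex.I‖ * ‖x - y‖
      have h1 := hbound (T * Complex.I) (by rw [him]; exact abs_pos.mp hT0)
        (R (η + (z - T * Complex.I) • x) - R (η + (z - T * Complex.I) • y))
      have e : schrodingerB q α (R (η + (z - T * Complex.I) • x) - R (η + (z - T * Complex.I) • y)) -
          (T * Complex.I) • ((R (η + (z - T * Complex.I) • x) -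
            R (η + (z - T * Complex.I) • y) : (schrodingerB q α).domain) : EllTwo) =
          (z - T * Complex.I) • (x - y) := by
        have e1 := hR (η + (z - T * Complex.I) • x)
        have e2 := hR (η + (z - T * Complex.I) • y)
        rw [LinearPMap.map_sub, Submodule.coe_sub, smul_sub, smul_sub]
        calc _ = (schrodingerB q α (R (η + (z - T * Complex.I) • x)) -
              (T * Complex.I) • (R (η + (z - T * Complex.I) • x) : EllTwo)) -
            (schrodingerB q α (R (η + (z - T * Complex.I) • y)) -
              (T * Complex.I) • (R (η + (z - T * Complex.I) • y) : EllTwo)) := by abel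
          _ = _ := by rw [e1, e2]; abel
      rw [e, him, norm_smul, ← mul_assoc] at h1
      exact h1
  have hfix : f (hcontr.fixedPoint f) = hcontr.fixedPoint f := hcontr.fixedPoint_isFixedPt
  set ψ := hcontr.fixedPoint f
  refine ⟨R (η + (z - T * Complex.I) • ψ), ?_⟩
  have h1 := hR (η + (z - T * Complex.I) • ψ)
  have h2 : (R (η + (z - T * Complex.I) • ψ) : EllTwo) = ψ := hfix
  rw [h2] at h1 ⊢
  rw [sub_eq_iff_eq_add.mp h1, sub_smul]
  abel

end SchrodingerB

/-! ### Multiplication operators and invariance of the range of the isometry -/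

section MultiplicationOperators

variable {μ : Measure ℝ}

/-- Multiplication by a bounded measurable function on `L²`. -/
theorem exists_mul_lp {g : ℝ → ℂ} (hg : Measurable g) {C : ℝ} (hC : ∀ x, ‖g x‖ ≤ C) :
    ∃ M : Lp ℂ 2 μ →L[ℂ] Lp ℂ 2 μ, (∀ f, M f =ᵐ[μ] fun x => g x * f x) ∧
      ∀ f, ‖M f‖ ≤ C * ‖f‖ := by
  have hmem : ∀ f : Lp ℂ 2 μ, MemLp (fun x => g x * f x) 2 μ := fun f =>
    (Lp.memLp f).of_le_mul (c := C) (hg.aestronglyMeasurable.mul (Lp.aestronglyMeasurable f))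
      (ae_of_all _ fun x => by rw [norm_mul]; gcongr; exact hC x)
  have hcoe : ∀ f, (hmem f).toLp =ᵐ[μ] fun x => g x * f x := fun f => (hmem f).coeFn_toLp
  have hnorm : ∀ f, ‖(hmem f).toLp‖ ≤ C * ‖f‖ := fun f =>
    Lp.norm_le_mul_norm_of_ae_le_mul (by
      filter_upwards [hcoe f] with x hx
      rw [hx, norm_mul]
      gcongr
      exact hC x)
  refine ⟨LinearMap.mkContinuous
    { toFun := fun f => (hmem f).toLp
      map_add' := fun f₁ f₂ => Lp.ext (by
        filter_upwards [hcoe f₁, hcoe f₂, hcoe (f₁ + f₂), Lp.coeFn_add f₁ f₂,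
          Lp.coeFn_add (hmem f₁).toLp (hmem f₂).toLp] with x h1 h2 h3 h4 h5
        rw [h3, h5, Pi.add_apply, h1, h2, h4, Pi.add_apply, mul_add])
      map_smul' := fun c f => Lp.ext (by
        filter_upwards [hcoe f, hcoe (c • f), Lp.coeFn_smul c f,
          Lp.coeFn_smul c (hmem f).toLp] with x h1 h2 h3 h4
        rw [RingHom.id_apply, h2, h4, Pi.smul_apply, h1, h3, Pi.smul_apply, smul_eq_mul,
          smul_eq_mul, mul_left_comm]) } C hnorm, hcoe, hnorm⟩

variable {H : Type*} [NormedAddCommGroup H] [InnerProductSpace ℂ H]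

/-- Under `Φ` the operator `T - z` is multiplication by `x - z`, and `|x - z| ≥ |Im z|` for real
`x`. -/
theorem LinearIsometry.norm_le_of_mul {Φ : H →ₗᵢ[ℂ] Lp ℂ 2 μ} {T : H →ₗ.[ℂ] H}
    (hmul : ∀ ψ : T.domain, Φ (T ψ) =ᵐ[μ] fun x => (x : ℂ) * Φ ψ x) {z : ℂ} (hz : z.im ≠ 0)
    (ψ : T.domain) : ‖(ψ : H)‖ ≤ |z.im|⁻¹ * ‖T ψ - z • (ψ : H)‖ := by
  rw [← Φ.norm_map, ← Φ.norm_map (T ψ - z • (ψ : H))]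
  refine Lp.norm_le_mul_norm_of_ae_le_mul ?_
  rw [map_sub, map_smul]
  filter_upwards [hmul ψ, Lp.coeFn_sub (Φ (T ψ)) (z • Φ ψ), Lp.coeFn_smul z (Φ ψ)] with x h1 h2 h3
  rw [h2, Pi.sub_apply, h3, h1, Pi.smul_apply, smul_eq_mul, ← sub_mul, norm_mul, ← mul_assoc]
  have h4 := norm_inv_ofReal_sub_le hz x
  have h5 : 0 < ‖(x : ℂ) - z‖ := norm_pos_iff.mpr (ofReal_sub_ne_zero hz x)
  rw [norm_inv] at h4
  have h6 : 1 ≤ |z.im|⁻¹ * ‖(x : ℂ) - z‖ := by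
    calc (1 : ℝ) = ‖(x : ℂ) - z‖⁻¹ * ‖(x : ℂ) - z‖ := (inv_mul_cancel₀ h5.ne').symm
      _ ≤ _ := by gcongr
  exact le_mul_of_one_le_left (norm_nonneg _) h6

/-- If `Φ` intertwines `T` with the multiplication by `x`, and `T - z` is onto for nonreal `z`,
then the range of `Φ` is invariant under all multiplications. -/
theorem LinearIsometry.exists_eq_of_ae_mul [SFinite μ] [CompleteSpace H] {Φ : H →ₗᵢ[ℂ] Lp ℂ 2 μ}
    {T : H →ₗ.[ℂ] H}
    (hmul : ∀ ψ : T.domain, Φ (T ψ) =ᵐ[μ] fun x => (x : ℂ) * Φ ψ x)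
    (hsurj : ∀ z : ℂ, z.im ≠ 0 → ∀ η : H, ∃ ψ : T.domain, T ψ - z • (ψ : H) = η)
    {ψ : H} {h : Lp ℂ 2 μ} {g : ℝ → ℂ} (hh : h =ᵐ[μ] fun x => g x * Φ ψ x) :
    ∃ η, Φ η = h := by
  set R : Submodule ℂ (Lp ℂ 2 μ) := LinearMap.range Φ.toLinearMap with hR
  have hclosed : IsClosed (R : Set (Lp ℂ 2 μ)) := by
    have := Φ.isometry.isClosedEmbedding.isClosed_range
    rwa [hR, LinearMap.coe_range]
  have : CompleteSpace R := hclosed.completeSpace_coe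
  have hmemR : h ∈ R := by
    rw [← Submodule.orthogonal_orthogonal R, Submodule.mem_orthogonal]
    intro k hk
    rw [Submodule.mem_orthogonal'] at hk
    -- With `χ` solving `(T - z)χ = ψ`, the function `(x - z)⁻¹ Φψ` equals `Φχ` and lies in the
    -- range. So the pointwise inner product with `k`, orthogonal to the range, has vanishing
    -- Stieltjes transform.
    have hzero : ∀ᵐ x ∂μ, inner ℂ (k x) (Φ ψ x) = 0 := by
      refine ae_eq_zero_of_stieltjes (L2.integrable_inner k (Φ ψ)) fun z hz => ?_
      obtain ⟨χ, hχ⟩ := hsurj z hz ψ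
      have h1 : inner ℂ k (Φ χ) = 0 := hk _ ⟨χ, rfl⟩
      rw [L2.inner_def] at h1
      rw [← h1]
      refine integral_congr_ae ?_
      have h2 : Φ ψ = Φ (T χ) - z • Φ χ := by rw [← hχ, map_sub, map_smul]
      filter_upwards [hmul χ, Lp.coeFn_sub (Φ (T χ)) (z • Φ χ), Lp.coeFn_smul z (Φ χ)]
        with x h3 h4 h5
      rw [h2, h4, Pi.sub_apply, h5, h3, Pi.smul_apply, smul_eq_mul, ← sub_mul]
      simp only [RCLike.inner_apply]
      rw [← mul_assoc, ← mul_assoc, inv_mul_cancel₀ (ofReal_sub_ne_zero hz x), one_mul]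
    rw [L2.inner_def]
    refine integral_eq_zero_of_ae ?_
    filter_upwards [hzero, hh] with x h1 h2
    simp only [RCLike.inner_apply, Pi.zero_apply] at h1 ⊢
    rw [h2, mul_assoc, h1, mul_zero]
  exact hmemR

end MultiplicationOperators

/-! ### Norm convergence of orthogonal series -/

section HilbertSums

variable {H : Type*} [NormedAddCommGroup H] [InnerProductSpace ℂ H]

/-- By Pythagoras the squared distance of a partial sum from `w` is `‖w‖²` minus the partial sum of
the `‖v i‖²`. This lifts scalar countable additivity to the strong topology. -/
theorem hasSum_of_inner_eq {v : ℕ → H} {w : H} (horth : ∀ i j, i ≠ j → inner ℂ (v i) (v j) = 0)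
    (hw : ∀ i, inner ℂ (v i) w = (‖v i‖ : ℂ) ^ 2)
    (hsum : HasSum (fun i => ‖v i‖ ^ 2) (‖w‖ ^ 2)) : HasSum v w := by
  have key : ∀ s : Finset ℕ, ‖∑ i ∈ s, v i - w‖ ^ 2 = ‖w‖ ^ 2 - ∑ i ∈ s, ‖v i‖ ^ 2 := by
    intro s
    have h1 : inner ℂ (∑ i ∈ s, v i) w = ((∑ i ∈ s, ‖v i‖ ^ 2 : ℝ) : ℂ) := by
      rw [sum_inner]; push_cast; exact Finset.sum_congr rfl fun i _ => hw i
    have h2 : ((‖∑ i ∈ s, v i‖ : ℂ)) ^ 2 = ((∑ i ∈ s, ‖v i‖ ^ 2 : ℝ) : ℂ) := by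
      have h3 := inner_self_eq_norm_sq_to_K (𝕜 := ℂ) (∑ i ∈ s, v i)
      refine h3.symm.trans ?_
      rw [sum_inner]
      push_cast
      refine Finset.sum_congr rfl fun i hi => ?_
      rw [inner_sum, Finset.sum_eq_single i]
      · exact inner_self_eq_norm_sq_to_K (𝕜 := ℂ) (v i)
      · intro j _ hj; exact horth i j hj.symm
      · intro h; exact absurd hi h
    have h4 : ‖∑ i ∈ s, v i‖ ^ 2 = ∑ i ∈ s, ‖v i‖ ^ 2 := by exact_mod_cast h2
    rw [norm_sub_sq (𝕜 := ℂ), h1, h4]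
    simp only [RCLike.re_to_complex, Complex.ofReal_re]
    ring
  rw [HasSum, tendsto_iff_norm_sub_tendsto_zero]
  have h5 : Tendsto (fun s : Finset ℕ => ‖∑ i ∈ s, v i - w‖ ^ 2) atTop (𝓝 0) := by
    simp_rw [key]
    have h7 : Tendsto (fun s : Finset ℕ => ∑ i ∈ s, ‖v i‖ ^ 2) atTop (𝓝 (‖w‖ ^ 2)) := hsum
    have h8 := h7.const_sub (‖w‖ ^ 2)
    rwa [sub_self] at h8
  have h6 := h5.sqrt
  simpa [Real.sqrt_sq (norm_nonneg _)] using h6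

end HilbertSums

/-! ### Construction of the spectral measure from indicator functions -/

section SpectralMeasureExists

variable {μ : Measure ℝ} {H : Type*} [NormedAddCommGroup H] [InnerProductSpace ℂ H]

theorem ProjValuedMeasure.scalar_apply [CompleteSpace H] (E : ProjValuedMeasure H) (ψ : H)
    {A : Set ℝ}
    (hA : MeasurableSet A) : E.scalar ψ A = ENNReal.ofReal (inner ℂ ψ (E.toFun A ψ)).re := by
  rw [ProjValuedMeasure.scalar, Measure.ofMeasurable_apply _ hA]

/-- The projections induced by multiplication with indicator functions. -/
theorem LinearIsometry.exists_indicator_projection [CompleteSpace H] [SFinite μ]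
    {Φ : H →ₗᵢ[ℂ] Lp ℂ 2 μ}
    {T : H →ₗ.[ℂ] H} (hmul : ∀ ψ : T.domain, Φ (T ψ) =ᵐ[μ] fun x => (x : ℂ) * Φ ψ x)
    (hsurj : ∀ z : ℂ, z.im ≠ 0 → ∀ η : H, ∃ ψ : T.domain, T ψ - z • (ψ : H) = η)
    {A : Set ℝ} (hA : MeasurableSet A) :
    ∃ P : H →L[ℂ] H, ∀ ψ, Φ (P ψ) =ᵐ[μ] A.indicator (Φ ψ) := by
  obtain ⟨M, hM, -⟩ := exists_mul_lp (μ := μ) (g := A.indicator 1)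
    (measurable_one.indicator hA) (C := 1) fun x => by
      by_cases h : x ∈ A <;> simp [h]
  refine ⟨ContinuousLinearMap.adjoint Φ.toContinuousLinearMap ∘L M ∘L Φ.toContinuousLinearMap,
    fun ψ => ?_⟩
  obtain ⟨η, hη⟩ := Φ.exists_eq_of_ae_mul hmul hsurj (hM (Φ ψ))
  have h1 : (ContinuousLinearMap.adjoint Φ.toContinuousLinearMap ∘L M ∘L
      Φ.toContinuousLinearMap) ψ = η := by
    refine ext_inner_left ℂ fun χ => ?_
    simp only [ContinuousLinearMap.comp_apply, ContinuousLinearMap.adjoint_inner_right,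
      LinearIsometry.coe_toContinuousLinearMap]
    rw [← hη, LinearIsometry.inner_map_map]
  rw [h1, hη]
  filter_upwards [hM (Φ ψ)] with x hx
  rw [hx]
  by_cases h : x ∈ A <;> simp [h]

theorem LinearIsometry.inner_indicator_projection {Φ : H →ₗᵢ[ℂ] Lp ℂ 2 μ} {A : Set ℝ}
    (hA : MeasurableSet A) {P : H →L[ℂ] H} (hP : ∀ ψ, Φ (P ψ) =ᵐ[μ] A.indicator (Φ ψ)) (χ ψ : H) :
    inner ℂ χ (P ψ) = ∫ x in A, inner ℂ (Φ χ x) (Φ ψ x) ∂μ := by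
  rw [← Φ.inner_map_map, L2.inner_def, ← integral_indicator hA]
  refine integral_congr_ae ?_
  filter_upwards [hP ψ] with x hx
  rw [hx]
  by_cases h : x ∈ A <;> simp [h]

theorem LinearIsometry.isStarProjection_indicator [CompleteSpace H] {Φ : H →ₗᵢ[ℂ] Lp ℂ 2 μ}
    {A : Set ℝ}
    (hA : MeasurableSet A) {P : H →L[ℂ] H} (hP : ∀ ψ, Φ (P ψ) =ᵐ[μ] A.indicator (Φ ψ)) :
    IsStarProjection P := by
  constructor
  · ext ψ
    refine Φ.injective (Lp.ext ?_)
    filter_upwards [hP (P ψ), hP ψ] with x h1 h2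
    change Φ (P (P ψ)) x = _
    rw [h1]
    by_cases h : x ∈ A <;> simp [h, h2]
  · rw [ContinuousLinearMap.isSelfAdjoint_iff_isSymmetric]
    intro ψ χ
    change inner ℂ (P ψ) χ = inner ℂ ψ (P χ)
    rw [← inner_conj_symm, Φ.inner_indicator_projection hA hP, Φ.inner_indicator_projection hA hP,
      ← integral_conj]
    simp_rw [inner_conj_symm]

theorem LinearIsometry.inner_self_integrable (Φ : H →ₗᵢ[ℂ] Lp ℂ 2 μ) (ψ : H) :
    Integrable (fun x => ‖Φ ψ x‖ ^ 2) μ := by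
  have := (Lp.memLp (Φ ψ)).integrable_norm_pow (by norm_num)
  simpa using this

theorem LinearIsometry.inner_self_indicator_projection {Φ : H →ₗᵢ[ℂ] Lp ℂ 2 μ} {A : Set ℝ}
    (hA : MeasurableSet A) {P : H →L[ℂ] H} (hP : ∀ ψ, Φ (P ψ) =ᵐ[μ] A.indicator (Φ ψ)) (ψ : H) :
    inner ℂ ψ (P ψ) = ((∫ x in A, ‖Φ ψ x‖ ^ 2 ∂μ : ℝ) : ℂ) := by
  rw [Φ.inner_indicator_projection hA hP, ← integral_complex_ofReal]
  refine integral_congr_ae (ae_of_all _ fun x => ?_)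
  simp

theorem LinearIsometry.norm_sq_indicator_projection {Φ : H →ₗᵢ[ℂ] Lp ℂ 2 μ} {A : Set ℝ}
    (hA : MeasurableSet A) {P : H →L[ℂ] H} (hP : ∀ ψ, Φ (P ψ) =ᵐ[μ] A.indicator (Φ ψ)) (ψ : H) :
    ‖P ψ‖ ^ 2 = ∫ x in A, ‖Φ ψ x‖ ^ 2 ∂μ := by
  have h1 := inner_self_eq_norm_sq_to_K (𝕜 := ℂ) (P ψ)
  rw [← Φ.inner_map_map, L2.inner_def] at h1
  have h2 : ∫ x, inner ℂ (Φ (P ψ) x) (Φ (P ψ) x) ∂μ = ((∫ x in A, ‖Φ ψ x‖ ^ 2 ∂μ : ℝ) : ℂ) := by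
    rw [← integral_complex_ofReal, ← integral_indicator hA]
    refine integral_congr_ae ?_
    filter_upwards [hP ψ] with x hx
    rw [hx]
    by_cases h : x ∈ A
    · simp [h]
    · simp [h]
  rw [h2] at h1
  refine Complex.ofReal_injective ?_
  rw [h1, Complex.ofReal_pow]
  rfl

/-- An operator that is unitarily equivalent to a restriction of the multiplication by `x` and has
surjective `T - z` has the spectral measure induced by the indicator functions. -/
theorem LinearIsometry.exists_projValuedMeasure [CompleteSpace H] [SFinite μ]
    {Φ : H →ₗᵢ[ℂ] Lp ℂ 2 μ}
    {T : H →ₗ.[ℂ] H} (hmul : ∀ ψ : T.domain, Φ (T ψ) =ᵐ[μ] fun x => (x : ℂ) * Φ ψ x)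
    (hsurj : ∀ z : ℂ, z.im ≠ 0 → ∀ η : H, ∃ ψ : T.domain, T ψ - z • (ψ : H) = η) :
    ∃ E : ProjValuedMeasure H, ∀ A, MeasurableSet A → ∀ ψ,
      Φ (E.toFun A ψ) =ᵐ[μ] A.indicator (Φ ψ) := by
  classical
  choose P hP using fun (A : Set ℝ) (hA : MeasurableSet A) =>
    Φ.exists_indicator_projection hmul hsurj hA
  -- The value at non-measurable sets is arbitrary.
  set Q : Set ℝ → H →L[ℂ] H := fun A => if hA : MeasurableSet A then P A hA else 0 with hQdef
  have hQ : ∀ A, MeasurableSet A → ∀ ψ, Φ (Q A ψ) =ᵐ[μ] A.indicator (Φ ψ) := by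
    intro A hA
    simp only [hQdef, dif_pos hA]
    exact hP A hA
  refine ⟨⟨Q, fun A hA => Φ.isStarProjection_indicator hA (hQ A hA), ?_, ?_⟩, hQ⟩
  · ext ψ
    refine Φ.injective (Lp.ext ?_)
    filter_upwards [hQ _ MeasurableSet.univ ψ] with x hx
    rw [hx]
    simp
  · intro A hA hd ψ
    have hU := MeasurableSet.iUnion hA
    refine hasSum_of_inner_eq (fun i j hij => ?_) (fun i => ?_) ?_
    · rw [Φ.inner_indicator_projection (hA j) (hQ _ (hA j)), ← integral_indicator (hA j)]
      refine integral_eq_zero_of_ae ?_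
      filter_upwards [hQ _ (hA i) ψ] with x hx
      by_cases h : x ∈ A j
      · have : x ∉ A i := fun h' => Set.disjoint_left.mp (hd hij) h' h
        simp [h, hx, this]
      · simp [h]
    · rw [Φ.inner_indicator_projection hU (hQ _ hU), ← integral_indicator hU,
        ← Complex.ofReal_pow, Φ.norm_sq_indicator_projection (hA i) (hQ _ (hA i)),
        ← integral_complex_ofReal, ← integral_indicator (hA i)]
      refine integral_congr_ae ?_
      filter_upwards [hQ _ (hA i) ψ] with x hx
      rw [Set.indicator_apply, Set.indicator_apply, hx]
      by_cases h : x ∈ A i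
      · have h' : x ∈ ⋃ i, A i := Set.mem_iUnion_of_mem i h
        simp [h, h']
      · simp [h]
    · rw [Φ.norm_sq_indicator_projection hU (hQ _ hU)]
      simp_rw [fun i => Φ.norm_sq_indicator_projection (hA i) (hQ _ (hA i)) ψ]
      exact hasSum_integral_iUnion hA hd (Φ.inner_self_integrable ψ).integrableOn

theorem LinearIsometry.scalar_eq_withDensity [CompleteSpace H] {Φ : H →ₗᵢ[ℂ] Lp ℂ 2 μ}
    {E : ProjValuedMeasure H}
    (hE : ∀ A, MeasurableSet A → ∀ ψ, Φ (E.toFun A ψ) =ᵐ[μ] A.indicator (Φ ψ)) (ψ : H) :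
    E.scalar ψ = μ.withDensity fun x => ENNReal.ofReal (‖Φ ψ x‖ ^ 2) := by
  ext A hA
  rw [E.scalar_apply ψ hA, withDensity_apply _ hA,
    Φ.inner_self_indicator_projection hA (hE A hA), Complex.ofReal_re,
    ofReal_integral_eq_lintegral_ofReal (Φ.inner_self_integrable ψ).integrableOn
      (ae_of_all _ fun x => by positivity)]

theorem LinearIsometry.isSpectralMeasureOf [CompleteSpace H] [SFinite μ] {Φ : H →ₗᵢ[ℂ] Lp ℂ 2 μ}
    {T : H →ₗ.[ℂ] H} (hmul : ∀ ψ : T.domain, Φ (T ψ) =ᵐ[μ] fun x => (x : ℂ) * Φ ψ x)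
    (hsurj : ∀ z : ℂ, z.im ≠ 0 → ∀ η : H, ∃ ψ : T.domain, T ψ - z • (ψ : H) = η)
    {E : ProjValuedMeasure H}
    (hE : ∀ A, MeasurableSet A → ∀ ψ, Φ (E.toFun A ψ) =ᵐ[μ] A.indicator (Φ ψ)) :
    E.IsSpectralMeasureOf T := by
  have hmeas : ∀ ψ, Measurable fun x => ENNReal.ofReal (‖Φ ψ x‖ ^ 2) := fun ψ =>
    ((Lp.stronglyMeasurable (Φ ψ)).norm.measurable.pow_const 2).ennreal_ofReal
  have hfin : ∀ ψ, ∀ᵐ x ∂μ, ENNReal.ofReal (‖Φ ψ x‖ ^ 2) < ⊤ := fun ψ =>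
    ae_of_all _ fun x => ENNReal.ofReal_lt_top
  have hreal : ∀ ψ x, (ENNReal.ofReal (‖Φ ψ x‖ ^ 2)).toReal = ‖Φ ψ x‖ ^ 2 := fun ψ x =>
    ENNReal.toReal_ofReal (by positivity)
  refine ⟨fun ψ => ?_, fun ψ => ?_⟩
  · rw [Φ.scalar_eq_withDensity hE, integrable_withDensity_iff_integrable_smul' (hmeas ψ) (hfin ψ)]
    simp_rw [hreal, smul_eq_mul]
    constructor
    · intro hψ
      have h1 := Φ.inner_self_integrable (T ⟨ψ, hψ⟩)
      refine h1.congr ?_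
      filter_upwards [hmul ⟨ψ, hψ⟩] with x hx
      rw [hx, norm_mul, Complex.norm_real, Real.norm_eq_abs, mul_pow, sq_abs, mul_comm]
    -- If `x Φψ` is square integrable, so is `(x - i) Φψ`. By invariance it equals `Φη` for some
    -- `η`, and the solution `χ` of `(T - i)χ = η` must be `ψ`, which is thereby in the domain.
    · intro hint
      have hmem : MemLp (fun x : ℝ => ((x : ℂ) - Complex.I) * Φ ψ x) 2 μ := by
        rw [memLp_two_iff_integrable_sq_norm]
        · refine (hint.add (Φ.inner_self_integrable ψ)).congr (ae_of_all _ fun x => ?_)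
          have : ‖(x : ℂ) - Complex.I‖ ^ 2 = x ^ 2 + 1 := by
            rw [← Complex.normSq_eq_norm_sq, Complex.normSq_apply]
            simp
            ring
          simp only [Pi.add_apply, norm_mul, mul_pow, this]
          ring
        · exact ((Complex.measurable_ofReal.sub_const _).aestronglyMeasurable).mul
            (Lp.aestronglyMeasurable _)
      obtain ⟨η, hη⟩ := Φ.exists_eq_of_ae_mul hmul hsurj hmem.coeFn_toLp
      obtain ⟨χ, hχ⟩ := hsurj Complex.I (by simp) η
      have : (χ : H) = ψ := by
        refine Φ.injective (Lp.ext ?_)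
        have h2 : Φ η = Φ (T χ) - Complex.I • Φ χ := by rw [← hχ, map_sub, map_smul]
        rw [hη] at h2
        filter_upwards [hmul χ, Lp.coeFn_sub (Φ (T χ)) (Complex.I • Φ χ),
          Lp.coeFn_smul Complex.I (Φ χ), hmem.coeFn_toLp] with x h3 h4 h5 h6
        rw [h2, h4, Pi.sub_apply, h5, h3, Pi.smul_apply, smul_eq_mul, ← sub_mul] at h6
        exact mul_left_cancel₀ (ofReal_sub_ne_zero (by simp) x) h6
      rw [← this]
      exact χ.2
  · rw [Φ.scalar_eq_withDensity hE, integral_withDensity_eq_integral_toReal_smul (hmeas _) (hfin _),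
      ← Φ.inner_map_map, L2.inner_def, ← integral_complex_ofReal]
    refine integral_congr_ae ?_
    filter_upwards [hmul ψ] with x hx
    rw [hx, hreal, smul_eq_mul, ← smul_eq_mul (x : ℂ), inner_smul_right]
    have := inner_self_eq_norm_sq_to_K (𝕜 := ℂ) (Φ ψ x)
    rw [this]
    push_cast
    rw [mul_comm]
    rfl

end SpectralMeasureExists

/-! ### Calculus of an arbitrary projection-valued measure -/

namespace ProjValuedMeasure

variable {H : Type*} [NormedAddCommGroup H] [InnerProductSpace ℂ H] [CompleteSpace H]
  (E : ProjValuedMeasure H) {A B : Set ℝ}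

theorem apply_apply_self (hA : MeasurableSet A) (ψ : H) :
    E.toFun A (E.toFun A ψ) = E.toFun A ψ :=
  congrArg (fun P : H →L[ℂ] H => P ψ) (E.isProj A hA).isIdempotentElem

theorem inner_apply_left (hA : MeasurableSet A) (φ ψ : H) :
    inner ℂ (E.toFun A φ) ψ = inner ℂ φ (E.toFun A ψ) :=
  (ContinuousLinearMap.isSelfAdjoint_iff_isSymmetric.mp (E.isProj A hA).isSelfAdjoint) φ ψ

theorem inner_self_apply (hA : MeasurableSet A) (ψ : H) :
    inner ℂ ψ (E.toFun A ψ) = ((‖E.toFun A ψ‖ ^ 2 : ℝ) : ℂ) := by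
  rw [← E.apply_apply_self hA, ← E.inner_apply_left hA, inner_self_eq_norm_sq_to_K,
    E.apply_apply_self hA, Complex.ofReal_pow]
  rfl

theorem scalar_apply_eq_norm_sq (hA : MeasurableSet A) (ψ : H) :
    E.scalar ψ A = ENNReal.ofReal (‖E.toFun A ψ‖ ^ 2) := by
  rw [E.scalar_apply ψ hA, E.inner_self_apply hA, Complex.ofReal_re]

theorem scalar_univ (ψ : H) : E.scalar ψ Set.univ = ENNReal.ofReal (‖ψ‖ ^ 2) := by
  rw [E.scalar_apply_eq_norm_sq MeasurableSet.univ, E.map_univ]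
  rfl

instance isFiniteMeasure_scalar (ψ : H) : IsFiniteMeasure (E.scalar ψ) :=
  ⟨by rw [E.scalar_univ]; exact ENNReal.ofReal_lt_top⟩

theorem scalar_real_eq (hA : MeasurableSet A) (ψ : H) :
    (E.scalar ψ).real A = ‖E.toFun A ψ‖ ^ 2 := by
  rw [measureReal_def, E.scalar_apply_eq_norm_sq hA, ENNReal.toReal_ofReal (by positivity)]

theorem scalar_eq_zero_iff (hA : MeasurableSet A) (ψ : H) :
    E.scalar ψ A = 0 ↔ E.toFun A ψ = 0 := by
  rw [E.scalar_apply_eq_norm_sq hA, ENNReal.ofReal_eq_zero]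
  constructor
  · intro h
    have : ‖E.toFun A ψ‖ ^ 2 = 0 := le_antisymm h (by positivity)
    simpa using this
  · intro h; simp [h]

theorem ext_of_scalar {E₁ E₂ : ProjValuedMeasure H} (h : ∀ ψ, E₁.scalar ψ = E₂.scalar ψ)
    (hA : MeasurableSet A) : E₁.toFun A = E₂.toFun A := by
  have key : ((E₁.toFun A : H →L[ℂ] H) : H →ₗ[ℂ] H) = (E₂.toFun A : H →L[ℂ] H) := by
    rw [← ext_inner_map]
    intro ψ
    change inner ℂ (E₁.toFun A ψ) ψ = inner ℂ (E₂.toFun A ψ) ψ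
    rw [E₁.inner_apply_left hA, E₂.inner_apply_left hA, E₁.inner_self_apply hA,
      E₂.inner_self_apply hA, ← E₁.scalar_real_eq hA, ← E₂.scalar_real_eq hA, h]
  exact ContinuousLinearMap.coe_injective key

theorem map_union (hA : MeasurableSet A) (hB : MeasurableSet B) (hd : Disjoint A B) :
    E.toFun (A ∪ B) = E.toFun A + E.toFun B := by
  have key : ((E.toFun (A ∪ B) : H →L[ℂ] H) : H →ₗ[ℂ] H) =
      ((E.toFun A + E.toFun B : H →L[ℂ] H) : H →ₗ[ℂ] H) := by
    rw [← ext_inner_map]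
    intro ψ
    change inner ℂ (E.toFun (A ∪ B) ψ) ψ = inner ℂ (E.toFun A ψ + E.toFun B ψ) ψ
    rw [inner_add_left, E.inner_apply_left hA, E.inner_apply_left hB,
      E.inner_apply_left (hA.union hB), E.inner_self_apply hA, E.inner_self_apply hB,
      E.inner_self_apply (hA.union hB), ← E.scalar_real_eq hA, ← E.scalar_real_eq hB,
      ← E.scalar_real_eq (hA.union hB), measureReal_union hd hB, Complex.ofReal_add]
  exact ContinuousLinearMap.coe_injective key

theorem norm_apply_le (hA : MeasurableSet A) (ψ : H) : ‖E.toFun A ψ‖ ≤ ‖ψ‖ := by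
  have h := measureReal_mono (μ := E.scalar ψ) (Set.subset_univ A)
  rw [E.scalar_real_eq hA, E.scalar_real_eq MeasurableSet.univ, E.map_univ] at h
  exact (abs_le_of_sq_le_sq' h (norm_nonneg _)).2

/-- Multiplicativity is not an axiom. For `φ = E(B)ψ` additivity gives `‖E(A)φ‖² + ‖E(B)φ‖² ≤ ‖φ‖²`,
and `E(B)φ = φ` leaves no room for the first term. -/
theorem apply_apply_of_disjoint (hA : MeasurableSet A) (hB : MeasurableSet B) (hd : Disjoint A B)
    (ψ : H) : E.toFun A (E.toFun B ψ) = 0 := by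
  have h1 : (E.scalar (E.toFun B ψ)).real (A ∪ B) ≤ (E.scalar (E.toFun B ψ)).real Set.univ :=
    measureReal_mono (Set.subset_univ _)
  rw [measureReal_union hd hB, E.scalar_real_eq hA, E.scalar_real_eq hB,
    E.scalar_real_eq MeasurableSet.univ, E.map_univ, E.apply_apply_self hB] at h1
  have h2 : ‖E.toFun A (E.toFun B ψ)‖ ^ 2 ≤ 0 := by
    change _ ≤ ‖E.toFun B ψ‖ ^ 2 at h1
    linarith
  simpa using le_antisymm h2 (by positivity)

theorem apply_apply (hA : MeasurableSet A) (hB : MeasurableSet B) (ψ : H) :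
    E.toFun A (E.toFun B ψ) = E.toFun (A ∩ B) ψ := by
  have h1 : E.toFun B = E.toFun (A ∩ B) + E.toFun (B \ A) := by
    rw [← E.map_union (hA.inter hB) (hB.diff hA), Set.inter_comm, Set.inter_union_sdiff]
    exact Set.disjoint_left.mpr fun x hx hx' => hx'.2 hx.1
  have h2 : E.toFun A = E.toFun (A ∩ B) + E.toFun (A \ B) := by
    rw [← E.map_union (hA.inter hB) (hA.diff hB), Set.inter_union_sdiff]
    exact Set.disjoint_left.mpr fun x hx hx' => hx'.2 hx.2
  have h3 : E.toFun A (E.toFun (B \ A) ψ) = 0 :=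
    E.apply_apply_of_disjoint hA (hB.diff hA) Set.disjoint_sdiff_right ψ
  have h4 : E.toFun (A \ B) (E.toFun (A ∩ B) ψ) = 0 :=
    E.apply_apply_of_disjoint (hA.diff hB) (hA.inter hB)
      (Set.disjoint_left.mpr fun x hx hx' => hx.2 hx'.2) ψ
  rw [h1, add_apply, map_add, h3, add_zero, h2, add_apply,
    h4, add_zero, E.apply_apply_self (hA.inter hB)]

theorem apply_compl (hA : MeasurableSet A) (ψ : H) :
    E.toFun A ψ + E.toFun Aᶜ ψ = ψ := by
  have := E.map_union hA hA.compl disjoint_compl_right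
  rw [Set.union_compl_self, E.map_univ] at this
  exact (congrArg (fun P : H →L[ℂ] H => P ψ) this).symm

theorem ae_mem_of_apply_eq_self (hA : MeasurableSet A) {ψ : H} (h : E.toFun A ψ = ψ) :
    ∀ᵐ x ∂(E.scalar ψ), x ∈ A := by
  rw [ae_iff]
  change E.scalar ψ Aᶜ = 0
  rw [E.scalar_eq_zero_iff hA.compl, ← h]
  exact E.apply_apply_of_disjoint hA.compl hA disjoint_compl_left ψ

theorem scalar_add_of_apply_eq (hA : MeasurableSet A) {φ ψ : H} (hφ : E.toFun A φ = 0)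
    (hψ : E.toFun A ψ = ψ) : E.scalar (φ + ψ) = E.scalar φ + E.scalar ψ := by
  ext B hB
  have h1 : inner ℂ φ (E.toFun B ψ) = 0 := by
    rw [← hψ, E.apply_apply hB hA, Set.inter_comm, ← E.apply_apply hA hB, ← E.inner_apply_left hA,
      hφ, inner_zero_left]
  have h2 : inner ℂ ψ (E.toFun B φ) = 0 := by
    rw [← E.inner_apply_left hB, ← inner_conj_symm, h1, map_zero]
  rw [Measure.add_apply, E.scalar_apply _ hB, E.scalar_apply _ hB, E.scalar_apply _ hB,
    ← ENNReal.ofReal_add (E.re_inner_nonneg hB φ) (E.re_inner_nonneg hB ψ), map_add, inner_add_left,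
    inner_add_right, inner_add_right, h1, h2]
  simp

section Operator

variable {E} {T : H →ₗ.[ℂ] H} {c r : ℝ}

theorem IsSpectralMeasureOf.mem_domain_of_apply_eq_self (hT : E.IsSpectralMeasureOf T) {ψ : H}
    (hψ : E.toFun (Set.Icc (c - r) (c + r)) ψ = ψ) : ψ ∈ T.domain := by
  rw [hT.mem_domain_iff]
  refine Integrable.of_bound (by fun_prop) ((|c| + |r|) ^ 2) ?_
  filter_upwards [E.ae_mem_of_apply_eq_self measurableSet_Icc hψ] with x hx
  rw [norm_pow, Real.norm_eq_abs]
  gcongr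
  rw [abs_le]
  constructor
  · linarith [neg_abs_le c, le_abs_self r, hx.1]
  · linarith [le_abs_self c, le_abs_self r, hx.2]

theorem IsSpectralMeasureOf.integrable_id (hT : E.IsSpectralMeasureOf T) (ψ : T.domain) :
    Integrable (fun x : ℝ => x) (E.scalar (ψ : H)) := by
  have h := (hT.mem_domain_iff ψ).mp ψ.2
  refine (h.add (integrable_const 1)).mono' (by fun_prop) (ae_of_all _ fun x => ?_)
  rw [Real.norm_eq_abs, Pi.add_apply]
  nlinarith [sq_abs x, sq_nonneg (|x| - 1), abs_nonneg x]

/-- The definition controls only the quadratic form of `T`. For vectors in complementary spectral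
subspaces the scalar measures add, so the cross terms of the form cancel. -/
theorem IsSpectralMeasureOf.inner_add_inner_eq_zero (hT : E.IsSpectralMeasureOf T) {A : Set ℝ}
    (hA : MeasurableSet A)
    {φ ψ : T.domain} (hφ : E.toFun A φ = 0) (hψ : E.toFun A ψ = ψ) :
    inner ℂ (φ : H) (T ψ) + inner ℂ (ψ : H) (T φ) = 0 := by
  have h := hT.inner_apply (φ + ψ)
  rw [Submodule.coe_add, E.scalar_add_of_apply_eq hA hφ hψ,
    integral_add_measure (hT.integrable_id φ) (hT.integrable_id ψ), LinearPMap.map_add,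
    inner_add_left, inner_add_right, inner_add_right, hT.inner_apply, hT.inner_apply] at h
  push_cast at h
  linear_combination h

/-- Replacing `ψ` by `iψ` in the vanishing sum of the two cross terms separates them. -/
theorem IsSpectralMeasureOf.inner_eq_zero (hT : E.IsSpectralMeasureOf T) {A : Set ℝ}
    (hA : MeasurableSet A)
    {φ ψ : T.domain} (hφ : E.toFun A φ = 0) (hψ : E.toFun A ψ = ψ) :
    inner ℂ (φ : H) (T ψ) = 0 := by
  have h1 := hT.inner_add_inner_eq_zero hA hφ hψ
  have h2 := hT.inner_add_inner_eq_zero (ψ := Complex.I • ψ) hA hφ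
    (by rw [Submodule.coe_smul, map_smul, hψ])
  rw [LinearPMap.map_smul, Submodule.coe_smul, inner_smul_right, inner_smul_left,
    Complex.conj_I] at h2
  have h3 : (2 : ℂ) * inner ℂ (φ : H) (T ψ) = 0 := by
    linear_combination h1 - Complex.I * h2 + (inner ℂ (φ : H) (T ψ) -
      inner ℂ (ψ : H) (T φ)) * Complex.I_mul_I
  simpa using h3

/-- It suffices to test against `φ - E(I)φ` with `φ` in the dense domain. This vector stays in the
domain because the interval `I` is bounded. -/
theorem IsSpectralMeasureOf.apply_map_eq (hT : E.IsSpectralMeasureOf T)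
    (hdense : Dense (T.domain : Set H)) {ψ : T.domain}
    (hψ : E.toFun (Set.Icc (c - r) (c + r)) ψ = ψ) :
    E.toFun (Set.Icc (c - r) (c + r)) (T ψ) = T ψ := by
  set I := Set.Icc (c - r) (c + r)
  have hI : MeasurableSet I := measurableSet_Icc
  rw [← sub_eq_zero]
  refine hdense.eq_zero_of_inner_right ℂ fun φ hφ => ?_
  have hmem : φ - E.toFun I φ ∈ T.domain :=
    T.domain.sub_mem hφ (hT.mem_domain_of_apply_eq_self (E.apply_apply_self hI φ))
  have h := hT.inner_eq_zero hI (φ := ⟨_, hmem⟩) (ψ := ψ)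
    (by change E.toFun I (φ - E.toFun I φ) = 0; rw [map_sub, E.apply_apply_self hI, sub_self]) hψ
  change inner ℂ (φ - E.toFun I φ) (T ψ) = 0 at h
  rw [inner_sub_right, ← E.inner_apply_left hI, ← neg_sub, ← inner_sub_left, h, neg_zero]

/-- The scalar measure of `ψ` is carried by the interval, where `|x - c| ≤ r`. So the numerical
radius of `T - c` on this spectral subspace is at most `r`. -/
theorem IsSpectralMeasureOf.inner_sub_eq (hT : E.IsSpectralMeasureOf T) {ψ : T.domain}
    (hψ : E.toFun (Set.Icc (c - r) (c + r)) ψ = ψ) :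
    ∃ t : ℝ, inner ℂ (ψ : H) (T ψ - (c : ℂ) • (ψ : H)) = t ∧ |t| ≤ r * ‖(ψ : H)‖ ^ 2 := by
  have hmass : (E.scalar (ψ : H)).real Set.univ = ‖(ψ : H)‖ ^ 2 := by
    rw [E.scalar_real_eq MeasurableSet.univ, E.map_univ]; rfl
  refine ⟨∫ x, (x - c) ∂(E.scalar (ψ : H)), ?_, ?_⟩
  · rw [integral_sub (hT.integrable_id ψ) (integrable_const c), integral_const, hmass,
      inner_sub_right, hT.inner_apply, inner_smul_right, inner_self_eq_norm_sq_to_K]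
    simp [mul_comm]
  · rw [← hmass, ← Real.norm_eq_abs]
    refine norm_integral_le_of_norm_le_const ?_
    filter_upwards [E.ae_mem_of_apply_eq_self measurableSet_Icc hψ] with x hx
    rw [Real.norm_eq_abs, abs_le]
    exact ⟨by linarith [hx.1], by linarith [hx.2]⟩

end Operator

end ProjValuedMeasure

/-! ### Numerical radius and norm -/

section NumericalRadius

variable {V : Type*} [NormedAddCommGroup V] [InnerProductSpace ℂ V]

/-- A symmetric operator is bounded by its numerical radius. -/
theorem LinearMap.norm_le_of_inner_self_le (S : V →ₗ[ℂ] V) {r : ℝ}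
    (h : ∀ x, ∃ t : ℝ, inner ℂ x (S x) = t ∧ |t| ≤ r * ‖x‖ ^ 2) (x : V) :
    ‖S x‖ ≤ r * ‖x‖ := by
  have hsymm : S.IsSymmetric := by
    rw [LinearMap.isSymmetric_iff_inner_map_self_real]
    intro v
    obtain ⟨t, ht, -⟩ := h v
    rw [inner_conj_symm, ← inner_conj_symm (S v), ht, Complex.conj_ofReal]
  -- The left side is the difference of the quadratic form at `x + y` and `x - y`. The right side
  -- comes from the parallelogram law.
  have key : ∀ x y, 4 * (inner ℂ (S x) y : ℂ).re ≤ 2 * r * (‖x‖ ^ 2 + ‖y‖ ^ 2) := by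
    intro x y
    obtain ⟨t, ht, ht'⟩ := h (x + y)
    obtain ⟨s, hs, hs'⟩ := h (x - y)
    have h1 : (inner ℂ x (S y) : ℂ).re = (inner ℂ (S x) y : ℂ).re := by rw [hsymm x y]
    have h2 : (inner ℂ y (S x) : ℂ).re = (inner ℂ (S x) y : ℂ).re := by
      rw [← inner_conj_symm, Complex.conj_re]
    have e1 := congrArg Complex.re ht
    have e2 := congrArg Complex.re hs
    rw [map_add, inner_add_left, inner_add_right, inner_add_right] at e1
    rw [map_sub, inner_sub_left, inner_sub_right, inner_sub_right] at e2
    simp only [Complex.add_re, Complex.sub_re, Complex.ofReal_re, h1, h2] at e1 e2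
    have h5 := parallelogram_law_with_norm ℂ x y
    have h6 := le_abs_self t
    have h7 := neg_abs_le s
    have h8 : r * ‖x + y‖ ^ 2 + r * ‖x - y‖ ^ 2 = 2 * r * (‖x‖ ^ 2 + ‖y‖ ^ 2) := by
      rw [← mul_add, h5]; ring
    linarith
  rcases eq_or_ne (S x) 0 with h0 | h0
  · rw [h0, norm_zero]
    rcases eq_or_ne x 0 with rfl | hx
    · simp
    · obtain ⟨t, -, ht⟩ := h x
      have hx' : 0 < ‖x‖ := norm_pos_iff.mpr hx
      have : 0 ≤ r * ‖x‖ * ‖x‖ := by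
        have := (abs_nonneg t).trans ht
        nlinarith
      exact nonneg_of_mul_nonneg_left this hx'
  · have hS : 0 < ‖S x‖ := norm_pos_iff.mpr h0
    have hx : 0 < ‖x‖ := norm_pos_iff.mpr fun hx => h0 (by rw [hx, map_zero])
    -- The multiple of `S x` of norm `‖x‖` balances the two squares.
    have h1 := key x (((‖x‖ / ‖S x‖ : ℝ) : ℂ) • S x)
    rw [inner_smul_right, inner_self_eq_norm_sq_to_K, norm_smul, Complex.norm_real,
      Real.norm_of_nonneg (by positivity), div_mul_cancel₀ _ hS.ne'] at h1
    have h2 : (((‖x‖ / ‖S x‖ : ℝ) : ℂ) * ((‖S x‖ : ℝ) : ℂ) ^ 2).re = ‖x‖ * ‖S x‖ := by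
      rw [← Complex.ofReal_pow, ← Complex.ofReal_mul, Complex.ofReal_re]
      field_simp
    have h3 : 4 * (‖x‖ * ‖S x‖) ≤ 2 * r * (‖x‖ ^ 2 + ‖x‖ ^ 2) := by rw [← h2]; exact h1
    have h4 : ‖x‖ * ‖S x‖ ≤ ‖x‖ * (r * ‖x‖) := by nlinarith
    exact le_of_mul_le_mul_left h4 hx

end NumericalRadius

/-! ### Uniqueness of the spectral measure -/

section Uniqueness

variable {μ : Measure ℝ} {H : Type*} [NormedAddCommGroup H] [InnerProductSpace ℂ H]
  [CompleteSpace H] {Φ : H →ₗᵢ[ℂ] Lp ℂ 2 μ} {T : H →ₗ.[ℂ] H} {E E₀ : ProjValuedMeasure H}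

/-- The range of a spectral projection of a compact interval consists of vectors that are
represented by functions supported in this interval. -/
theorem ProjValuedMeasure.IsSpectralMeasureOf.apply_eq_self_of_apply_eq_self
    (hT : E.IsSpectralMeasureOf T) (hdense : Dense (T.domain : Set H))
    (hmul : ∀ ψ : T.domain, Φ (T ψ) =ᵐ[μ] fun x => (x : ℂ) * Φ ψ x)
    (hE₀ : ∀ A, MeasurableSet A → ∀ ψ, Φ (E₀.toFun A ψ) =ᵐ[μ] A.indicator (Φ ψ))
    {c r : ℝ} (hr : 0 ≤ r) {ψ : H} (hψ : E.toFun (Set.Icc (c - r) (c + r)) ψ = ψ) :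
    E₀.toFun (Set.Icc (c - r) (c + r)) ψ = ψ := by
  set I := Set.Icc (c - r) (c + r) with hI
  have hIm : MeasurableSet I := measurableSet_Icc
  set V : Submodule ℂ H := LinearMap.eqLocus (E.toFun I : H →ₗ[ℂ] H) LinearMap.id with hV
  have hVmem : ∀ v : V, E.toFun I (v : H) = v := fun v => v.2
  have hVdom : ∀ v : V, (v : H) ∈ T.domain := fun v => hT.mem_domain_of_apply_eq_self (hVmem v)
  -- The restriction of `T - c` to the range of `E(I)`, which `T` maps into itself.
  set S : V →ₗ[ℂ] V :=
    { toFun := fun v => ⟨T ⟨v, hVdom v⟩ - (c : ℂ) • (v : H), by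
        change E.toFun I (T ⟨v, hVdom v⟩ - (c : ℂ) • (v : H)) = _
        rw [map_sub, map_smul, hVmem, hT.apply_map_eq hdense (ψ := ⟨v, hVdom v⟩) (hVmem v)]
        rfl⟩
      map_add' := fun v w => Subtype.ext (by
        have h : T ⟨((v + w : V) : H), hVdom (v + w)⟩ = T ⟨v, hVdom v⟩ + T ⟨w, hVdom w⟩ := by
          rw [← LinearPMap.map_add]; rfl
        change T ⟨((v + w : V) : H), hVdom (v + w)⟩ - (c : ℂ) • ((v : H) + w) =
          (T ⟨v, hVdom v⟩ - (c : ℂ) • (v : H)) + (T ⟨w, hVdom w⟩ - (c : ℂ) • (w : H))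
        rw [h, smul_add]; abel)
      map_smul' := fun a v => Subtype.ext (by
        have h : T ⟨((a • v : V) : H), hVdom (a • v)⟩ = a • T ⟨v, hVdom v⟩ := by
          rw [← LinearPMap.map_smul]; rfl
        change T ⟨((a • v : V) : H), hVdom (a • v)⟩ - (c : ℂ) • (a • (v : H)) =
          a • (T ⟨v, hVdom v⟩ - (c : ℂ) • (v : H))
        rw [h, smul_sub, smul_comm]) } with hS
  have hSn : ∀ v, ‖S v‖ ≤ r * ‖v‖ := S.norm_le_of_inner_self_le fun v =>
    hT.inner_sub_eq (ψ := ⟨v, hVdom v⟩) (hVmem v)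
  have hSΦ : ∀ v, Φ (S v : H) =ᵐ[μ] fun x => ((x : ℂ) - c) * Φ v x := by
    intro v
    have h : Φ (S v : H) = Φ (T ⟨v, hVdom v⟩) - (c : ℂ) • Φ v := by
      rw [← map_smul, ← map_sub]; rfl
    rw [h]
    filter_upwards [hmul ⟨v, hVdom v⟩, Lp.coeFn_sub (Φ (T ⟨v, hVdom v⟩)) ((c : ℂ) • Φ v),
      Lp.coeFn_smul (c : ℂ) (Φ v)] with x h1 h2 h3
    rw [h2, Pi.sub_apply, h1, h3, Pi.smul_apply, smul_eq_mul, sub_mul]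
  set v₀ : V := ⟨ψ, hψ⟩
  have hpow : ∀ k : ℕ, ‖(S ^ k) v₀‖ ≤ r ^ k * ‖v₀‖ ∧
      Φ ((S ^ k) v₀ : H) =ᵐ[μ] fun x => ((x : ℂ) - c) ^ k * Φ ψ x := by
    intro k
    induction k with
    | zero => exact ⟨by simp, by simp [v₀]⟩
    | succ k ih =>
      have e : (S ^ (k + 1)) v₀ = S ((S ^ k) v₀) := by rw [pow_succ']; rfl
      rw [e]
      constructor
      · refine (hSn _).trans ?_
        rw [pow_succ', mul_assoc]
        gcongr
        exact ih.1
      · filter_upwards [hSΦ ((S ^ k) v₀), ih.2] with x h1 h2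
        rw [h1, h2, pow_succ', mul_assoc]
  -- These sets exhaust the complement of `I`. On `A n` one has `|x - c| ≥ d > r`, so the mass of
  -- `Φψ` there is controlled by `d^{-k} ‖S^k ψ‖ ≤ (r/d)^k ‖ψ‖` for every `k`.
  set A : ℕ → Set ℝ := fun n => {x | r + 1 / ((n : ℝ) + 1) ≤ |x - c|} with hA
  have hAm : ∀ n, MeasurableSet (A n) := fun n => measurableSet_le (by fun_prop) (by fun_prop)
  have hzero : ∀ n, E₀.toFun (A n) ψ = 0 := by
    intro n
    set d : ℝ := r + 1 / ((n : ℝ) + 1)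
    have hrd : r < d := by simp only [d]; linarith [show 0 < 1 / ((n : ℝ) + 1) by positivity]
    have hd : 0 < d := hr.trans_lt hrd
    have hle : ∀ k : ℕ, ‖E₀.toFun (A n) ψ‖ ≤ (r / d) ^ k * ‖ψ‖ := by
      intro k
      have h1 : ‖Φ (E₀.toFun (A n) ψ)‖ ≤ (d⁻¹) ^ k * ‖Φ ((S ^ k) v₀ : H)‖ := by
        refine Lp.norm_le_mul_norm_of_ae_le_mul ?_
        filter_upwards [hE₀ _ (hAm n) ψ, (hpow k).2] with x h1 h2
        rw [h1, h2]
        by_cases hx : x ∈ A n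
        · rw [Set.indicator_of_mem hx, norm_mul, norm_pow, ← Complex.ofReal_sub, Complex.norm_real,
            Real.norm_eq_abs, ← mul_assoc, ← mul_pow]
          refine le_mul_of_one_le_left (norm_nonneg _) (one_le_pow₀ ?_)
          have hx' : d ≤ |x - c| := hx
          calc (1 : ℝ) = d⁻¹ * d := (inv_mul_cancel₀ hd.ne').symm
            _ ≤ _ := by gcongr
        · rw [Set.indicator_of_notMem hx, norm_zero]
          positivity
      rw [Φ.norm_map, Φ.norm_map] at h1
      refine h1.trans ?_
      rw [div_eq_mul_inv, mul_comm r, mul_pow, mul_assoc]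
      gcongr
      exact (hpow k).1
    have hlim : Tendsto (fun k : ℕ => (r / d) ^ k * ‖ψ‖) atTop (𝓝 0) := by
      have := (tendsto_pow_atTop_nhds_zero_of_lt_one (r := r / d) (by positivity)
        ((div_lt_one hd).mpr hrd)).mul_const ‖ψ‖
      rwa [zero_mul] at this
    exact norm_le_zero_iff.mp (ge_of_tendsto' hlim hle)
  have hcompl : E₀.toFun Iᶜ ψ = 0 := by
    rw [← E₀.scalar_eq_zero_iff hIm.compl]
    refine measure_mono_null (t := ⋃ n, A n) (fun x hx => ?_)
      (measure_iUnion_null fun n => (E₀.scalar_eq_zero_iff (hAm n) ψ).mpr (hzero n))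
    have hx' : r < |x - c| := by
      by_contra hcon
      rw [not_lt, abs_le] at hcon
      exact hx ⟨by linarith [hcon.1], by linarith [hcon.2]⟩
    obtain ⟨n, hn⟩ := exists_nat_one_div_lt (sub_pos.mpr hx')
    refine Set.mem_iUnion.mpr ⟨n, ?_⟩
    change r + 1 / ((n : ℝ) + 1) ≤ |x - c|
    linarith
  have := E₀.apply_compl hIm ψ
  rwa [hcompl, add_zero] at this

/-- Inclusion of the ranges gives `E₀(I) E(I) = E(I)`. Taking adjoints, `E(I) E₀(I) = E(I)`, so
`‖E(I)ψ‖ ≤ ‖E₀(I)ψ‖`. -/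
theorem ProjValuedMeasure.IsSpectralMeasureOf.scalar_Icc_le
    (hT : E.IsSpectralMeasureOf T) (hdense : Dense (T.domain : Set H))
    (hmul : ∀ ψ : T.domain, Φ (T ψ) =ᵐ[μ] fun x => (x : ℂ) * Φ ψ x)
    (hE₀ : ∀ A, MeasurableSet A → ∀ ψ, Φ (E₀.toFun A ψ) =ᵐ[μ] A.indicator (Φ ψ))
    (a b : ℝ) (ψ : H) : E.scalar ψ (Set.Icc a b) ≤ E₀.scalar ψ (Set.Icc a b) := by
  rcases lt_or_ge b a with hab | hab
  · simp [Set.Icc_eq_empty_of_lt hab]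
  obtain ⟨c, r, hr, rfl, rfl⟩ : ∃ c r : ℝ, 0 ≤ r ∧ a = c - r ∧ b = c + r :=
    ⟨(a + b) / 2, (b - a) / 2, by linarith, by ring, by ring⟩
  set I := Set.Icc (c - r) (c + r)
  have hI : MeasurableSet I := measurableSet_Icc
  have h1 : ∀ φ, E₀.toFun I (E.toFun I φ) = E.toFun I φ := fun φ =>
    hT.apply_eq_self_of_apply_eq_self hdense hmul hE₀ hr (E.apply_apply_self hI φ)
  have h2 : E.toFun I (E₀.toFun I ψ) = E.toFun I ψ := by
    refine ext_inner_left ℂ fun φ => ?_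
    rw [← E.inner_apply_left hI, ← E₀.inner_apply_left hI, h1, E.inner_apply_left hI]
  rw [E.scalar_apply_eq_norm_sq hI, E₀.scalar_apply_eq_norm_sq hI, ← h2]
  refine ENNReal.ofReal_le_ofReal ?_
  gcongr
  exact E.norm_apply_le hI _

/-- The spectral measure is unique. -/
theorem ProjValuedMeasure.IsSpectralMeasureOf.toFun_eq
    (hT : E.IsSpectralMeasureOf T) (hdense : Dense (T.domain : Set H))
    (hmul : ∀ ψ : T.domain, Φ (T ψ) =ᵐ[μ] fun x => (x : ℂ) * Φ ψ x)
    (hE₀ : ∀ A, MeasurableSet A → ∀ ψ, Φ (E₀.toFun A ψ) =ᵐ[μ] A.indicator (Φ ψ))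
    {A : Set ℝ} (hA : MeasurableSet A) : E.toFun A = E₀.toFun A := by
  refine ProjValuedMeasure.ext_of_scalar (fun ψ => ?_) hA
  have hIcc := fun a b => hT.scalar_Icc_le hdense hmul hE₀ a b ψ
  have hUnion : ∀ s : ℕ → Set ℝ, Monotone s → (∀ n, E.scalar ψ (s n) ≤ E₀.scalar ψ (s n)) →
      E.scalar ψ (⋃ n, s n) ≤ E₀.scalar ψ (⋃ n, s n) := by
    intro s hs h
    rw [hs.measure_iUnion, hs.measure_iUnion]
    exact iSup_mono h
  have hIic : ∀ b, E.scalar ψ (Set.Iic b) ≤ E₀.scalar ψ (Set.Iic b) := by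
    intro b
    have e : Set.Iic b = ⋃ n : ℕ, Set.Icc (b - n) b := by
      ext x
      simp only [Set.mem_Iic, Set.mem_iUnion, Set.mem_Icc]
      refine ⟨fun hx => ?_, fun ⟨_, h⟩ => h.2⟩
      obtain ⟨n, hn⟩ := exists_nat_ge (b - x)
      exact ⟨n, by linarith, hx⟩
    rw [e]
    refine hUnion _ (fun m n hmn => Set.Icc_subset_Icc ?_ le_rfl) fun n => hIcc _ _
    have : (m : ℝ) ≤ n := by exact_mod_cast hmn
    linarith
  have hIoi : ∀ b, E.scalar ψ (Set.Ioi b) ≤ E₀.scalar ψ (Set.Ioi b) := by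
    intro b
    have e : Set.Ioi b = ⋃ n : ℕ, Set.Icc (b + 1 / ((n : ℝ) + 1)) (b + n) := by
      ext x
      simp only [Set.mem_Ioi, Set.mem_iUnion, Set.mem_Icc]
      constructor
      · intro hx
        obtain ⟨n, hn⟩ := exists_nat_ge (x - b)
        obtain ⟨m, hm⟩ := exists_nat_one_div_lt (sub_pos.mpr hx)
        refine ⟨max m n, ?_, ?_⟩
        · have h1 : 1 / (((max m n : ℕ) : ℝ) + 1) ≤ 1 / ((m : ℝ) + 1) :=
            one_div_le_one_div_of_le (by positivity) (by gcongr; exact le_max_left m n)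
          linarith
        · have h1 : (n : ℝ) ≤ (max m n : ℕ) := by exact_mod_cast le_max_right m n
          linarith
      · rintro ⟨n, h1, -⟩
        have : 0 < 1 / ((n : ℝ) + 1) := by positivity
        linarith
    rw [e]
    refine hUnion _ (fun m n hmn => Set.Icc_subset_Icc ?_ ?_) fun n => hIcc _ _
    · gcongr
    · gcongr
  -- Both measures have total mass `‖ψ‖²`, so the inequality on `Ioi b` is the reverse inequality on
  -- `Iic b`.
  refine Measure.ext_of_Iic _ _ fun b => le_antisymm (hIic b) ?_
  have hsum : ∀ F : ProjValuedMeasure H,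
      F.scalar ψ (Set.Iic b) + F.scalar ψ (Set.Ioi b) = ENNReal.ofReal (‖ψ‖ ^ 2) := by
    intro F
    rw [← Set.compl_Iic, measure_add_measure_compl measurableSet_Iic, F.scalar_univ]
  have h := (hsum E₀).trans (hsum E).symm
  have h1 : E₀.scalar ψ (Set.Iic b) + E₀.scalar ψ (Set.Ioi b) ≤
      E.scalar ψ (Set.Iic b) + E₀.scalar ψ (Set.Ioi b) := by
    rw [h]; exact add_le_add le_rfl (hIoi b)
  exact (ENNReal.add_le_add_iff_right (measure_ne_top _ _)).mp h1

end Uniqueness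

/-! ### From orthonormal generalized eigenfunctions to the spectral measure of `B` -/

section Representation

variable {q α : ℝ} {μ : Measure ℝ}

theorem schrodingerB_stdBasis (n : ℤ) :
    schrodingerB q α ⟨stdBasis n, stdBasis_mem_domain n⟩ =
      stdBasis (n + 1) + ((α : ℂ) * (q : ℂ) ^ (-n)) • stdBasis n + stdBasis (n - 1) := by
  ext m
  rw [schrodingerB_apply]
  simp only [lp.coeFn_add, lp.coeFn_smul, Pi.add_apply, Pi.smul_apply, smul_eq_mul, stdBasis_apply]
  have e1 : m + -1 = n ↔ m = n + 1 := by omega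
  have e2 : m + 1 = n ↔ m = n - 1 := by omega
  simp only [e1, e2]
  by_cases h : m = n
  · subst h; simp
  · simp [h]

theorem hasSum_smul_stdBasis (ψ : EllTwo) : HasSum (fun n => ψ n • stdBasis n) ψ := by
  have h := lp.hasSum_single (p := 2) (by norm_num) ψ
  convert h using 2 with n
  rw [stdBasis, ← lp.single_smul, smul_eq_mul, mul_one]

theorem hasSum_smul_stdBasis_shift (c : ℤ) (ψ : EllTwo) :
    HasSum (fun n => ψ n • stdBasis (n - c)) (shiftSeq c ψ) := by
  rw [← (Equiv.addRight c).hasSum_iff]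
  convert hasSum_smul_stdBasis (shiftSeq c ψ) using 2 with n
  simp [shiftSeq_apply]

/-- The two shifts and the potential term converge separately. So finitely supported sequences are a
core, and identities on the basis extend to the domain. -/
theorem hasSum_schrodingerB (ψ : (schrodingerB q α).domain) :
    HasSum (fun n => (ψ : EllTwo) n • schrodingerB q α ⟨stdBasis n, stdBasis_mem_domain n⟩)
      (schrodingerB q α ψ) := by
  have h1 := hasSum_smul_stdBasis_shift (-1) (ψ : EllTwo)
  have h2 := hasSum_smul_stdBasis_shift 1 (ψ : EllTwo)
  have h3 := (hasSum_smul_stdBasis ⟨_, mem_schrodingerB_domain.mp ψ.2⟩).const_smul (α : ℂ)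
  have e : schrodingerB q α ψ = shiftSeq (-1) (ψ : EllTwo) +
      (α : ℂ) • ⟨_, mem_schrodingerB_domain.mp ψ.2⟩ + shiftSeq 1 (ψ : EllTwo) := rfl
  rw [e]
  convert (h1.add h3).add h2 using 2 with n
  change _ = (ψ : EllTwo) n • stdBasis (n - -1) +
    (α : ℂ) • ((q : ℂ) ^ (-n) * (ψ : EllTwo) n) • stdBasis n + (ψ : EllTwo) n • stdBasis (n - 1)
  rw [schrodingerB_stdBasis, smul_add, smul_add, sub_neg_eq_add, smul_smul, smul_smul]
  congr 3
  ring

theorem dense_schrodingerB_domain : Dense ((schrodingerB q α).domain : Set EllTwo) := by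
  intro ψ
  refine mem_closure_of_tendsto (hasSum_smul_stdBasis ψ) (Eventually.of_forall fun s => ?_)
  exact Submodule.sum_mem _ fun n _ => Submodule.smul_mem _ _ (stdBasis_mem_domain n)

/-- If `Φ` maps the action of `B` on basis vectors to the multiplication by `x`, then it does so
on the whole domain. -/
theorem LinearIsometry.schrodingerB_eq_mul {Φ : EllTwo →ₗᵢ[ℂ] Lp ℂ 2 μ}
    (hΦ : ∀ n, Φ (schrodingerB q α ⟨stdBasis n, stdBasis_mem_domain n⟩) =ᵐ[μ]
      fun x => (x : ℂ) * Φ (stdBasis n) x) (ψ : (schrodingerB q α).domain) :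
    Φ (schrodingerB q α ψ) =ᵐ[μ] fun x => (x : ℂ) * Φ ψ x := by
  -- Multiplication by `x` is not bounded in general. The equivalent identity `(x - i)⁻¹ Φ((B - i)ψ)
  -- = Φψ` involves only bounded operators and passes to the limit of the basis expansion.
  obtain ⟨M, hM, -⟩ := exists_mul_lp (μ := μ) (g := fun x : ℝ => ((x : ℂ) - Complex.I)⁻¹)
    (measurable_inv_ofReal_sub _) (C := |Complex.I.im|⁻¹) (norm_inv_ofReal_sub_le (by simp))
  have hne : ∀ x : ℝ, (x : ℂ) - Complex.I ≠ 0 := ofReal_sub_ne_zero (by simp)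
  have hb : ∀ n, M (Φ (schrodingerB q α ⟨stdBasis n, stdBasis_mem_domain n⟩) -
      Complex.I • Φ (stdBasis n)) = Φ (stdBasis n) := by
    intro n
    set f := Φ (schrodingerB q α ⟨stdBasis n, stdBasis_mem_domain n⟩) with hf
    refine Lp.ext ?_
    filter_upwards [hM (f - Complex.I • Φ (stdBasis n)), hΦ n, Lp.coeFn_sub f
      (Complex.I • Φ (stdBasis n)), Lp.coeFn_smul Complex.I (Φ (stdBasis n))] with x h1 h2 h3 h4
    rw [h1, h3, Pi.sub_apply, h2, h4, Pi.smul_apply, smul_eq_mul, ← sub_mul, ← mul_assoc,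
      inv_mul_cancel₀ (hne x), one_mul]
  have hs1 : HasSum (fun n => (ψ : EllTwo) n • Φ (stdBasis n)) (Φ ψ) := by
    have := (hasSum_smul_stdBasis (ψ : EllTwo)).mapL Φ.toContinuousLinearMap
    simpa using this
  have hs2 : HasSum (fun n => (ψ : EllTwo) n • Φ (stdBasis n))
      (M (Φ (schrodingerB q α ψ) - Complex.I • Φ ψ)) := by
    have h1 : HasSum (fun n => Φ ((ψ : EllTwo) n •
        schrodingerB q α ⟨stdBasis n, stdBasis_mem_domain n⟩)) (Φ (schrodingerB q α ψ)) :=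
      (hasSum_schrodingerB ψ).mapL Φ.toContinuousLinearMap
    have h2 := ((h1.sub (hs1.const_smul Complex.I))).mapL M
    convert h2 using 2 with n
    rw [map_smul, smul_comm Complex.I, ← smul_sub, map_smul, hb]
  have h := hs2.unique hs1
  filter_upwards [hM (Φ (schrodingerB q α ψ) - Complex.I • Φ ψ),
    Lp.coeFn_sub (Φ (schrodingerB q α ψ)) (Complex.I • Φ ψ), Lp.coeFn_smul Complex.I (Φ ψ)]
    with x h1 h2 h3
  rw [h, h2, Pi.sub_apply, h3, Pi.smul_apply, smul_eq_mul, eq_inv_mul_iff_mul_eq₀ (hne x)] at h1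
  linear_combination -h1

/-- An orthonormal sequence of generalized eigenfunctions of `B` determines the spectral measure. -/
theorem schrodingerB_spectralMeasure [SFinite μ] (hα : α ≠ 0) {F : ℤ → ℝ → ℂ}
    (hF : ∀ n, MemLp (F n) 2 μ)
    (horth : ∀ k l, ∫ x, inner ℂ (F k x) (F l x) ∂μ = if k = l then 1 else 0)
    (hrec : ∀ n, ∀ᵐ x ∂μ, F (n - 1) x + (α : ℂ) * (q : ℂ) ^ (-n) * F n x + F (n + 1) x =
      (x : ℂ) * F n x) :
    (∃ E : ProjValuedMeasure EllTwo, E.IsSpectralMeasureOf (schrodingerB q α)) ∧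
    ∀ E : ProjValuedMeasure EllTwo, E.IsSpectralMeasureOf (schrodingerB q α) →
      ∀ A : Set ℝ, MeasurableSet A → ∀ k l : ℤ,
        inner ℂ (stdBasis k) (E.toFun A (stdBasis l)) = ∫ x in A, inner ℂ (F k x) (F l x) ∂μ := by
  have hcoe : ∀ n, (hF n).toLp =ᵐ[μ] F n := fun n => (hF n).coeFn_toLp
  have hon : Orthonormal ℂ fun n => (hF n).toLp := by
    rw [orthonormal_iff_ite]
    intro k l
    rw [L2.inner_def, ← horth k l]
    refine integral_congr_ae ?_
    filter_upwards [hcoe k, hcoe l] with x h1 h2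
    rw [h1, h2]
  set Φ : EllTwo →ₗᵢ[ℂ] Lp ℂ 2 μ := hon.orthogonalFamily.linearIsometry with hΦdef
  have hΦ : ∀ n, Φ (stdBasis n) = (hF n).toLp := by
    intro n
    rw [hΦdef, stdBasis, OrthogonalFamily.linearIsometry_apply_single]
    simp
  have hmul := Φ.schrodingerB_eq_mul (q := q) (α := α) fun n => by
    rw [schrodingerB_stdBasis, map_add, map_add, map_smul, hΦ, hΦ, hΦ]
    set c := (α : ℂ) * (q : ℂ) ^ (-n) with hc
    filter_upwards [Lp.coeFn_add ((hF (n + 1)).toLp + c • (hF n).toLp) (hF (n - 1)).toLp,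
      Lp.coeFn_add (hF (n + 1)).toLp (c • (hF n).toLp), Lp.coeFn_smul c (hF n).toLp,
      hcoe n, hcoe (n + 1), hcoe (n - 1), hrec n] with x h1 h2 h3 h4 h5 h6 h7
    rw [h1, Pi.add_apply, h2, Pi.add_apply, h3, Pi.smul_apply, smul_eq_mul, h4, h5, h6, ← h7]
    ring
  have hsurj := fun (z : ℂ) (hz : z.im ≠ 0) (η : EllTwo) =>
    schrodingerB_sub_surjective hα (fun z hz ψ => Φ.norm_le_of_mul hmul hz ψ) hz η
  obtain ⟨E₀, hE₀⟩ := Φ.exists_projValuedMeasure hmul hsurj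
  refine ⟨⟨E₀, Φ.isSpectralMeasureOf hmul hsurj hE₀⟩, fun E hE A hA k l => ?_⟩
  rw [hE.toFun_eq dense_schrodingerB_domain hmul hE₀ hA,
    Φ.inner_indicator_projection hA (hE₀ A hA)]
  refine integral_congr_ae (ae_restrict_of_ae ?_)
  rw [hΦ, hΦ]
  filter_upwards [hcoe k, hcoe l] with x h1 h2
  rw [h1, h2]

end Representation

/-! ### The spectral parameter `x = z + z⁻¹` and the measure of the formula -/

section SpectralRepresentation

open Real

/-- The inverse of `z ↦ z + z⁻¹` from the real line to the union of the upper unit semicircle and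
the punctured interval `(-1, 1)`. -/
noncomputable def joukowskiInv (x : ℝ) : ℂ :=
  if |x| ≤ 2 then Complex.exp (Complex.I * (arccos (x / 2) : ℝ))
  else ((x * (1 - √(1 - 4 / x ^ 2)) / 2 : ℝ) : ℂ)

theorem measurable_joukowskiInv : Measurable joukowskiInv := by
  refine Measurable.ite (measurableSet_le (by fun_prop) (by fun_prop)) ?_ ?_
  · have : Measurable fun x : ℝ => arccos (x / 2) := measurable_arccos.comp (by fun_prop)
    fun_prop
  · fun_prop

theorem joukowskiInv_two_mul_cos {φ : ℝ} (hφ : φ ∈ Set.Icc 0 π) :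
    joukowskiInv (2 * cos φ) = Complex.exp (Complex.I * φ) := by
  have h : |2 * cos φ| ≤ 2 := by
    rw [abs_mul, abs_two]
    linarith [abs_cos_le_one φ]
  rw [joukowskiInv, if_pos h, mul_div_cancel_left₀ _ two_ne_zero, arccos_cos hφ.1 hφ.2]

theorem joukowskiInv_add_inv {p : ℝ} (hp : p ≠ 0) (hp1 : |p| < 1) :
    joukowskiInv (p + p⁻¹) = p := by
  have hsq : p ^ 2 < 1 := by rw [← sq_abs]; nlinarith [abs_nonneg p]
  have hx : p + p⁻¹ = (1 + p ^ 2) / p := by field_simp; ring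
  have h : ¬ |p + p⁻¹| ≤ 2 := by
    rw [hx, abs_div, div_le_iff₀ (abs_pos.mpr hp), abs_of_pos (by positivity), ← sq_abs]
    nlinarith
  have hs : √(1 - 4 / (p + p⁻¹) ^ 2) = (1 - p ^ 2) / (1 + p ^ 2) := by
    rw [← sqrt_sq (div_nonneg (by linarith) (by positivity) : 0 ≤ (1 - p ^ 2) / (1 + p ^ 2)), hx]
    congr 1
    field_simp
    ring
  rw [joukowskiInv, if_neg h, hs, hx]
  congr 1
  field_simp
  ring

/-- This holds at every real `x`, so the recurrence for `spectralFn` is valid pointwise and not only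
on the support of the measure. -/
theorem joukowskiInv_ne_zero_and_add_inv (x : ℝ) :
    joukowskiInv x ≠ 0 ∧ joukowskiInv x + (joukowskiInv x)⁻¹ = x := by
  rw [joukowskiInv]
  split_ifs with h
  · refine ⟨Complex.exp_ne_zero _, ?_⟩
    rw [abs_le] at h
    rw [← Complex.exp_neg, mul_comm Complex.I, ← neg_mul, ← Complex.two_cos, ← Complex.ofReal_cos,
      cos_arccos (by linarith) (by linarith)]
    push_cast
    ring
  · rw [not_le] at h
    have hx : x ≠ 0 := fun h0 => by norm_num [h0] at h
    have hx2 : 4 < x ^ 2 := by rw [← sq_abs]; nlinarith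
    have hs : √(1 - 4 / x ^ 2) ^ 2 = 1 - 4 / x ^ 2 :=
      sq_sqrt (sub_nonneg.mpr ((div_le_one (by positivity)).mpr hx2.le))
    set s := √(1 - 4 / x ^ 2)
    have hprod : x * (1 - s) / 2 * (x * (1 + s) / 2) = 1 := by
      have : x * (1 - s) / 2 * (x * (1 + s) / 2) = x ^ 2 * (1 - s ^ 2) / 4 := by ring
      rw [this, hs]
      field_simp
      ring
    have hne : x * (1 - s) / 2 ≠ 0 := left_ne_zero_of_mul_eq_one hprod
    refine ⟨by exact_mod_cast hne, ?_⟩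
    rw [← Complex.ofReal_inv, ← Complex.ofReal_add, inv_eq_of_mul_eq_one_right hprod]
    congr 1
    ring

variable (q α : ℝ)

/-- The generalized eigenfunctions of `B` as functions of the spectral parameter. -/
noncomputable def spectralFn (n : ℤ) (x : ℝ) : ℂ := solF q α n (joukowskiInv x)

/-- The points of the discrete spectrum of `B`. -/
noncomputable def eigenvalueB (m : ℤ) : ℝ := α⁻¹ * q ^ m + α * q ^ (-m)

/-- The weight of the discrete part, at the `i`-th admissible index. -/
noncomputable def pointMass (i : ℕ) : ℝ :=
  discreteWeight q α (⌊logb q |α|⌋ + 1 + i) / ‖qPochInf (q : ℂ) q‖ ^ 2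

/-- The absolutely continuous part of the spectral measure of `B`. -/
noncomputable def acMeasure : Measure ℝ :=
  ((volume.restrict (Set.Icc 0 π)).withDensity
    fun φ => ENNReal.ofReal (acWeight q α φ / (2 * π))).map fun φ => 2 * cos φ

/-- The discrete part of the spectral measure of `B`. -/
noncomputable def discreteMeasure : Measure ℝ :=
  Measure.sum fun i : ℕ => ENNReal.ofReal (pointMass q α i) •
    Measure.dirac (eigenvalueB q α (⌊logb q |α|⌋ + 1 + i))

instance : SFinite (acMeasure q α) := by unfold acMeasure; infer_instance

instance : SFinite (discreteMeasure q α) := by unfold discreteMeasure; infer_instance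

variable {q α}

theorem measurable_spectralFn (hq0 : 0 < q) (hq1 : q < 1) (n : ℤ) :
    Measurable (spectralFn q α n) := by
  have : Measurable (solF q α n) :=
    measurable_of_continuousOn_compl_singleton 0 fun z hz =>
      (differentiableAt_solF hq0 hq1 n hz).continuousAt.continuousWithinAt
  exact this.comp measurable_joukowskiInv

theorem spectralFn_recurrence (hq0 : 0 < q) (hq1 : q < 1) (hα : α ≠ 0) (n : ℤ) (x : ℝ) :
    spectralFn q α (n - 1) x + (α : ℂ) * (q : ℂ) ^ (-n) * spectralFn q α n x +
      spectralFn q α (n + 1) x = (x : ℂ) * spectralFn q α n x := by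
  obtain ⟨h0, h1⟩ := joukowskiInv_ne_zero_and_add_inv x
  have := solF_recurrence hq0 hq1 hα h0 n
  rwa [h1] at this

theorem measurable_acWeight (hq0 : 0 < q) (hq1 : q < 1) : Measurable (acWeight q α) := by
  have h := (continuous_qPochInf (norm_ofReal_lt_one hq0 hq1)).measurable
  unfold acWeight
  have h1 : Measurable fun φ : ℝ => qPochInf (Complex.exp (2 * Complex.I * φ)) q :=
    h.comp (by fun_prop)
  have h2 : Measurable fun φ : ℝ => qPochInf (α * Complex.exp (Complex.I * φ)) q :=
    h.comp (by fun_prop)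
  have h3 : Measurable fun φ : ℝ => qPochInf (q * (α : ℂ)⁻¹ * Complex.exp (-(Complex.I * φ))) q :=
    h.comp (by fun_prop)
  exact ((h1.div (h2.mul h3)).norm).pow_const 2

theorem ofReal_norm_qPochInf_self_sq (hq0 : 0 < q) (hq1 : q < 1) :
    ((‖qPochInf (q : ℂ) q‖ ^ 2 : ℝ) : ℂ) = qPochInf (q : ℂ) q ^ 2 := by
  rw [Complex.ofReal_pow, ← Complex.conj_mul', conj_qPochInf (norm_ofReal_lt_one hq0 hq1),
    Complex.conj_ofReal, sq]

theorem pointMass_nonneg (hq0 : 0 < q) (hq1 : q < 1) (hα : α ≠ 0) (i : ℕ) :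
    0 ≤ pointMass q α i :=
  div_nonneg (discreteWeight_nonneg hq0 hq1 hα (by omega)) (by positivity)

theorem inner_spectralFn_two_mul_cos (hq0 : 0 < q) (hq1 : q < 1) (k l : ℤ) {φ : ℝ}
    (hφ : φ ∈ Set.Icc 0 π) :
    (acWeight q α φ / (2 * π)) • inner ℂ (spectralFn q α k (2 * cos φ))
      (spectralFn q α l (2 * cos φ)) = 1 / (2 * (π : ℂ)) * acIntegrand q α k l φ := by
  rw [RCLike.inner_apply, spectralFn, spectralFn, joukowskiInv_two_mul_cos hφ,
    conj_solF_exp hq0 hq1, acIntegrand, Complex.real_smul]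
  push_cast
  ring

theorem joukowskiInv_eigenvalueB (hq0 : 0 < q) (hq1 : q < 1) (hα : α ≠ 0) {m : ℤ}
    (hm : ⌊logb q |α|⌋ < m) : joukowskiInv (eigenvalueB q α m) = (α : ℂ)⁻¹ * (q : ℂ) ^ m := by
  have hp : α⁻¹ * q ^ m ≠ 0 := mul_ne_zero (inv_ne_zero hα) (zpow_ne_zero _ hq0.ne')
  have hp1 : |α⁻¹ * q ^ m| < 1 := by
    rw [abs_mul, abs_inv, abs_of_pos (zpow_pos hq0 m), inv_mul_lt_one₀ (abs_pos.mpr hα)]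
    exact zpow_lt_abs_of_floor_lt hq0 hq1 hα hm
  have h := joukowskiInv_add_inv hp hp1
  rw [mul_inv, inv_inv, ← zpow_neg] at h
  rw [eigenvalueB, h]
  push_cast
  rfl

theorem inner_spectralFn_eigenvalueB (hq0 : 0 < q) (hq1 : q < 1) (hα : α ≠ 0) (k l : ℤ) (i : ℕ) :
    pointMass q α i • inner ℂ (spectralFn q α k (eigenvalueB q α (⌊logb q |α|⌋ + 1 + i)))
      (spectralFn q α l (eigenvalueB q α (⌊logb q |α|⌋ + 1 + i))) =
      1 / qPochInf q q ^ 2 * discreteTerm q α k l (⌊logb q |α|⌋ + 1 + i) := by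
  rw [RCLike.inner_apply, spectralFn, spectralFn, joukowskiInv_eigenvalueB hq0 hq1 hα (by omega),
    conj_solF_pole hq0 hq1, discreteTerm_eq, Complex.real_smul, pointMass, Complex.ofReal_div,
    ofReal_norm_qPochInf_self_sq hq0 hq1]
  ring

theorem integrable_acMeasure_iff (hq0 : 0 < q) (hq1 : q < 1) {G : ℝ → ℂ} (hG : Measurable G) :
    Integrable G (acMeasure q α) ↔
      IntegrableOn (fun φ => (acWeight q α φ / (2 * π)) • G (2 * cos φ)) (Set.Icc 0 π) := by
  have hm : Measurable fun φ => ENNReal.ofReal (acWeight q α φ / (2 * π)) :=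
    ((measurable_acWeight hq0 hq1).div_const _).ennreal_ofReal
  have hr : ∀ φ, (ENNReal.ofReal (acWeight q α φ / (2 * π))).toReal = acWeight q α φ / (2 * π) :=
    fun φ => ENNReal.toReal_ofReal (div_nonneg (sq_nonneg _) (by positivity))
  rw [acMeasure, integrable_map_measure hG.aestronglyMeasurable (by fun_prop),
    integrable_withDensity_iff_integrable_smul' hm (ae_of_all _ fun _ => ENNReal.ofReal_lt_top)]
  simp_rw [hr]
  rfl

theorem integral_acMeasure (hq0 : 0 < q) (hq1 : q < 1) {G : ℝ → ℂ} (hG : Measurable G) :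
    ∫ x, G x ∂(acMeasure q α) =
      ∫ φ in Set.Icc 0 π, (acWeight q α φ / (2 * π)) • G (2 * cos φ) := by
  have hm : Measurable fun φ => ENNReal.ofReal (acWeight q α φ / (2 * π)) :=
    ((measurable_acWeight hq0 hq1).div_const _).ennreal_ofReal
  have hr : ∀ φ, (ENNReal.ofReal (acWeight q α φ / (2 * π))).toReal = acWeight q α φ / (2 * π) :=
    fun φ => ENNReal.toReal_ofReal (div_nonneg (sq_nonneg _) (by positivity))
  rw [acMeasure, integral_map (by fun_prop) hG.aestronglyMeasurable,
    integral_withDensity_eq_integral_toReal_smul hm (ae_of_all _ fun _ => ENNReal.ofReal_lt_top)]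
  simp_rw [hr]

theorem integrable_discreteMeasure_iff (hq0 : 0 < q) (hq1 : q < 1) (hα : α ≠ 0) {G : ℝ → ℂ} :
    Integrable G (discreteMeasure q α) ↔
      Summable fun i : ℕ => ‖pointMass q α i • G (eigenvalueB q α (⌊logb q |α|⌋ + 1 + i))‖ := by
  rw [discreteMeasure, integrable_sum_dirac_iff fun _ => ENNReal.ofReal_ne_top]
  simp_rw [ENNReal.toReal_ofReal (pointMass_nonneg hq0 hq1 hα _), norm_smul,
    Real.norm_of_nonneg (pointMass_nonneg hq0 hq1 hα _)]

theorem integral_discreteMeasure (hq0 : 0 < q) (hq1 : q < 1) (hα : α ≠ 0) (G : ℝ → ℂ) :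
    ∫ x, G x ∂(discreteMeasure q α) =
      ∑' i : ℕ, pointMass q α i • G (eigenvalueB q α (⌊logb q |α|⌋ + 1 + i)) := by
  rw [discreteMeasure, integral_sum_dirac fun _ => ENNReal.ofReal_ne_top]
  simp_rw [ENNReal.toReal_ofReal (pointMass_nonneg hq0 hq1 hα _)]

theorem measurable_inner_spectralFn (hq0 : 0 < q) (hq1 : q < 1) (k l : ℤ) :
    Measurable fun x => inner ℂ (spectralFn q α k x) (spectralFn q α l x) :=
  (measurable_spectralFn hq0 hq1 k).inner (measurable_spectralFn hq0 hq1 l)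

theorem integrable_inner_spectralFn (hq0 : 0 < q) (hq1 : q < 1) (hα : α ≠ 0) (k l : ℤ) :
    Integrable (fun x => inner ℂ (spectralFn q α k x) (spectralFn q α l x)) (acMeasure q α) ∧
    Integrable (fun x => inner ℂ (spectralFn q α k x) (spectralFn q α l x))
      (discreteMeasure q α) := by
  constructor
  · rw [integrable_acMeasure_iff hq0 hq1 (measurable_inner_spectralFn hq0 hq1 k l)]
    exact (integrableOn_congr_fun (fun φ hφ => inner_spectralFn_two_mul_cos hq0 hq1 k l hφ)
      measurableSet_Icc).mpr
      ((acIntegrand_integrableOn_and_integral hq0 hq1 hα k l).1.const_mul _)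
  · rw [integrable_discreteMeasure_iff hq0 hq1 hα]
    simp_rw [inner_spectralFn_eigenvalueB hq0 hq1 hα]
    exact ((summable_discreteTerm hq0 hq1 hα k l).mul_left _).norm

theorem acSet_eq (A : Set ℝ) : acSet A = Set.Icc 0 π ∩ (fun φ => 2 * cos φ) ⁻¹' A := by
  ext φ
  refine ⟨fun h => ⟨h.1, h.2.2⟩, fun h => ⟨h.1, ⟨?_, ?_⟩, h.2⟩⟩
  · linarith [neg_one_le_cos φ]
  · linarith [cos_le_one φ]

/-- Under `x = 2 cos φ` the continuous part becomes the integral over `acSet A`. The point masses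
give the sum, with the smallest admissible index `⌊log_q |α|⌋ + 1` at `i = 0`. -/
theorem setIntegral_inner_spectralFn (hq0 : 0 < q) (hq1 : q < 1) (hα : α ≠ 0) (k l : ℤ)
    {A : Set ℝ} (hA : MeasurableSet A) :
    ∫ x in A, inner ℂ (spectralFn q α k x) (spectralFn q α l x)
        ∂(acMeasure q α + discreteMeasure q α) =
      1 / (2 * (π : ℂ)) * (∫ φ in acSet A, acIntegrand q α k l φ) +
      1 / qPochInf q q ^ 2 * ∑' i : ℕ,
        (discreteSet q α A).indicator (discreteTerm q α k l) (⌊logb q |α|⌋ + 1 + i) := by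
  obtain ⟨h1, h2⟩ := integrable_inner_spectralFn hq0 hq1 hα k l
  rw [← integral_indicator hA, integral_add_measure (h1.indicator hA) (h2.indicator hA),
    integral_acMeasure hq0 hq1 ((measurable_inner_spectralFn hq0 hq1 k l).indicator hA),
    integral_discreteMeasure hq0 hq1 hα, ← integral_const_mul, ← tsum_mul_left]
  congr 1
  · have hpre : MeasurableSet ((fun φ => 2 * cos φ) ⁻¹' A) :=
      (show Measurable fun φ => 2 * cos φ by fun_prop) hA
    rw [acSet_eq, Set.inter_comm, ← Measure.restrict_restrict hpre, ← integral_indicator hpre]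
    refine setIntegral_congr_fun measurableSet_Icc fun φ hφ => ?_
    by_cases h : 2 * cos φ ∈ A
    · have h' : φ ∈ (fun φ => 2 * cos φ) ⁻¹' A := h
      simp only [Set.indicator_of_mem h, Set.indicator_of_mem h']
      exact inner_spectralFn_two_mul_cos hq0 hq1 k l hφ
    · have h' : φ ∉ (fun φ => 2 * cos φ) ⁻¹' A := h
      simp only [Set.indicator_of_notMem h, Set.indicator_of_notMem h', smul_zero]
  · refine tsum_congr fun i => ?_
    by_cases h : eigenvalueB q α (⌊logb q |α|⌋ + 1 + i) ∈ A
    · have h' : ⌊logb q |α|⌋ + 1 + (i : ℤ) ∈ discreteSet q α A := ⟨by omega, h⟩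
      rw [Set.indicator_of_mem h, Set.indicator_of_mem h',
        inner_spectralFn_eigenvalueB hq0 hq1 hα]
    · have h' : ⌊logb q |α|⌋ + 1 + (i : ℤ) ∉ discreteSet q α A := fun h' => h h'.2
      rw [Set.indicator_of_notMem h, Set.indicator_of_notMem h', smul_zero, mul_zero]

theorem memLp_spectralFn (hq0 : 0 < q) (hq1 : q < 1) (hα : α ≠ 0) (n : ℤ) :
    MemLp (spectralFn q α n) 2 (acMeasure q α + discreteMeasure q α) := by
  rw [memLp_two_iff_integrable_sq_norm (measurable_spectralFn hq0 hq1 n).aestronglyMeasurable]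
  obtain ⟨h1, h2⟩ := integrable_inner_spectralFn hq0 hq1 hα n n
  refine (h1.add_measure h2).norm.congr (ae_of_all _ fun x => ?_)
  simp [sq]

theorem integral_inner_spectralFn (hq0 : 0 < q) (hq1 : q < 1) (hα : α ≠ 0) (k l : ℤ) :
    ∫ x, inner ℂ (spectralFn q α k x) (spectralFn q α l x)
        ∂(acMeasure q α + discreteMeasure q α) = if k = l then 1 else 0 := by
  rw [← setIntegral_univ, setIntegral_inner_spectralFn hq0 hq1 hα k l MeasurableSet.univ,
    ← spectral_orthonormality hq0 hq1 hα, acSet_eq, Set.preimage_univ, Set.inter_univ]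
  have h : ∀ i : ℕ, (discreteSet q α Set.univ).indicator (discreteTerm q α k l)
      (⌊logb q |α|⌋ + 1 + i) = discreteTerm q α k l (⌊logb q |α|⌋ + 1 + i) := fun i =>
    Set.indicator_of_mem (show _ ∈ discreteSet q α Set.univ from ⟨by omega, Set.mem_univ _⟩) _
  simp_rw [h]

theorem injective_add_natCast (j : ℤ) : Function.Injective fun i : ℕ => j + 1 + (i : ℤ) :=
  fun a b h => by simpa using h

theorem exists_natCast_of_mem_discreteSet {A : Set ℝ} {m : ℤ} (hm : m ∈ discreteSet q α A) :
    m ∈ Set.range fun i : ℕ => ⌊logb q |α|⌋ + 1 + (i : ℤ) := by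
  have := hm.1
  exact ⟨(m - (⌊logb q |α|⌋ + 1)).toNat, by simp only; omega⟩

theorem summable_discreteTerm_discreteSet (hq0 : 0 < q) (hq1 : q < 1) (hα : α ≠ 0) (k l : ℤ)
    (A : Set ℝ) : Summable fun m : discreteSet q α A => discreteTerm q α k l m := by
  refine (summable_subtype_iff_indicator (f := discreteTerm q α k l)
    (s := discreteSet q α A)).mpr ?_
  rw [← (injective_add_natCast ⌊logb q |α|⌋).summable_iff]
  · refine Summable.of_norm_bounded (summable_discreteTerm hq0 hq1 hα k l).norm fun i => ?_
    exact norm_indicator_le_norm_self _ _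
  · exact fun m hm => Set.indicator_of_notMem
      (fun h => hm (exists_natCast_of_mem_discreteSet h)) _

theorem tsum_discreteTerm_discreteSet (k l : ℤ) (A : Set ℝ) :
    ∑' i : ℕ, (discreteSet q α A).indicator (discreteTerm q α k l) (⌊logb q |α|⌋ + 1 + i) =
      ∑' m : discreteSet q α A, discreteTerm q α k l m := by
  rw [tsum_subtype (discreteSet q α A) (discreteTerm q α k l)]
  refine (injective_add_natCast ⌊logb q |α|⌋).tsum_eq fun m hm => ?_
  exact exists_natCast_of_mem_discreteSet (Set.mem_of_indicator_ne_zero hm)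

end SpectralRepresentation

/-! ### The spectral theorem for `B` -/

theorem mainTheorem3 (q α : ℝ) (hq0 : 0 < q) (hq1 : q < 1) (hα : α ≠ 0) :
    (∃ E : ProjValuedMeasure EllTwo, E.IsSpectralMeasureOf (schrodingerB q α)) ∧
    ∀ E : ProjValuedMeasure EllTwo, E.IsSpectralMeasureOf (schrodingerB q α) →
      ∀ 𝒜 : Set ℝ, MeasurableSet 𝒜 → ∀ k l : ℤ,
        IntegrableOn (acIntegrand q α k l) (acSet 𝒜) ∧
        Summable (fun m : discreteSet q α 𝒜 => discreteTerm q α k l m) ∧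
        inner ℂ (stdBasis k) (E.toFun 𝒜 (stdBasis l)) =
          1 / (2 * (Real.pi : ℂ)) * (∫ φ in acSet 𝒜, acIntegrand q α k l φ) +
          1 / qPochInf q q ^ 2 * ∑' m : discreteSet q α 𝒜, discreteTerm q α k l m := by
  obtain ⟨hex, huniq⟩ := schrodingerB_spectralMeasure hα (memLp_spectralFn hq0 hq1 hα)
    (integral_inner_spectralFn hq0 hq1 hα)
    fun n => ae_of_all _ (spectralFn_recurrence hq0 hq1 hα n)
  refine ⟨hex, fun E hE 𝒜 h𝒜 k l => ⟨?_, summable_discreteTerm_discreteSet hq0 hq1 hα k l 𝒜, ?_⟩⟩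
  · exact (acIntegrand_integrableOn_and_integral hq0 hq1 hα k l).1.mono_set fun φ hφ => hφ.1
  · rw [huniq E hE 𝒜 h𝒜 k l, setIntegral_inner_spectralFn hq0 hq1 hα k l h𝒜,
      tsum_discreteTerm_discreteSet]
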